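/- **Theorem (variance bound).** Let $\xi$ be a random variable with values in $\{0,1,2,\dots\}$, $\mathbb E\,\xi=1$ and $0<\operatorname{Var}\xi<\infty$. Let $\mathcal T$ be the Galton–Watson tree with offspring distribution $\xi$, regarded as a random ordered rooted tree: it is grown from a root by giving every node a number of children that is an independent copy of $\xi$. Write $|T|$ for the number of nodes of a tree $T$, and, for $n$ with $\mathbb P(|\mathcal T|=n)>0$, let $\mathcal T_n$ be $\mathcal T$ conditioned on $|\mathcal T|=n$. For a functional $f:\mathfrak T\to\mathbb R$ on the set $\mathfrak T$ of finite ordered rooted trees put $$F(T)=\sum_{v\in T} f(T_v),\qquad T\in\mathfrak T,$$ where $T_v$ is the subtree of $T$ consisting of the node $v$ and all its descendants. Then there is a constant $C<\infty$, depending only on the distribution of $\xi$, such that for every functional $f:\mathfrak T\to\mathbb R$ and every $n$ with $\mathbb P(|\mathcal T|=n)>0$, $$\operatorname{Var}\bigl(F(\mathcal T_n)\bigr)^{1/2}\le C\,n^{1/2}\Bigl(\sup_{k}\sqrt{\mathbb E f(\mathcal T_k)^2}+\sum_{k}\frac{\sqrt{\mathbb E f(\mathcal T_k)^2}}{k}\Bigr),$$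 where the supremum and the sum extend over all $k\ge1$ with $\mathbb P(|\mathcal T|=k)>0$, and the right-hand side may be $+\infty$. -/

import Mathlib

open MeasureTheory ProbabilityTheory
open scoped ENNReal NNReal

/-- Finite ordered (plane) rooted trees, up to isomorphism: a root with `d` children, together
with the ordered list of the `d` branches (the subtrees rooted at the children). -/
inductive PlaneTree : Type
  | node (d : ℕ) (branch : Fin d → PlaneTree) : PlaneTree

namespace PlaneTree

/-- The multiset of all fringe subtrees `T_v`, one for every node `v` of `T`: the node `v` is
either the root, with `T_v = T`, or a node of one of the branches. -/
def fringeSubtrees : PlaneTree → Multiset PlaneTree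
  | node d c => node d c ::ₘ ∑ i : Fin d, fringeSubtrees (c i)

/-- The number of nodes of `T`. -/
def size : PlaneTree → ℕ
  | node d c => 1 + ∑ i : Fin d, size (c i)

/-- The additive functional `F(T) = ∑_{v ∈ T} f(T_v)`. -/
noncomputable def additiveFunctional (f : PlaneTree → ℝ) (T : PlaneTree) : ℝ :=
  (T.fringeSubtrees.map f).sum

/-- Nodes of a random family tree are addressed by words over `ℕ` (Ulam-Harris notation): `[]` is
the root, and `i :: v` is the node with address `v` in the `i`-th branch (counted from `0`). If
`ω v` is the number of children that the potential node `v` gets, `T.IsFamilyTree ω` says that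
the tree grown from the root according to `ω` is the finite tree `T`. -/
def IsFamilyTree : PlaneTree → (List ℕ → ℕ) → Prop
  | node d c, ω => ω [] = d ∧ ∀ i : Fin d, IsFamilyTree (c i) (fun v => ω ((i : ℕ) :: v))

/-- The countable set of finite plane trees is given the discrete σ-algebra. -/
instance : MeasurableSpace PlaneTree := ⊤

end PlaneTree

/-- The law of a family `(ξ_v)` of independent copies of the offspring variable, indexed by the
potential nodes `v`; `ν` is the offspring distribution. -/
noncomputable def offspringMeasure (ν : Measure ℕ) [IsProbabilityMeasure ν] :
    Measure (List ℕ → ℕ) :=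
  Measure.infinitePi fun _ : List ℕ => ν

/-- The law of the Galton-Watson tree `𝒯` with offspring distribution `ν`, on the finite trees:
the mass at `T` is the probability that the tree grown from independent offspring numbers
is `T`. -/
noncomputable def galtonWatson (ν : Measure ℕ) [IsProbabilityMeasure ν] : Measure PlaneTree :=
  Measure.sum fun T : PlaneTree =>
    offspringMeasure ν {ω | T.IsFamilyTree ω} • Measure.dirac T

/-- The law of the conditioned Galton-Watson tree `𝒯_n`, that is, of `𝒯` given `|𝒯| = n`. -/
noncomputable def conditionedGaltonWatson (ν : Measure ℕ) [IsProbabilityMeasure ν] (n : ℕ) :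
    Measure PlaneTree :=
  (galtonWatson ν)[|{T | T.size = n}]

/-- The sizes `n` with `ℙ(|𝒯| = n) > 0`, for which `𝒯_n` is defined. -/
def admissibleSizes (ν : Measure ℕ) [IsProbabilityMeasure ν] : Set ℕ :=
  {n | 0 < galtonWatson ν {T | T.size = n}}

/-!
Write `F` for the additive functional with toll function `f`, and `w(T)` for the probability of the
tree `T`. Only finitely many trees have a given size, so that all conditional expectations are
finite sums `treeSum` of `w(T) f(T)` over the trees of size `n`, divided by the total weight `π n`.

*Exact moments.* Let `τ` be the generating function of the weights, so that `τ = X Φ(τ)` for the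
generating function `Φ` of the offspring distribution, and let `Q = 1 / (1 - X Φ'(τ))`. Splitting a
tree at its root gives the generating functions of the first two moments of `F`
(`treeSeries_additiveFunctional`, `treeSeries_additiveFunctional_sq`): the generating function of
`F` is `Q` times that of `f`, and the one of `F²` has a part `Q` for the pairs of nested fringe
subtrees and a part `X Φ''(τ) Q³` for the pairs of disjoint ones. Lagrange inversion
(`coeff_subst_mul_spineSeries`) identifies the coefficients of `Q` and `X Φ''(τ) Q³`, and `n π n`,
with the probabilities `q m = ℙ(S_m = m)`, `(m + 1) ℙ(S_m = m + 1)` and `ℙ(S_n = n - 1)` of the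
random walk `S` with step distribution `ξ`.

*Local estimates.* These probabilities are Fourier integrals over a period of the characteristic
function `φ` of `ξ - 1`. All upper bounds follow from `|φ(t)| ≤ exp(-c t²)` on a period and
`1 - exp(i t) φ(t) ^ l = O(√l |t|)`; the lower bound for `ℙ(S_n = n - 1)` is the local limit theorem.
They are collected in `LocalLimitBounds`.

*Variance.* With `a k = 𝔼 f(𝒯_k)`, decompose `f = g + h`, where `h(T) = a |T|` and `g` has conditional
mean `0` for every size. For `g` the disjoint pairs do not contribute to the second moment, and
Cauchy-Schwarz bounds the nested ones by the second moments for smaller sizes, so that an induction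
on the size applies (`LocalLimitBounds.treeSum_sq_le_of_centred`). For `h` the nested and the disjoint
pairs are both too large, but they cancel to leading order: for sizes `l ≤ k` the difference
contains factors `q (k - l) - k π k`, and a remainder in which the increments of the local
probabilities over `k` and over `l` steps combine to the second order difference whose Fourier
integrand has the factor `(1 - exp(i t) φ ^ k) (1 - exp(i t) φ ^ l)`
(`LocalLimitBounds.abs_kernel_le`, `LocalLimitBounds.abs_treeSum_sq_sub_le`). In both parts the
resulting sums are convolutions of `√(𝔼 f(𝒯_k)²) / k` with `1 / √m`, which
`sum_div_mul_invSqrtSucc_le` bounds in terms of the supremum and the sum in the statement.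
-/

/-! ### Weighted sums over the plane trees of a given size -/

namespace PlaneTree

/-- The weight `∏_{v ∈ T} p (number of children of v)` of a plane tree. -/
def weight (p : ℕ → ℝ) : PlaneTree → ℝ
  | node d c => p d * ∏ i : Fin d, weight p (c i)

theorem size_pos (T : PlaneTree) : 0 < T.size := by
  cases T with
  | node d c => simp [size]

theorem weight_nonneg {p : ℕ → ℝ} (hp : ∀ i, 0 ≤ p i) (T : PlaneTree) : 0 ≤ T.weight p := by
  induction T with
  | node d c ih => exact mul_nonneg (hp d) (Finset.prod_nonneg fun i _ => ih i)

theorem additiveFunctional_node (f : PlaneTree → ℝ) (d : ℕ) (c : Fin d → PlaneTree) :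
    (node d c).additiveFunctional f = f (node d c) + ∑ i, (c i).additiveFunctional f := by
  have h : ∀ s : Finset (Fin d), ((∑ i ∈ s, fringeSubtrees (c i)).map f).sum
      = ∑ i ∈ s, ((c i).fringeSubtrees.map f).sum := by
    intro s
    induction s using Finset.cons_induction with
    | empty => simp
    | cons a s ha ih => rw [Finset.sum_cons, Finset.sum_cons, Multiset.map_add,
        Multiset.sum_add, ih]
  simp only [additiveFunctional, fringeSubtrees, Multiset.map_cons, Multiset.sum_cons, h]

theorem additiveFunctional_add (f g : PlaneTree → ℝ) (T : PlaneTree) :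
    T.additiveFunctional (fun T => f T + g T)
      = T.additiveFunctional f + T.additiveFunctional g := by
  simp [additiveFunctional, Multiset.sum_map_add]

theorem additiveFunctional_one (T : PlaneTree) :
    T.additiveFunctional (fun _ => 1) = T.size := by
  induction T with
  | node d c ih => simp [additiveFunctional_node, size, ih]

/-- The finite set of plane trees in which every node, at depth `j` say, satisfies `j < N` and has
fewer than `N - j` children. It contains all trees with at most `N` nodes, and it is easy to
decompose at the root, unlike the set of these trees. -/
noncomputable def treesBelow : ℕ → Finset PlaneTree
  | 0 => ∅
  | N + 1 => ((Finset.range (N + 1)).sigma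
      fun d => Fintype.piFinset fun _ : Fin d => treesBelow N).map
        ⟨fun x => node x.1 x.2, fun x y h => by
          cases x; cases y; simp only [node.injEq] at h; exact Sigma.ext h.1 h.2⟩

theorem mem_treesBelow {T : PlaneTree} {N : ℕ} (h : T.size ≤ N) : T ∈ treesBelow N := by
  induction T generalizing N with
  | node d c ih =>
    rw [size] at h
    obtain ⟨M, rfl⟩ : ∃ M, N = M + 1 := ⟨N - 1, by omega⟩
    have hd : d ≤ ∑ i : Fin d, (c i).size := by
      simpa using Finset.card_nsmul_le_sum Finset.univ (fun i => (c i).size) 1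
        fun i _ => (c i).size_pos
    refine Finset.mem_map.2 ⟨⟨d, c⟩, ?_, rfl⟩
    simp only [Finset.mem_sigma, Finset.mem_range, Fintype.mem_piFinset]
    refine ⟨by omega, fun i => ih i ?_⟩
    have := Finset.single_le_sum (f := fun i => (c i).size) (fun _ _ => Nat.zero_le _)
      (Finset.mem_univ i)
    omega

/-- The finite set of plane trees with `n` nodes. -/
noncomputable def treesOfSize (n : ℕ) : Finset PlaneTree :=
  (treesBelow n).filter fun T => T.size = n

@[simp]
theorem mem_treesOfSize {n : ℕ} {T : PlaneTree} : T ∈ treesOfSize n ↔ T.size = n := by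
  simp only [treesOfSize, Finset.mem_filter, and_iff_right_iff_imp]
  exact fun h => mem_treesBelow h.le

end PlaneTree

open PlaneTree

/-- The sum of `w(T) f(T)` over the plane trees `T` with `n` nodes, where `w` is the weight given
by the offspring probabilities `p`. -/
noncomputable def treeSum (p : ℕ → ℝ) (f : PlaneTree → ℝ) (n : ℕ) : ℝ :=
  ∑ T ∈ treesOfSize n, T.weight p * f T

theorem treeSum_add (p : ℕ → ℝ) (f g : PlaneTree → ℝ) (n : ℕ) :
    treeSum p (fun T => f T + g T) n = treeSum p f n + treeSum p g n := by
  simp [treeSum, mul_add, Finset.sum_add_distrib]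

theorem treeSum_congr {p : ℕ → ℝ} {f g : PlaneTree → ℝ} {n : ℕ}
    (h : ∀ T : PlaneTree, T.size = n → f T = g T) : treeSum p f n = treeSum p g n :=
  Finset.sum_congr rfl fun T hT => by rw [h T (mem_treesOfSize.1 hT)]

theorem treeSum_const_mul (p : ℕ → ℝ) (f : PlaneTree → ℝ) (n : ℕ) (a : ℝ) :
    treeSum p (fun T => a * f T) n = a * treeSum p f n := by
  simp only [treeSum, Finset.mul_sum]
  exact Finset.sum_congr rfl fun T _ => by ring

theorem treeSum_mono {p : ℕ → ℝ} (hp : ∀ i, 0 ≤ p i) {f g : PlaneTree → ℝ} {n : ℕ}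
    (h : ∀ T : PlaneTree, T.size = n → f T ≤ g T) : treeSum p f n ≤ treeSum p g n :=
  Finset.sum_le_sum fun T hT =>
    mul_le_mul_of_nonneg_left (h T (mem_treesOfSize.1 hT)) (T.weight_nonneg hp)

theorem treeSum_nonneg {p : ℕ → ℝ} (hp : ∀ i, 0 ≤ p i) {f : PlaneTree → ℝ} {n : ℕ}
    (h : ∀ T : PlaneTree, T.size = n → 0 ≤ f T) : 0 ≤ treeSum p f n :=
  Finset.sum_nonneg fun T hT => mul_nonneg (T.weight_nonneg hp) (h T (mem_treesOfSize.1 hT))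

theorem treeSum_zero_size (p : ℕ → ℝ) (f : PlaneTree → ℝ) : treeSum p f 0 = 0 := by
  simp [treeSum, treesOfSize, treesBelow]

/-- The Cauchy-Schwarz inequality for weighted sums over trees. -/
theorem treeSum_mul_le {p : ℕ → ℝ} (hp : ∀ i, 0 ≤ p i) (f g : PlaneTree → ℝ) (n : ℕ) :
    treeSum p (fun T => f T * g T) n ^ 2
      ≤ treeSum p (fun T => f T ^ 2) n * treeSum p (fun T => g T ^ 2) n := by
  have h := Finset.sum_mul_sq_le_sq_mul_sq (treesOfSize n)
    (fun T => √(T.weight p) * f T) (fun T => √(T.weight p) * g T)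
  have hs : ∀ T : PlaneTree, √(T.weight p) * √(T.weight p) = T.weight p := fun T =>
    Real.mul_self_sqrt (T.weight_nonneg hp)
  have e1 : ∀ (T : PlaneTree) (a b : ℝ), √(T.weight p) * a * (√(T.weight p) * b)
      = T.weight p * (a * b) := fun T a b => by
      linear_combination a * b * hs T
  simpa only [treeSum, pow_two, e1] using h

/-! ### Generating functions of trees -/

open PowerSeries

/-- The generating function `∑_T w(T) f(T) X^|T|`. -/
noncomputable def treeSeries (p : ℕ → ℝ) (f : PlaneTree → ℝ) : ℝ⟦X⟧ :=
  PowerSeries.mk (treeSum p f)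

/-- The part of `treeSeries p f` that comes from the finitely many trees of `treesBelow N`. -/
noncomputable def treeSeriesBelow (p : ℕ → ℝ) (f : PlaneTree → ℝ) (N : ℕ) : ℝ⟦X⟧ :=
  ∑ T ∈ treesBelow N, (C (T.weight p) * X ^ T.size) * C (f T)

/-- The generating function agrees up to order `N` with the one of the finite set `treesBelow N`. -/
theorem X_pow_dvd_treeSeries_sub (p : ℕ → ℝ) (f : PlaneTree → ℝ) (N : ℕ) :
    (X : ℝ⟦X⟧) ^ (N + 1) ∣ treeSeries p f - treeSeriesBelow p f N := by
  rw [X_pow_dvd_iff]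
  intro n hn
  have h1 : ∀ T : PlaneTree, coeff n ((C (T.weight p) * X ^ T.size) * C (f T))
      = if T.size = n then T.weight p * f T else 0 := by
    intro T
    rw [coeff_mul_C, coeff_C_mul, coeff_X_pow]
    by_cases h : n = T.size
    · simp [h]
    · simp [h, Ne.symm h]
  have h2 : (treesBelow N).filter (fun T => T.size = n) = treesOfSize n := by
    ext T
    simp only [Finset.mem_filter, mem_treesOfSize, and_iff_right_iff_imp]
    exact fun h => mem_treesBelow (by omega)
  rw [map_sub, treeSeries, coeff_mk, treeSeriesBelow, map_sum, Finset.sum_congr rfl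
    fun T _ => h1 T, ← Finset.sum_filter, h2, treeSum, sub_self]

/-- The generating function of the offspring probabilities. -/
noncomputable def offspringSeries (p : ℕ → ℝ) : ℝ⟦X⟧ := PowerSeries.mk p

section Moments

variable {α R : Type*} [CommRing R]

theorem sum_piFinset_succ {M : Type*} [AddCommMonoid M] (S : Finset α) (d : ℕ)
    (h : (Fin (d + 1) → α) → M) :
    ∑ c ∈ Fintype.piFinset (fun _ : Fin (d + 1) => S), h c
      = ∑ a ∈ S, ∑ c ∈ Fintype.piFinset (fun _ : Fin d => S), h (Fin.cons a c) := by
  rw [← Finset.sum_product']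
  refine Finset.sum_bij' (fun c _ => (c 0, Fin.tail c)) (fun x _ => Fin.cons x.1 x.2)
    ?_ ?_ ?_ ?_ ?_
  · intro c hc
    simp only [Fintype.mem_piFinset, Finset.mem_product] at hc ⊢
    exact ⟨hc 0, fun i => hc i.succ⟩
  · intro x hx
    simp only [Fintype.mem_piFinset, Finset.mem_product] at hx ⊢
    exact Fin.cases hx.1 hx.2
  · intro c _; simp
  · intro x _; simp
  · intro c _; simp

/-- For independent branches with weights `u`, the total weight of the `d`-tuples. The next two
lemmas give the first and second moment of `∑ F` over the branches. -/
theorem sum_piFinset_prod (S : Finset α) (u : α → R) (d : ℕ) :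
    ∑ c ∈ Fintype.piFinset (fun _ : Fin d => S), ∏ i, u (c i) = (∑ a ∈ S, u a) ^ d := by
  rw [← Finset.prod_univ_sum]; simp

theorem sum_piFinset_prod_mul_sum (S : Finset α) (u F : α → R) (d : ℕ) :
    ∑ c ∈ Fintype.piFinset (fun _ : Fin d => S), (∏ i, u (c i)) * ∑ i, F (c i)
      = d * (∑ a ∈ S, u a) ^ (d - 1) * ∑ a ∈ S, u a * F a := by
  induction d with
  | zero => simp
  | succ d ih =>
    have h : ∀ a, ∑ c ∈ Fintype.piFinset (fun _ : Fin d => S),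
        (∏ i, u ((Fin.cons a c : Fin (d + 1) → α) i))
          * ∑ i, F ((Fin.cons a c : Fin (d + 1) → α) i)
        = (u a * F a) * (∑ a ∈ S, u a) ^ d
          + u a * (d * (∑ a ∈ S, u a) ^ (d - 1) * ∑ a ∈ S, u a * F a) := by
      intro a
      rw [← ih, ← sum_piFinset_prod S u d, Finset.mul_sum, Finset.mul_sum,
        ← Finset.sum_add_distrib]
      refine Finset.sum_congr rfl fun c _ => ?_
      simp only [Fin.prod_univ_succ, Fin.sum_univ_succ, Fin.cons_zero, Fin.cons_succ]
      ring
    rw [sum_piFinset_succ, Finset.sum_congr rfl fun a _ => h a, Finset.sum_add_distrib,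
      ← Finset.sum_mul, ← Finset.sum_mul]
    rcases d with _ | d
    · simp
    · rw [Nat.add_sub_cancel, Nat.add_sub_cancel]
      push_cast
      ring

theorem sum_piFinset_prod_mul_sum_sq (S : Finset α) (u F : α → R) (d : ℕ) :
    ∑ c ∈ Fintype.piFinset (fun _ : Fin d => S), (∏ i, u (c i)) * (∑ i, F (c i)) ^ 2
      = d * (∑ a ∈ S, u a) ^ (d - 1) * ∑ a ∈ S, u a * F a ^ 2
        + d * (d - 1 : ℕ) * (∑ a ∈ S, u a) ^ (d - 2) * (∑ a ∈ S, u a * F a) ^ 2 := by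
  induction d with
  | zero => simp
  | succ d ih =>
    have h : ∀ a, ∑ c ∈ Fintype.piFinset (fun _ : Fin d => S),
        (∏ i, u ((Fin.cons a c : Fin (d + 1) → α) i))
          * (∑ i, F ((Fin.cons a c : Fin (d + 1) → α) i)) ^ 2
        = (u a * F a ^ 2) * (∑ a ∈ S, u a) ^ d
          + (u a * F a) * (2 * (d * (∑ a ∈ S, u a) ^ (d - 1) * ∑ a ∈ S, u a * F a))
          + u a * (d * (∑ a ∈ S, u a) ^ (d - 1) * ∑ a ∈ S, u a * F a ^ 2
        + d * (d - 1 : ℕ) * (∑ a ∈ S, u a) ^ (d - 2) * (∑ a ∈ S, u a * F a) ^ 2) := by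
      intro a
      rw [← ih, ← sum_piFinset_prod S u d, ← sum_piFinset_prod_mul_sum S u F d, Finset.mul_sum,
        Finset.mul_sum, Finset.mul_sum, Finset.mul_sum, ← Finset.sum_add_distrib,
        ← Finset.sum_add_distrib]
      refine Finset.sum_congr rfl fun c _ => ?_
      simp only [Fin.prod_univ_succ, Fin.sum_univ_succ, Fin.cons_zero, Fin.cons_succ]
      ring
    rw [sum_piFinset_succ, Finset.sum_congr rfl fun a _ => h a, Finset.sum_add_distrib,
      Finset.sum_add_distrib, ← Finset.sum_mul, ← Finset.sum_mul, ← Finset.sum_mul]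
    rcases d with _ | _ | d
    · simp
    · simp; ring
    · rw [show d + 1 + 1 - 1 = d + 1 by omega, show d + 1 + 1 - 2 = d by omega,
        show d + 1 + 1 + 1 - 1 = d + 2 by omega, show d + 1 + 1 + 1 - 2 = d + 1 by omega]
      push_cast
      ring

end Moments

/-- A power series in `g`, with `g` without constant term, is up to order `N` a polynomial
in `g`. -/
theorem X_pow_dvd_subst_sub {g : ℝ⟦X⟧} (hg : constantCoeff g = 0) (H : ℝ⟦X⟧) (N : ℕ) :
    (X : ℝ⟦X⟧) ^ N ∣ H.subst g - ∑ d ∈ Finset.range N, C (coeff d H) * g ^ d := by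
  have hs : HasSubst g := HasSubst.of_constantCoeff_zero' hg
  obtain ⟨K, hK⟩ : (X : ℝ⟦X⟧) ^ N ∣ H - (trunc N H : ℝ⟦X⟧) := by
    rw [X_pow_dvd_iff]
    intro n hn
    simp [coeff_trunc, hn]
  have h1 : H = (trunc N H : ℝ⟦X⟧) + X ^ N * K := by rw [← hK]; ring
  have h2 : H.subst g = (trunc N H : ℝ⟦X⟧).subst g + g ^ N * K.subst g := by
    conv_lhs => rw [h1]
    rw [subst_add hs, subst_mul hs, subst_pow hs, subst_X hs]
  have h3 : (trunc N H : ℝ⟦X⟧).subst g = ∑ d ∈ Finset.range N, C (coeff d H) * g ^ d := by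
    rw [subst_coe hs, Polynomial.aeval_def, eval₂_trunc_eq_sum_range]
    rfl
  rw [h2, h3, add_sub_cancel_left]
  exact (pow_dvd_pow_of_dvd (X_dvd_iff.2 hg) N).mul_right _ 

theorem eq_of_forall_mk_eq {A B : ℝ⟦X⟧}
    (h : ∀ N, Ideal.Quotient.mk (Ideal.span {(X : ℝ⟦X⟧) ^ N}) A
      = Ideal.Quotient.mk (Ideal.span {(X : ℝ⟦X⟧) ^ N}) B) : A = B := by
  ext n
  have h1 := h (n + 1)
  rw [Ideal.Quotient.eq, Ideal.mem_span_singleton, X_pow_dvd_iff] at h1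
  have h2 := h1 n (Nat.lt_succ_self n)
  rwa [map_sub, sub_eq_zero] at h2

theorem mk_treeSeries (p : ℕ → ℝ) (f : PlaneTree → ℝ) {N M : ℕ} (h : M ≤ N + 1) :
    Ideal.Quotient.mk (Ideal.span {(X : ℝ⟦X⟧) ^ M}) (treeSeries p f)
      = Ideal.Quotient.mk (Ideal.span {(X : ℝ⟦X⟧) ^ M}) (treeSeriesBelow p f N) := by
  rw [Ideal.Quotient.eq, Ideal.mem_span_singleton]
  exact (pow_dvd_pow X h).trans (X_pow_dvd_treeSeries_sub p f N)

theorem mk_subst {g : ℝ⟦X⟧} (hg : constantCoeff g = 0) (H : ℝ⟦X⟧) {N M : ℕ} (h : M ≤ N) :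
    Ideal.Quotient.mk (Ideal.span {(X : ℝ⟦X⟧) ^ M}) (H.subst g)
      = ∑ d ∈ Finset.range N, Ideal.Quotient.mk (Ideal.span {(X : ℝ⟦X⟧) ^ M}) (C (coeff d H))
          * Ideal.Quotient.mk (Ideal.span {(X : ℝ⟦X⟧) ^ M}) g ^ d := by
  have h1 : Ideal.Quotient.mk (Ideal.span {(X : ℝ⟦X⟧) ^ M}) (H.subst g)
      = Ideal.Quotient.mk (Ideal.span {(X : ℝ⟦X⟧) ^ M})
          (∑ d ∈ Finset.range N, C (coeff d H) * g ^ d) := by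
    rw [Ideal.Quotient.eq, Ideal.mem_span_singleton]
    exact (pow_dvd_pow X h).trans (X_pow_dvd_subst_sub hg H N)
  rw [h1, map_sum]
  simp only [map_mul, map_pow]

theorem constantCoeff_treeSeries (p : ℕ → ℝ) (f : PlaneTree → ℝ) :
    constantCoeff (treeSeries p f) = 0 := by
  rw [← coeff_zero_eq_constantCoeff_apply, treeSeries, coeff_mk, treeSum_zero_size]

/-- Decomposition of the trees at the root. -/
theorem treeSeriesBelow_succ (p : ℕ → ℝ) (f : PlaneTree → ℝ) (N : ℕ) :
    treeSeriesBelow p f (N + 1) = X * ∑ d ∈ Finset.range (N + 1), C (p d) *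
      ∑ c ∈ Fintype.piFinset (fun _ : Fin d => treesBelow N),
        (∏ i, (C ((c i).weight p) * X ^ (c i).size)) * C (f (node d c)) := by
  rw [treeSeriesBelow, treesBelow, Finset.sum_map, Finset.sum_sigma, Finset.mul_sum]
  refine Finset.sum_congr rfl fun d _ => ?_
  rw [Finset.mul_sum, Finset.mul_sum]
  refine Finset.sum_congr rfl fun c _ => ?_
  change C (weight p (node d c)) * X ^ (node d c).size * C (f (node d c)) = _
  simp only [weight, size, map_mul, map_prod, pow_add, pow_one,
    Finset.prod_mul_distrib, Finset.prod_pow_eq_pow_sum]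
  ring

theorem treeSeriesBelow_one (p : ℕ → ℝ) (N : ℕ) :
    treeSeriesBelow p (fun _ => 1) N = ∑ T ∈ treesBelow N, C (T.weight p) * X ^ T.size := by
  simp [treeSeriesBelow]

section FunctionalEquations

variable (p : ℕ → ℝ)

/-- The functional equation `τ = X Φ(τ)`. -/
theorem treeSeries_one_eq :
    treeSeries p (fun _ => 1)
      = X * (offspringSeries p).subst (treeSeries p fun _ => 1) := by
  refine eq_of_forall_mk_eq fun N => ?_
  have h0 := constantCoeff_treeSeries p fun _ => 1
  rw [mk_treeSeries p (fun _ => 1) (N := N + 1) (M := N) (by omega), treeSeriesBelow_succ,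
    map_mul, map_mul, mk_subst h0 _ (N := N + 1) (by omega),
    mk_treeSeries p (fun _ => 1) (N := N) (M := N) (by omega), map_sum]
  congr 1
  refine Finset.sum_congr rfl fun d _ => ?_
  simp only [map_one, mul_one]
  rw [sum_piFinset_prod (treesBelow N) (fun T => C (T.weight p) * X ^ T.size) d,
    ← treeSeriesBelow_one, map_mul, map_pow, offspringSeries, coeff_mk]

/-- Truncation of `Φ'(G)`. -/
theorem sum_range_succ_mul_pow_pred (G : ℝ⟦X⟧) (N : ℕ) :
    ∑ d ∈ Finset.range (N + 1), C (p d) * (d * G ^ (d - 1))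
      = ∑ d ∈ Finset.range N, C (coeff d (d⁄dX ℝ (offspringSeries p))) * G ^ d := by
  rw [Finset.sum_range_succ']
  simp only [Nat.cast_zero, zero_mul, mul_zero, add_zero]
  refine Finset.sum_congr rfl fun d _ => ?_
  rw [coeff_derivative, offspringSeries, coeff_mk, Nat.add_sub_cancel, map_mul]
  push_cast
  simp only [map_add, map_one, map_natCast]
  ring

/-- Truncation of `Φ''(G)`. -/
theorem sum_range_succ_mul_pow_pred_pred (G : ℝ⟦X⟧) (N : ℕ) :
    ∑ d ∈ Finset.range (N + 2), C (p d) * (d * (d - 1 : ℕ) * G ^ (d - 2))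
      = ∑ d ∈ Finset.range N,
          C (coeff d (d⁄dX ℝ (d⁄dX ℝ (offspringSeries p)))) * G ^ d := by
  rw [Finset.sum_range_succ', Finset.sum_range_succ']
  simp only [Nat.cast_zero, zero_mul, mul_zero, add_zero, zero_add, Nat.sub_self]
  refine Finset.sum_congr rfl fun d _ => ?_
  rw [coeff_derivative, coeff_derivative, offspringSeries, coeff_mk, Nat.add_sub_cancel,
    show d + 1 + 1 - 2 = d by omega]
  push_cast
  simp only [map_add, map_one, map_natCast, map_mul]
  ring

/-- First moment of a sum over the branches: each branch may be the one that carries `F`. -/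
theorem treeSeries_sum_branches {f F : PlaneTree → ℝ}
    (hf : ∀ d c, f (node d c) = ∑ i, F (c i)) :
    treeSeries p f = X * (d⁄dX ℝ (offspringSeries p)).subst (treeSeries p fun _ => 1)
      * treeSeries p F := by
  refine eq_of_forall_mk_eq fun N => ?_
  have h0 := constantCoeff_treeSeries p fun _ => 1
  rw [mk_treeSeries p f (N := N + 1) (M := N) (by omega), treeSeriesBelow_succ,
    map_mul, map_mul, map_mul, mk_subst h0 _ (N := N) le_rfl,
    mk_treeSeries p (fun _ => 1) (N := N) (M := N) (by omega),
    mk_treeSeries p F (N := N) (M := N) (by omega), mul_assoc]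
  congr 1
  simp only [← map_mul, ← map_pow, ← map_sum]
  congr 1
  rw [← sum_range_succ_mul_pow_pred, Finset.sum_mul]
  refine Finset.sum_congr rfl fun d _ => ?_
  simp only [hf, map_sum]
  rw [sum_piFinset_prod_mul_sum (treesBelow N) (fun T => C (T.weight p) * X ^ T.size)
    (fun T => C (F T)) d, ← treeSeriesBelow_one]
  simp only [treeSeriesBelow]
  ring

/-- Second moment of a sum over the branches: the factors `F` belong to the same branch, which gives
`Φ'`, or to two different ones, which gives `Φ''`. -/
theorem treeSeries_sum_branches_sq {f F : PlaneTree → ℝ}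
    (hf : ∀ d c, f (node d c) = (∑ i, F (c i)) ^ 2) :
    treeSeries p f = X * (d⁄dX ℝ (offspringSeries p)).subst (treeSeries p fun _ => 1)
        * treeSeries p (fun T => F T ^ 2)
      + X * (d⁄dX ℝ (d⁄dX ℝ (offspringSeries p))).subst (treeSeries p fun _ => 1)
        * treeSeries p F ^ 2 := by
  refine eq_of_forall_mk_eq fun N => ?_
  have h0 := constantCoeff_treeSeries p fun _ => 1
  rw [mk_treeSeries p f (N := N + 2) (M := N) (by omega), treeSeriesBelow_succ, map_add,
    map_mul, map_mul, map_mul, map_mul, map_mul, map_pow, mk_subst h0 _ (N := N + 1) (by omega),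
    mk_subst h0 _ (N := N) le_rfl,
    mk_treeSeries p (fun _ => 1) (N := N + 1) (M := N) (by omega),
    mk_treeSeries p F (N := N + 1) (M := N) (by omega),
    mk_treeSeries p (fun T => F T ^ 2) (N := N + 1) (M := N) (by omega), mul_assoc, mul_assoc,
    ← mul_add]
  congr 1
  simp only [← map_mul, ← map_pow, ← map_sum, ← map_add]
  congr 1
  rw [← sum_range_succ_mul_pow_pred, ← sum_range_succ_mul_pow_pred_pred, Finset.sum_mul,
    Finset.sum_mul, ← Finset.sum_add_distrib]
  refine Finset.sum_congr rfl fun d _ => ?_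
  simp only [hf, map_sum, map_pow]
  rw [sum_piFinset_prod_mul_sum_sq (treesBelow (N + 1)) (fun T => C (T.weight p) * X ^ T.size)
    (fun T => C (F T)) d, ← treeSeriesBelow_one]
  simp only [treeSeriesBelow, map_pow]
  ring

end FunctionalEquations

/-- The generating function `Q = 1 / (1 - X Φ'(τ))` of the trees with a marked leaf, the leaf being
counted neither in the size nor in the weight; `τ` is the generating function of the trees. -/
noncomputable def spineSeries (p : ℕ → ℝ) : ℝ⟦X⟧ :=
  (1 - X * (d⁄dX ℝ (offspringSeries p)).subst (treeSeries p fun _ => 1))⁻¹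

theorem spineSeries_mul (p : ℕ → ℝ) : spineSeries p *
    (1 - X * (d⁄dX ℝ (offspringSeries p)).subst (treeSeries p fun _ => 1)) = 1 :=
  PowerSeries.inv_mul_cancel _ (by simp)

/-- The generating function of the trees with an ordered pair of marked leaves, counted neither in
the size nor in the weight. -/
noncomputable def branchingSeries (p : ℕ → ℝ) : ℝ⟦X⟧ :=
  X * (d⁄dX ℝ (d⁄dX ℝ (offspringSeries p))).subst (treeSeries p fun _ => 1) * spineSeries p ^ 3

theorem treeSeries_add (p : ℕ → ℝ) (f g : PlaneTree → ℝ) :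
    treeSeries p (fun T => f T + g T) = treeSeries p f + treeSeries p g := by
  ext n; simp [treeSeries, treeSum_add]

/-- First moments: `F` is the toll at the root plus the sum of `F` over the branches. -/
theorem treeSeries_additiveFunctional (p : ℕ → ℝ) (f : PlaneTree → ℝ) :
    treeSeries p (additiveFunctional f) = spineSeries p * treeSeries p f := by
  have h1 : treeSeries p (additiveFunctional f) = treeSeries p f
      + treeSeries p (fun T => additiveFunctional f T - f T) := by
    rw [← treeSeries_add]; congr 1; ext T; ring
  have h2 := treeSeries_sum_branches p (f := fun T => additiveFunctional f T - f T)
    (F := additiveFunctional f) (fun d c => by rw [additiveFunctional_node]; ring)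
  rw [h2] at h1
  linear_combination spineSeries p * h1 - treeSeries p (additiveFunctional f) * spineSeries_mul p

/-- Second moments: `F² = f (2 F - f) + (F - f)²`, and `F - f` is the sum of `F` over the
branches. -/
theorem treeSeries_additiveFunctional_sq (p : ℕ → ℝ) (f : PlaneTree → ℝ) :
    treeSeries p (fun T => additiveFunctional f T ^ 2)
      = spineSeries p * treeSeries p (fun T => f T * (2 * additiveFunctional f T - f T))
        + branchingSeries p * treeSeries p f ^ 2 := by
  have h1 : treeSeries p (fun T => additiveFunctional f T ^ 2)
      = treeSeries p (fun T => f T * (2 * additiveFunctional f T - f T))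
      + treeSeries p (fun T => (additiveFunctional f T - f T) ^ 2) := by
    rw [← treeSeries_add]; congr 1; ext T; ring
  have h2 := treeSeries_sum_branches_sq p (f := fun T => (additiveFunctional f T - f T) ^ 2)
    (F := additiveFunctional f) (fun d c => by rw [additiveFunctional_node]; ring)
  rw [h2, treeSeries_additiveFunctional] at h1
  rw [branchingSeries]
  linear_combination spineSeries p * h1
    - treeSeries p (fun T => additiveFunctional f T ^ 2) * spineSeries_mul p

/-! ### Lagrange inversion -/

/-- The probability that the random walk with step distribution `p` is at `j` at time `m`. -/
noncomputable def walkProb (p : ℕ → ℝ) (m j : ℕ) : ℝ := coeff j (offspringSeries p ^ m)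

/-- Lagrange's inversion formula: if `τ = X Φ(τ)`, then
`[X^m] H(τ) / (1 - X Φ'(τ)) = [u^m] H(u) Φ(u)^m`. The induction on `m` splits off the constant term
of `H`; it uses `τ = X Φ(τ)` for the rest of `H`, and `(Φ^m)' = m Φ' Φ^(m-1)` for the constant. -/
theorem coeff_subst_mul_spineSeries (p : ℕ → ℝ) (H : ℝ⟦X⟧) (m : ℕ) :
    coeff m (H.subst (treeSeries p fun _ => 1) * spineSeries p)
      = coeff m (H * offspringSeries p ^ m) := by
  have h0 := constantCoeff_treeSeries p fun _ => 1
  have hs : HasSubst (treeSeries p fun _ => 1) := HasSubst.of_constantCoeff_zero' h0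
  have hH : ∀ H : ℝ⟦X⟧, H = X * PowerSeries.mk (fun n => coeff (n + 1) H) + C (constantCoeff H) :=
    eq_X_mul_shift_add_const
  have hQ : spineSeries p = 1 + X * ((d⁄dX ℝ (offspringSeries p)).subst (treeSeries p fun _ => 1)
      * spineSeries p) := by linear_combination spineSeries_mul p
  have hQ0 : constantCoeff (spineSeries p) = 1 := by rw [hQ]; simp
  induction m generalizing H with
  | zero =>
    rw [pow_zero, mul_one, coeff_zero_eq_constantCoeff_apply, coeff_zero_eq_constantCoeff_apply,
      map_mul, hQ0, mul_one]
    conv_lhs => rw [hH H, subst_add hs, subst_mul hs, subst_X hs, subst_C]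
    rw [map_add, map_mul, h0, zero_mul, zero_add]
    exact constantCoeff_C _
  | succ m ih =>
    set H1 := PowerSeries.mk (fun n => coeff (n + 1) H)
    have e1 : H.subst (treeSeries p fun _ => 1) * spineSeries p
        = X * ((offspringSeries p * H1).subst (treeSeries p fun _ => 1) * spineSeries p)
          + C (constantCoeff H) * spineSeries p := by
      conv_lhs => rw [hH H, subst_add hs, subst_mul hs, subst_X hs, subst_C]
      rw [subst_mul hs]
      conv_lhs => enter [1, 1, 1]; rw [treeSeries_one_eq]
      have hC : (MvPowerSeries.C (constantCoeff H) : ℝ⟦X⟧) = C (constantCoeff H) := rfl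
      rw [hC]
      ring
    have e2 : H * offspringSeries p ^ (m + 1) = X * (offspringSeries p * H1 * offspringSeries p ^ m)
        + C (constantCoeff H) * offspringSeries p ^ (m + 1) := by
      conv_lhs => rw [hH H]
      ring
    have e3 : coeff (m + 1) (spineSeries p) = coeff (m + 1) (offspringSeries p ^ (m + 1)) := by
      rw [hQ, map_add, coeff_succ_X_mul, ih, coeff_one, if_neg (Nat.succ_ne_zero m), zero_add]
      have h1 : d⁄dX ℝ (offspringSeries p ^ (m + 1)) = C ((m : ℝ) + 1) *
          (d⁄dX ℝ (offspringSeries p) * offspringSeries p ^ m) := by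
        rw [Derivation.leibniz_pow, Nat.add_sub_cancel, smul_eq_mul, nsmul_eq_mul]
        push_cast
        simp only [map_add, map_one, map_natCast]
        ring
      have h2 := congrArg (coeff m) h1
      rw [coeff_derivative, coeff_C_mul] at h2
      have h3 : (m : ℝ) + 1 ≠ 0 := by positivity
      rw [mul_comm] at h2
      exact (mul_left_cancel₀ h3 h2).symm
    rw [e1, e2, map_add, map_add, coeff_succ_X_mul,
      coeff_succ_X_mul, ih, coeff_C_mul, coeff_C_mul, e3]

theorem coeff_spineSeries (p : ℕ → ℝ) (m : ℕ) : coeff m (spineSeries p) = walkProb p m m := by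
  have hs : HasSubst (treeSeries p fun _ => 1) :=
    HasSubst.of_constantCoeff_zero' (constantCoeff_treeSeries p _)
  have h := coeff_subst_mul_spineSeries p (C 1) m
  rw [subst_C] at h
  change coeff m (C 1 * _) = _ at h
  rwa [map_one, one_mul, one_mul] at h

/-- Multiplying `∑_T w(T) f(T) X^|T|` with the size is `X` times the derivative. -/
theorem treeSeries_size_mul (p : ℕ → ℝ) (f : PlaneTree → ℝ) :
    treeSeries p (fun T => T.size * f T) = X * d⁄dX ℝ (treeSeries p f) := by
  ext n
  have h : treeSum p (fun T => T.size * f T) n = n * treeSum p f n := by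
    rw [← treeSum_const_mul]
    exact treeSum_congr fun T hT => by rw [hT]
  rw [treeSeries, coeff_mk, h]
  cases n with
  | zero => simp
  | succ n => rw [coeff_succ_X_mul, coeff_derivative, treeSeries, coeff_mk]; push_cast; ring

theorem X_mul_derivative_treeSeries (p : ℕ → ℝ) :
    X * d⁄dX ℝ (treeSeries p fun _ => 1) = spineSeries p * treeSeries p fun _ => 1 := by
  rw [← treeSeries_additiveFunctional, ← treeSeries_size_mul]
  congr 1; ext T; rw [additiveFunctional_one, mul_one]

/-- The total weight of the trees of size `n`, by Lagrange inversion. -/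
theorem mul_treeSum_one (p : ℕ → ℝ) {n : ℕ} (hn : n ≠ 0) :
    n * treeSum p (fun _ => 1) n = walkProb p n (n - 1) := by
  have hs : HasSubst (treeSeries p fun _ => 1) :=
    HasSubst.of_constantCoeff_zero' (constantCoeff_treeSeries p _)
  obtain ⟨m, rfl⟩ := Nat.exists_eq_succ_of_ne_zero hn
  have h1 := congrArg (coeff (m + 1)) (X_mul_derivative_treeSeries p)
  have h2 := coeff_subst_mul_spineSeries p X (m + 1)
  rw [subst_X hs, coeff_succ_X_mul] at h2
  rw [mul_comm (spineSeries p), h2, coeff_succ_X_mul, coeff_derivative, treeSeries, coeff_mk] at h1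
  rw [walkProb, Nat.succ_eq_add_one, Nat.add_sub_cancel, ← h1]
  push_cast; ring

/-- Lagrange inversion for `R = X Φ''(τ) Q³`. The second moment identity for the size of the tree
expresses `R` by `τ` and `Q`, and shows that `R = X K'` with `K = Q Φ'(τ) / Φ(τ)`. -/
theorem coeff_branchingSeries {p : ℕ → ℝ} (hp : p 0 ≠ 0) (m : ℕ) :
    coeff m (branchingSeries p) = (m + 1) * walkProb p m (m + 1) := by
  set τ := treeSeries p fun _ => 1 with hτ
  set Q := spineSeries p with hQ
  set R := branchingSeries p with hR
  have hs : HasSubst τ := HasSubst.of_constantCoeff_zero' (constantCoeff_treeSeries p _)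
  have hΦ : constantCoeff (offspringSeries p) ≠ 0 := by
    rw [← coeff_zero_eq_constantCoeff_apply, offspringSeries, coeff_mk]; exact hp
  set K := (d⁄dX ℝ (offspringSeries p) * (offspringSeries p)⁻¹).subst τ * Q with hK
  have hXτ : X * d⁄dX ℝ τ = Q * τ := X_mul_derivative_treeSeries p
  have hτ0 : τ ≠ 0 := by
    intro h
    have h1 := mul_treeSum_one p one_ne_zero
    have h2 : treeSum p (fun _ => 1) 1 = 0 := by
      have := congrArg (coeff 1) h
      rwa [hτ, treeSeries, coeff_mk, map_zero] at this
    rw [h2, walkProb, pow_one, offspringSeries, coeff_mk] at h1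
    exact hp (by simpa using h1.symm)
  -- the second moment identity for `f = 1`, where `F` is the size
  have h1 : τ * R = X * d⁄dX ℝ Q - Q ^ 2 + Q := by
    have h2 := treeSeries_additiveFunctional_sq p fun _ => 1
    have e1 : treeSeries p (fun T => additiveFunctional (fun _ => 1) T ^ 2)
        = X * d⁄dX ℝ (X * d⁄dX ℝ τ) := by
      rw [hτ, ← treeSeries_size_mul, ← treeSeries_size_mul]
      congr 1; ext T; rw [additiveFunctional_one]; ring
    have e2 : treeSeries p (fun T => 1 * (2 * additiveFunctional (fun _ => 1) T - 1))
        = 2 * (X * d⁄dX ℝ τ) - τ := by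
      have : treeSeries p (fun T => (T.size : ℝ) * 1) + treeSeries p (fun T => (T.size : ℝ) * 1)
          = treeSeries p (fun T => 1 * (2 * additiveFunctional (fun _ => 1) T - 1))
            + treeSeries p fun _ => 1 := by
        rw [← treeSeries_add, ← treeSeries_add]
        congr 1; ext T; rw [additiveFunctional_one]; ring
      rw [treeSeries_size_mul] at this
      linear_combination -this
    rw [e1, e2, hXτ, Derivation.leibniz, smul_eq_mul, smul_eq_mul] at h2
    apply mul_left_cancel₀ hτ0
    linear_combination -h2 + Q * hXτ
  have h2 : τ * K = Q - 1 := by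
    have e1 : (offspringSeries p).subst τ * (d⁄dX ℝ (offspringSeries p)
        * (offspringSeries p)⁻¹).subst τ = (d⁄dX ℝ (offspringSeries p)).subst τ := by
      rw [← subst_mul hs, mul_left_comm, PowerSeries.mul_inv_cancel _ hΦ, mul_one]
    have e2 : τ = X * (offspringSeries p).subst τ := treeSeries_one_eq p
    have e3 := spineSeries_mul p
    rw [hK]
    conv_lhs => enter [1]; rw [e2]
    rw [← hQ, ← hτ] at e3
    linear_combination X * Q * e1 - e3
  have h3 : R = X * d⁄dX ℝ K := by
    have e1 := congrArg (d⁄dX ℝ) h2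
    rw [Derivation.leibniz, smul_eq_mul, smul_eq_mul, map_sub, Derivation.map_one_eq_zero] at e1
    apply mul_left_cancel₀ hτ0
    linear_combination h1 - X * e1 + K * hXτ + Q * h2
  rw [h3, walkProb]
  cases m with
  | zero => simp [coeff_one]
  | succ m =>
    have e1 : d⁄dX ℝ (offspringSeries p ^ (m + 1)) = C ((m : ℝ) + 1) *
        (d⁄dX ℝ (offspringSeries p) * (offspringSeries p)⁻¹ * offspringSeries p ^ (m + 1)) := by
      rw [Derivation.leibniz_pow, Nat.add_sub_cancel, smul_eq_mul, nsmul_eq_mul]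
      push_cast
      simp only [map_add, map_one, map_natCast]
      have := PowerSeries.inv_mul_cancel _ hΦ
      linear_combination (-(m : ℝ⟦X⟧) - 1) * (offspringSeries p ^ m
        * d⁄dX ℝ (offspringSeries p)) * this
    have e2 := congrArg (coeff (m + 1)) e1
    rw [coeff_derivative, coeff_C_mul, ← coeff_subst_mul_spineSeries] at e2
    rw [coeff_succ_X_mul, coeff_derivative, hK]
    push_cast at e2 ⊢
    linear_combination -e2

/-! ### First and second moments of additive functionals -/

theorem treeSum_additiveFunctional (p : ℕ → ℝ) (f : PlaneTree → ℝ) (n : ℕ) :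
    treeSum p (additiveFunctional f) n
      = ∑ k ∈ Finset.range (n + 1), walkProb p (n - k) (n - k) * treeSum p f k := by
  have h := congrArg (coeff n) (treeSeries_additiveFunctional p f)
  rw [mul_comm, coeff_mul, Finset.Nat.sum_antidiagonal_eq_sum_range_succ_mk] at h
  simp only [coeff_spineSeries] at h
  simp only [treeSeries, coeff_mk] at h
  rw [h]
  exact Finset.sum_congr rfl fun k _ => mul_comm _ _

theorem treeSum_additiveFunctional_sq {p : ℕ → ℝ} (hp : p 0 ≠ 0) (f : PlaneTree → ℝ) (n : ℕ) :
    treeSum p (fun T => additiveFunctional f T ^ 2) n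
      = ∑ k ∈ Finset.range (n + 1), walkProb p (n - k) (n - k)
          * treeSum p (fun T => f T * (2 * additiveFunctional f T - f T)) k
        + ∑ k ∈ Finset.range (n + 1), ∑ l ∈ Finset.range (n + 1), (if k + l ≤ n then
            (((n - k - l : ℕ) : ℝ) + 1) * walkProb p (n - k - l) (n - k - l + 1) else 0)
              * (treeSum p f k * treeSum p f l) := by
  have h := congrArg (coeff n) (treeSeries_additiveFunctional_sq p f)
  rw [map_add, mul_comm, mul_comm (branchingSeries p), pow_two, mul_assoc, coeff_mul, coeff_mul,
    Finset.Nat.sum_antidiagonal_eq_sum_range_succ_mk,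
    Finset.Nat.sum_antidiagonal_eq_sum_range_succ_mk] at h
  simp only [coeff_mul, Finset.Nat.sum_antidiagonal_eq_sum_range_succ_mk, coeff_spineSeries,
    coeff_branchingSeries hp] at h
  simp only [treeSeries, coeff_mk] at h
  rw [h]
  congr 1
  · exact Finset.sum_congr rfl fun k _ => mul_comm _ _
  · refine Finset.sum_congr rfl fun k hk => ?_
    rw [Finset.mul_sum]
    have hsub : Finset.range (n - k).succ ⊆ Finset.range (n + 1) := by
      intro l; simp only [Finset.mem_range]; omega
    rw [← Finset.sum_subset hsub]
    · refine Finset.sum_congr rfl fun l hl => ?_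
      rw [Finset.mem_range] at hl hk
      rw [if_pos (by omega)]
      ring
    · intro l _ hl
      rw [Finset.mem_range] at hl hk
      rw [if_neg (by omega), zero_mul]

/-! ### The characteristic function of the centred offspring distribution -/

section CharacteristicFunction

open Filter Topology

variable (ν : Measure ℕ)

/-- The characteristic function of `ξ - 1`, where `ξ` has distribution `ν`. -/
noncomputable def centredCharFun (t : ℝ) : ℂ := charFun (ν.map fun k : ℕ => (k : ℝ) - 1) t

theorem centredCharFun_eq_integral (t : ℝ) :
    centredCharFun ν t = ∫ k : ℕ, Complex.exp (t * ((k : ℝ) - 1 : ℝ) * Complex.I) ∂ν := by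
  rw [centredCharFun, charFun_apply_real, integral_map (by fun_prop)]
  exact (by fun_prop : Continuous fun x : ℝ => Complex.exp (t * x * Complex.I)).aestronglyMeasurable

theorem charFun_standardized (σ t : ℝ) :
    charFun (ν.map fun k : ℕ => σ⁻¹ * ((k : ℝ) - 1)) t = centredCharFun ν (σ⁻¹ * t) := by
  rw [centredCharFun, charFun_map_mul_comp (by fun_prop)]

theorem integral_standardized_sq {ν : Measure ℕ} (hmean : ∫ k : ℕ, (k : ℝ) ∂ν = 1)
    (hvar : 0 < Var[fun k : ℕ => (k : ℝ); ν]) :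
    ν[(fun k : ℕ => (√Var[fun k : ℕ => (k : ℝ); ν])⁻¹ * ((k : ℝ) - 1)) ^ 2] = 1 := by
  have h : ((fun k : ℕ => (√Var[fun k : ℕ => (k : ℝ); ν])⁻¹ * ((k : ℝ) - 1)) ^ 2)
      = fun k : ℕ => (Var[fun k : ℕ => (k : ℝ); ν])⁻¹ * ((k : ℝ) - 1) ^ 2 := by
    ext k
    rw [Pi.pow_apply, mul_pow, inv_pow, Real.sq_sqrt hvar.le]
  rw [h, integral_const_mul]
  have h2 := variance_eq_integral (μ := ν) (X := fun k : ℕ => (k : ℝ)) (by fun_prop)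
  rw [hmean] at h2
  rw [← h2, inv_mul_cancel₀ hvar.ne']

/-- The span `d` of the offspring distribution: all possible values are multiples of `d`, and `d`
is in every additive subgroup of `ℤ` that contains them. -/
theorem exists_span {ν : Measure ℕ} (hmean : ∫ k : ℕ, (k : ℝ) ∂ν = 1) :
    ∃ d : ℕ, 0 < d ∧ (∀ i, ν {i} ≠ 0 → d ∣ i) ∧
      ∀ K : AddSubgroup ℤ, (∀ i : ℕ, ν {i} ≠ 0 → (i : ℤ) ∈ K) → (d : ℤ) ∈ K := by
  set S : Set ℤ := {j | ∃ i : ℕ, ν {i} ≠ 0 ∧ j = i}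
  obtain ⟨a, ha⟩ := Int.subgroup_cyclic (AddSubgroup.closure S)
  have hmem : ∀ i : ℕ, ν {i} ≠ 0 → a.natAbs ∣ i := by
    intro i hi
    have h1 : (i : ℤ) ∈ AddSubgroup.closure S := AddSubgroup.subset_closure ⟨i, hi, rfl⟩
    rw [ha, ← AddSubgroup.zmultiples_eq_closure, Int.mem_zmultiples_iff] at h1
    exact Int.natAbs_dvd_natAbs.2 h1
  refine ⟨a.natAbs, ?_, hmem, fun K hK => ?_⟩
  · rw [Nat.pos_iff_ne_zero]
    intro h0
    have : ∀ᵐ k : ℕ ∂ν, (k : ℝ) = 0 := by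
      rw [ae_iff_of_countable]
      intro k hk
      have := hmem k hk
      rw [h0, zero_dvd_iff] at this
      simp [this]
    rw [integral_congr_ae this] at hmean
    simp at hmean
  · have h1 : AddSubgroup.closure S ≤ K := by
      rw [AddSubgroup.closure_le]
      rintro _ ⟨i, hi, rfl⟩
      exact hK i hi
    have h2 : a ∈ K := h1 (by rw [ha]; exact AddSubgroup.subset_closure rfl)
    rcases Int.natAbs_eq a with h | h
    · rwa [h] at h2
    · rw [h] at h2; exact neg_mem_iff.1 h2

variable [IsProbabilityMeasure ν]

theorem continuous_centredCharFun : Continuous (centredCharFun ν) :=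
  haveI := Measure.isProbabilityMeasure_map (μ := ν) (f := fun k : ℕ => (k : ℝ) - 1) (by fun_prop)
  continuous_charFun

theorem norm_centredCharFun_le_one (t : ℝ) : ‖centredCharFun ν t‖ ≤ 1 :=
  haveI := Measure.isProbabilityMeasure_map (μ := ν) (f := fun k : ℕ => (k : ℝ) - 1) (by fun_prop)
  norm_charFun_le_one t

theorem centredCharFun_eq_tsum (t : ℝ) : centredCharFun ν t =
    Complex.exp (-(t * Complex.I)) * ∑' i : ℕ, (ν.real {i} : ℂ) * Complex.exp (t * Complex.I) ^ i := by
  rw [centredCharFun_eq_integral, integral_countable, ← tsum_mul_left]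
  · refine tsum_congr fun i => ?_
    rw [Complex.real_smul, mul_left_comm, ← Complex.exp_nat_mul, ← Complex.exp_add]
    congr 2
    push_cast; ring
  · refine Integrable.of_bound (by fun_prop) 1 (ae_of_all _ fun k => ?_)
    rw [← Complex.ofReal_mul, Complex.norm_exp_ofReal_mul_I]

variable {ν}

theorem integrable_natCast (hfin : MemLp (fun k : ℕ => (k : ℝ)) 2 ν) :
    Integrable (fun k : ℕ => (k : ℝ)) ν := hfin.integrable one_le_two

theorem integral_standardized (hfin : MemLp (fun k : ℕ => (k : ℝ)) 2 ν)
    (hmean : ∫ k : ℕ, (k : ℝ) ∂ν = 1) (σ : ℝ) :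
    ν[fun k : ℕ => σ⁻¹ * ((k : ℝ) - 1)] = 0 := by
  rw [integral_const_mul, integral_sub (integrable_natCast hfin) (integrable_const _), hmean]
  simp

theorem tendsto_centredCharFun_pow (hfin : MemLp (fun k : ℕ => (k : ℝ)) 2 ν)
    (hmean : ∫ k : ℕ, (k : ℝ) ∂ν = 1) (hvar : 0 < Var[fun k : ℕ => (k : ℝ); ν]) (t : ℝ) :
    Tendsto (fun n : ℕ => centredCharFun ν ((√n)⁻¹ * t) ^ n) atTop
      (𝓝 (Complex.exp (-(Var[fun k : ℕ => (k : ℝ); ν] * t ^ 2 / 2 : ℝ)))) := by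
  set σ := √Var[fun k : ℕ => (k : ℝ); ν] with hσ
  have hσ0 : σ ≠ 0 := (Real.sqrt_pos.2 hvar).ne'
  have h := tendsto_charFun_inv_sqrt_mul_pow (P := ν)
    (X := fun k : ℕ => σ⁻¹ * ((k : ℝ) - 1)) (by fun_prop) (integral_standardized hfin hmean σ)
    (integral_standardized_sq hmean hvar) (σ * t)
  simp only [charFun_standardized ν] at h
  have h1 : ∀ n : ℕ, σ⁻¹ * ((√n)⁻¹ * (σ * t)) = (√n)⁻¹ * t := fun n => by field_simp
  simp only [h1] at h
  convert h using 3
  rw [← Real.sq_sqrt hvar.le]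
  push_cast; ring

theorem centredCharFun_isLittleO (hfin : MemLp (fun k : ℕ => (k : ℝ)) 2 ν)
    (hmean : ∫ k : ℕ, (k : ℝ) ∂ν = 1) (hvar : 0 < Var[fun k : ℕ => (k : ℝ); ν]) :
    (fun t : ℝ => centredCharFun ν t - (1 - (Var[fun k : ℕ => (k : ℝ); ν] * t ^ 2 / 2 : ℝ)))
      =o[𝓝 0] fun t : ℝ => t ^ 2 := by
  set σ := √Var[fun k : ℕ => (k : ℝ); ν] with hσ
  have hσ0 : σ ≠ 0 := (Real.sqrt_pos.2 hvar).ne'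
  have h := taylor_charFun_two (P := ν)
    (X := fun k : ℕ => σ⁻¹ * ((k : ℝ) - 1)) (by fun_prop) (integral_standardized hfin hmean σ)
    (integral_standardized_sq hmean hvar)
  have ht : Tendsto (fun t : ℝ => σ * t) (𝓝 0) (𝓝 0) := by
    have : Continuous fun t : ℝ => σ * t := by fun_prop
    simpa using this.tendsto 0
  have h2 := h.comp_tendsto ht
  have h3 : ((fun t : ℝ => t ^ 2) ∘ fun t : ℝ => σ * t) = fun t => σ ^ 2 * t ^ 2 := by
    ext t; simp [mul_pow]
  rw [h3] at h2
  have h4 := h2.of_const_mul_right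
  refine h4.congr_left fun t => ?_
  simp only [Function.comp_apply, charFun_standardized ν, inv_mul_cancel_left₀ hσ0]
  rw [← Real.sq_sqrt hvar.le]
  push_cast; ring

/-- Close to `0`, the characteristic function is controlled by its second order expansion. -/
theorem exists_centredCharFun_near_zero (hfin : MemLp (fun k : ℕ => (k : ℝ)) 2 ν)
    (hmean : ∫ k : ℕ, (k : ℝ) ∂ν = 1) (hvar : 0 < Var[fun k : ℕ => (k : ℝ); ν]) :
    ∃ δ > 0, ∃ c > 0, ∃ K : ℝ, ∀ t : ℝ, |t| < δ →
      ‖centredCharFun ν t‖ ≤ Real.exp (-(c * t ^ 2)) ∧ ‖1 - centredCharFun ν t‖ ≤ K * t ^ 2 := by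
  set V := Var[fun k : ℕ => (k : ℝ); ν]
  have h := (centredCharFun_isLittleO hfin hmean hvar).def (c := V / 4) (by positivity)
  obtain ⟨δ, hδ, h⟩ := Metric.eventually_nhds_iff.1 h
  refine ⟨min δ (√(2 / V)), lt_min hδ (Real.sqrt_pos.2 (by positivity)), V / 4, by positivity,
    V, fun t ht => ?_⟩
  have h1 := h (y := t) (by simpa using ht.trans_le (min_le_left _ _))
  have h2 : V * t ^ 2 / 2 ≤ 1 := by
    have h3 := (ht.trans_le (min_le_right _ _)).le
    have h4 := Real.sq_sqrt (show 0 ≤ 2 / V by positivity)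
    have h5 : t ^ 2 ≤ 2 / V := by
      rw [← h4, ← sq_abs]
      exact pow_le_pow_left₀ (abs_nonneg t) h3 2
    rw [le_div_iff₀ hvar] at h5
    linarith
  rw [Real.norm_of_nonneg (sq_nonneg t)] at h1
  have h0 := mul_nonneg hvar.le (sq_nonneg t)
  constructor
  · have e : centredCharFun ν t = (centredCharFun ν t - (1 - (V * t ^ 2 / 2 : ℝ)))
        + ((1 - V * t ^ 2 / 2 : ℝ) : ℂ) := by push_cast; ring
    have h3 : ‖((1 - V * t ^ 2 / 2 : ℝ) : ℂ)‖ = 1 - V * t ^ 2 / 2 := by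
      rw [Complex.norm_real, Real.norm_of_nonneg (by linarith)]
    calc ‖centredCharFun ν t‖ ≤ V / 4 * t ^ 2 + (1 - V * t ^ 2 / 2) := by
          rw [e]; exact (norm_add_le _ _).trans (by rw [h3]; linarith)
      _ = -(V / 4 * t ^ 2) + 1 := by ring
      _ ≤ _ := Real.add_one_le_exp _
  · have e : 1 - centredCharFun ν t = ((V * t ^ 2 / 2 : ℝ) : ℂ)
        - (centredCharFun ν t - (1 - (V * t ^ 2 / 2 : ℝ))) := by push_cast; ring
    have h3 : ‖((V * t ^ 2 / 2 : ℝ) : ℂ)‖ = V * t ^ 2 / 2 := by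
      rw [Complex.norm_real, Real.norm_of_nonneg (by positivity)]
    rw [e]
    exact (norm_sub_le _ _).trans (by rw [h3]; linarith)

/-- The quadratic bound near `0` extends to the line as `|1 - φ| ≤ 2`. -/
theorem exists_norm_one_sub_centredCharFun_le (hfin : MemLp (fun k : ℕ => (k : ℝ)) 2 ν)
    (hmean : ∫ k : ℕ, (k : ℝ) ∂ν = 1) (hvar : 0 < Var[fun k : ℕ => (k : ℝ); ν]) :
    ∃ K : ℝ, 0 ≤ K ∧ ∀ t : ℝ, ‖1 - centredCharFun ν t‖ ≤ K * t ^ 2 := by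
  obtain ⟨δ, hδ, _, _, K, hK⟩ := exists_centredCharFun_near_zero hfin hmean hvar
  refine ⟨max K (2 / δ ^ 2), le_max_of_le_right (by positivity), fun t => ?_⟩
  rcases lt_or_ge |t| δ with h | h
  · exact (hK t h).2.trans (mul_le_mul_of_nonneg_right (le_max_left _ _) (sq_nonneg t))
  · have h1 : ‖1 - centredCharFun ν t‖ ≤ 1 + 1 :=
      (norm_sub_le _ _).trans (add_le_add (by simp) (norm_centredCharFun_le_one ν t))
    have h2 : δ ^ 2 ≤ t ^ 2 := by
      rw [← sq_abs t]; exact pow_le_pow_left₀ hδ.le h 2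
    calc _ ≤ 2 / δ ^ 2 * δ ^ 2 := by rw [div_mul_cancel₀ _ (by positivity)]; linarith
      _ ≤ 2 / δ ^ 2 * t ^ 2 := by gcongr
      _ ≤ _ := mul_le_mul_of_nonneg_right (le_max_right _ _) (sq_nonneg t)

/-- A critical offspring distribution that is not degenerate charges `0`. -/
theorem measure_zero_ne_zero (hfin : MemLp (fun k : ℕ => (k : ℝ)) 2 ν)
    (hmean : ∫ k : ℕ, (k : ℝ) ∂ν = 1) (hvar : 0 < Var[fun k : ℕ => (k : ℝ); ν]) :
    ν {0} ≠ 0 := by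
  intro h0
  have hae : ∀ᵐ k : ℕ ∂ν, 0 ≤ (k : ℝ) - 1 := by
    rw [ae_iff_of_countable]
    intro k hk
    have : 1 ≤ k := Nat.one_le_iff_ne_zero.2 (by rintro rfl; exact hk h0)
    have : (1 : ℝ) ≤ k := by exact_mod_cast this
    linarith
  have h1 : ∫ k : ℕ, ((k : ℝ) - 1) ∂ν = 0 := by
    rw [integral_sub (integrable_natCast hfin) (integrable_const _), hmean]; simp
  rw [integral_eq_zero_iff_of_nonneg_ae hae
    ((integrable_natCast hfin).sub (integrable_const _))] at h1
  have h2 := variance_eq_integral (μ := ν) (X := fun k : ℕ => (k : ℝ)) (by fun_prop)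
  rw [hmean] at h2
  have h3 : ∫ k : ℕ, ((k : ℝ) - 1) ^ 2 ∂ν = 0 := by
    rw [integral_congr_ae (g := fun _ => 0)]
    · simp
    · filter_upwards [h1] with k hk
      simp only [Pi.zero_apply] at hk
      rw [hk]; ring
  rw [h3] at h2
  exact hvar.ne' h2

/-- On a period the characteristic function has absolute value `1` only at `0`. -/
theorem norm_centredCharFun_lt_one (h0 : ν {0} ≠ 0) {d : ℕ} (hd : 0 < d)
    (hspan : ∀ K : AddSubgroup ℤ, (∀ i : ℕ, ν {i} ≠ 0 → (i : ℤ) ∈ K) → (d : ℤ) ∈ K)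
    {t : ℝ} (ht0 : t ≠ 0) (ht : |t| ≤ Real.pi / d) : ‖centredCharFun ν t‖ < 1 := by
  refine lt_of_le_of_ne (norm_centredCharFun_le_one ν t) fun h1 => ht0 ?_
  set φ := centredCharFun ν t with hφ
  -- `conj φ * exp (i t (k - 1))` has integral `1` and absolute value `1`, so it is constant
  have hint : Integrable (fun k : ℕ => (starRingEnd ℂ) φ
      * Complex.exp (t * ((k : ℝ) - 1 : ℝ) * Complex.I)) ν := by
    refine Integrable.of_bound (by fun_prop) 1 (ae_of_all _ fun k => ?_)
    rw [← Complex.ofReal_mul, norm_mul, Complex.norm_exp_ofReal_mul_I, RCLike.norm_conj, h1, one_mul]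
  have hint' : Integrable (fun k : ℕ => ((starRingEnd ℂ) φ
      * Complex.exp (t * ((k : ℝ) - 1 : ℝ) * Complex.I)).re) ν := hint.re
  have hI : ∫ k : ℕ, (starRingEnd ℂ) φ * Complex.exp (t * ((k : ℝ) - 1 : ℝ) * Complex.I) ∂ν = 1 := by
    rw [integral_const_mul, ← centredCharFun_eq_integral, ← hφ, mul_comm, Complex.mul_conj,
      Complex.normSq_eq_norm_sq, h1]
    simp
  have hnorm : ∀ k : ℕ, ‖(starRingEnd ℂ) φ * Complex.exp (t * ((k : ℝ) - 1 : ℝ) * Complex.I)‖ = 1 := by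
    intro k
    rw [← Complex.ofReal_mul, norm_mul, Complex.norm_exp_ofReal_mul_I, RCLike.norm_conj, h1, one_mul]
  have hre : ∫ k : ℕ, (1 - ((starRingEnd ℂ) φ
      * Complex.exp (t * ((k : ℝ) - 1 : ℝ) * Complex.I)).re) ∂ν = 0 := by
    have h2 : ∫ k : ℕ, ((starRingEnd ℂ) φ
      * Complex.exp (t * ((k : ℝ) - 1 : ℝ) * Complex.I)).re ∂ν = 1 := by
      have := integral_re hint
      simp only [RCLike.re_eq_complex_re] at this
      rw [this, hI, Complex.one_re]
    rw [integral_sub (integrable_const _) hint', h2]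
    simp
  rw [integral_eq_zero_iff_of_nonneg (fun k => sub_nonneg.2
    ((Complex.re_le_norm _).trans (hnorm k).le)) ((integrable_const _).sub hint')] at hre
  have hone : ∀ k : ℕ, ν {k} ≠ 0 → (starRingEnd ℂ) φ
      * Complex.exp (t * ((k : ℝ) - 1 : ℝ) * Complex.I) = 1 := by
    intro k hk
    have h2 : ((starRingEnd ℂ) φ * Complex.exp (t * ((k : ℝ) - 1 : ℝ) * Complex.I)).re = 1 := by
      have := ae_iff_of_countable.1 hre k hk
      simp only [Pi.zero_apply] at this
      linarith
    have h3 := hnorm k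
    have h4 := Complex.sq_norm ((starRingEnd ℂ) φ * Complex.exp (t * ((k : ℝ) - 1 : ℝ) * Complex.I))
    rw [h3, Complex.normSq_apply, h2] at h4
    refine Complex.ext h2 ?_
    have h5 : ((starRingEnd ℂ) φ * Complex.exp (t * ((k : ℝ) - 1 : ℝ) * Complex.I)).im ^ 2 = 0 := by
      linarith
    simpa using h5
  have hexp : ∀ k : ℕ, ν {k} ≠ 0 → Complex.exp (t * Complex.I * (k : ℤ)) = 1 := by
    intro k hk
    have e0 := hone 0 h0
    have ek := hone k hk
    have e1 : Complex.exp (t * ((k : ℝ) - 1 : ℝ) * Complex.I)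
        = Complex.exp (t * (((0 : ℕ) : ℝ) - 1 : ℝ) * Complex.I)
          * Complex.exp (t * Complex.I * (k : ℤ)) := by
      rw [← Complex.exp_add]; congr 1; push_cast; ring
    rw [e1, ← mul_assoc, e0, one_mul] at ek
    exact ek
  -- the integers `j` with `exp (i t j) = 1` form a subgroup
  have hd1 := hspan
    { carrier := {j : ℤ | Complex.exp (t * Complex.I * j) = 1}
      zero_mem' := by simp
      add_mem' := fun {a b} ha hb => by
        simp only [Set.mem_ofPred_eq] at ha hb ⊢
        push_cast
        rw [mul_add, Complex.exp_add, ha, hb, one_mul]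
      neg_mem' := fun {a} ha => by
        simp only [Set.mem_ofPred_eq] at ha ⊢
        push_cast
        rw [mul_neg, Complex.exp_neg, ha, inv_one] } hexp
  change Complex.exp (t * Complex.I * (d : ℤ)) = 1 at hd1
  obtain ⟨q, hq⟩ := Complex.exp_eq_one_iff.1 hd1
  have hq2 : t * d = q * (2 * Real.pi) := by
    have := congrArg Complex.im hq
    simpa using this
  have hdpos : (0 : ℝ) < d := by exact_mod_cast hd
  have hq3 : |(q : ℝ)| * (2 * Real.pi) ≤ Real.pi := by
    rw [le_div_iff₀ hdpos] at ht
    rw [← abs_of_pos Real.two_pi_pos, ← abs_mul, ← hq2, abs_mul, abs_of_pos hdpos]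
    exact ht
  have hq4 : q = 0 := by
    have h5 : |(q : ℝ)| < 1 := by
      by_contra h6
      rw [not_lt] at h6
      nlinarith [Real.pi_pos]
    have h6 : |q| < 1 := by exact_mod_cast h5
    exact Int.abs_lt_one_iff.1 h6
  rw [hq4] at hq2
  simp only [Int.cast_zero, zero_mul, mul_eq_zero] at hq2
  exact hq2.resolve_right hdpos.ne'

/-- A Gaussian bound for the characteristic function on a period. -/
theorem exists_norm_centredCharFun_le_exp (hfin : MemLp (fun k : ℕ => (k : ℝ)) 2 ν)
    (hmean : ∫ k : ℕ, (k : ℝ) ∂ν = 1) (hvar : 0 < Var[fun k : ℕ => (k : ℝ); ν]) {d : ℕ} (hd : 0 < d)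
    (hspan : ∀ K : AddSubgroup ℤ, (∀ i : ℕ, ν {i} ≠ 0 → (i : ℤ) ∈ K) → (d : ℤ) ∈ K) :
    ∃ c > 0, ∀ t : ℝ, |t| ≤ Real.pi / d →
      ‖centredCharFun ν t‖ ≤ Real.exp (-(c * t ^ 2)) := by
  obtain ⟨δ, hδ, c₁, hc₁, _, hK⟩ := exists_centredCharFun_near_zero hfin hmean hvar
  set b := Real.pi / d with hb
  have hbpos : 0 < b := div_pos Real.pi_pos (by exact_mod_cast hd)
  set S : Set ℝ := {t | δ ≤ |t| ∧ |t| ≤ b}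
  have hS : IsCompact S := by
    refine Metric.isCompact_of_isClosed_isBounded ?_ ?_
    · exact (isClosed_le continuous_const continuous_abs).inter
        (isClosed_le continuous_abs continuous_const)
    · refine (Metric.isBounded_Icc (-b) b).subset fun t ht => ?_
      exact abs_le.1 ht.2
  obtain ⟨ρ, hρ1, hρ⟩ : ∃ ρ < 1, 0 < ρ ∧ ∀ t ∈ S, ‖centredCharFun ν t‖ ≤ ρ := by
    rcases S.eq_empty_or_nonempty with h | h
    · exact ⟨1 / 2, by norm_num, by norm_num, fun t ht => by rw [h] at ht; exact ht.elim⟩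
    · obtain ⟨x, hx, hmax⟩ := hS.exists_isMaxOn h
        (continuous_centredCharFun ν).norm.continuousOn
      have hx0 : x ≠ 0 := by
        rintro rfl
        have := hx.1
        rw [abs_zero] at this
        linarith
      have hlt := norm_centredCharFun_lt_one (measure_zero_ne_zero hfin hmean hvar) hd hspan hx0 hx.2
      refine ⟨max ‖centredCharFun ν x‖ (1 / 2), max_lt hlt (by norm_num),
        lt_max_of_lt_right (by norm_num), fun t ht => (hmax ht).trans (le_max_left _ _)⟩
  refine ⟨min c₁ (-Real.log ρ / b ^ 2), lt_min hc₁
    (div_pos (neg_pos.2 (Real.log_neg hρ.1 hρ1)) (by positivity)), fun t ht => ?_⟩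
  rcases lt_or_ge |t| δ with h | h
  · refine (hK t h).1.trans (Real.exp_le_exp.2 (neg_le_neg ?_))
    exact mul_le_mul_of_nonneg_right (min_le_left _ _) (sq_nonneg t)
  · refine (hρ.2 t ⟨h, ht⟩).trans ?_
    rw [← Real.log_le_iff_le_exp hρ.1]
    have h1 : t ^ 2 ≤ b ^ 2 := by
      rw [← sq_abs t]; exact pow_le_pow_left₀ (abs_nonneg t) ht 2
    have h2 : min c₁ (-Real.log ρ / b ^ 2) * t ^ 2 ≤ -Real.log ρ / b ^ 2 * b ^ 2 := by
      have h3 : 0 ≤ -Real.log ρ / b ^ 2 :=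
        (div_pos (neg_pos.2 (Real.log_neg hρ.1 hρ1)) (by positivity)).le
      exact mul_le_mul (min_le_right _ _) h1 (sq_nonneg t) h3
    rw [div_mul_cancel₀ _ (by positivity)] at h2
    linarith

end CharacteristicFunction

/-! ### Fourier inversion for the random walk -/

section Walk

theorem walkProb_zero (p : ℕ → ℝ) (j : ℕ) : walkProb p 0 j = if j = 0 then 1 else 0 := by
  rw [walkProb, pow_zero, coeff_one]

theorem walkProb_succ (p : ℕ → ℝ) (m j : ℕ) :
    walkProb p (m + 1) j = ∑ x ∈ Finset.HasAntidiagonal.antidiagonal j, walkProb p m x.1 * p x.2 := by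
  rw [walkProb, pow_succ, coeff_mul]
  simp [walkProb, offspringSeries]

theorem walkProb_nonneg {p : ℕ → ℝ} (hp : ∀ i, 0 ≤ p i) (m j : ℕ) : 0 ≤ walkProb p m j := by
  induction m generalizing j with
  | zero => rw [walkProb_zero]; split_ifs <;> norm_num
  | succ m ih =>
    rw [walkProb_succ]
    exact Finset.sum_nonneg fun x _ => mul_nonneg (ih _) (hp _)

theorem walkProb_eq_zero_of_not_dvd {p : ℕ → ℝ} {d : ℕ} (hp : ∀ i, p i ≠ 0 → d ∣ i) (m : ℕ)
    {j : ℕ} (hj : ¬ d ∣ j) : walkProb p m j = 0 := by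
  induction m generalizing j with
  | zero =>
    rw [walkProb_zero, if_neg]
    rintro rfl
    exact hj (dvd_zero d)
  | succ m ih =>
    rw [walkProb_succ]
    refine Finset.sum_eq_zero fun x hx => ?_
    rw [Finset.HasAntidiagonal.mem_antidiagonal] at hx
    by_cases h1 : d ∣ x.1
    · by_cases h2 : p x.2 = 0
      · rw [h2, mul_zero]
      · exact absurd (hx ▸ dvd_add h1 (hp _ h2)) hj
    · rw [ih h1, zero_mul]

theorem summable_tsum_walkProb {p : ℕ → ℝ} (hp : ∀ i, 0 ≤ p i) (hs : Summable p) {x : ℂ}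
    (hx : ‖x‖ = 1) (m : ℕ) : Summable (fun j => ‖(walkProb p m j : ℂ) * x ^ j‖) ∧
      ∑' j, (walkProb p m j : ℂ) * x ^ j = (∑' i, (p i : ℂ) * x ^ i) ^ m := by
  have h1 : Summable fun i => ‖(p i : ℂ) * x ^ i‖ := by
    refine hs.congr fun i => ?_
    rw [norm_mul, norm_pow, hx, one_pow, mul_one, Complex.norm_real, Real.norm_of_nonneg (hp i)]
  induction m with
  | zero =>
    have h2 : ∀ j, (walkProb p 0 j : ℂ) * x ^ j = if j = 0 then 1 else 0 := by
      intro j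
      rw [walkProb_zero]
      split_ifs with h <;> simp [h]
    simp only [h2, pow_zero, tsum_ite_eq, and_true]
    exact summable_of_ne_finset_zero (s := {0}) fun j hj => by
      rw [if_neg (by simpa using hj), norm_zero]
  | succ m ih =>
    have h2 : ∀ j, (walkProb p (m + 1) j : ℂ) * x ^ j = ∑ y ∈ Finset.HasAntidiagonal.antidiagonal j,
        ((walkProb p m y.1 : ℂ) * x ^ y.1) * ((p y.2 : ℂ) * x ^ y.2) := by
      intro j
      rw [walkProb_succ, Complex.ofReal_sum, Finset.sum_mul]
      refine Finset.sum_congr rfl fun y hy => ?_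
      rw [Finset.HasAntidiagonal.mem_antidiagonal] at hy
      rw [← hy, pow_add]
      push_cast; ring
    simp only [h2]
    refine ⟨summable_norm_sum_mul_antidiagonal_of_summable_norm
      (f := fun j => (walkProb p m j : ℂ) * x ^ j) (g := fun i => (p i : ℂ) * x ^ i) ih.1 h1, ?_⟩
    have h3 := tsum_mul_tsum_eq_tsum_sum_antidiagonal_of_summable_norm
      (f := fun j => (walkProb p m j : ℂ) * x ^ j) (g := fun i => (p i : ℂ) * x ^ i) ih.1 h1
    rw [ih.2] at h3
    rw [pow_succ, h3]

variable (ν : Measure ℕ) [IsProbabilityMeasure ν]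

theorem summable_measureReal_singleton : Summable fun i => ν.real {i} := by
  have h := (integrable_const (1 : ℝ) : Integrable (fun _ : ℕ => (1 : ℝ)) ν)
  have h1 : ∑' i, ν {i} = 1 := by
    rw [← measure_univ (μ := ν), ← Set.iUnion_of_singleton ℕ, measure_iUnion]
    · exact fun i j hij => by simpa using hij
    · exact fun i => measurableSet_singleton i
  exact ENNReal.summable_toReal (by rw [h1]; exact ENNReal.one_ne_top)

/-- Orthogonality of the characters `exp (i t j)`, `d ∣ j`, on a period of length `2 π / d`. -/
theorem integral_exp_period {d : ℕ} (hd : 0 < d) {q : ℤ} :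
    ∫ t in (-(Real.pi / d))..(Real.pi / d), Complex.exp (t * Complex.I * ((d * q : ℤ) : ℂ))
      = if q = 0 then ((2 * Real.pi / d : ℝ) : ℂ) else 0 := by
  have hd0 : (d : ℂ) ≠ 0 := by exact_mod_cast hd.ne'
  split_ifs with h
  · simp only [h, mul_zero, Int.cast_zero, Complex.exp_zero]
    rw [intervalIntegral.integral_const, Complex.real_smul]
    push_cast; ring
  · have hc : (d : ℂ) * q * Complex.I ≠ 0 :=
      mul_ne_zero (mul_ne_zero hd0 (by exact_mod_cast h)) Complex.I_ne_zero
    have h1 : ∀ t : ℝ, Complex.exp (t * Complex.I * ((d * q : ℤ) : ℂ))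
        = Complex.exp ((d : ℂ) * q * Complex.I * t) := by
      intro t; congr 1; push_cast; ring
    simp only [h1]
    rw [integral_exp_mul_complex hc, div_eq_zero_iff]
    left
    rw [sub_eq_zero, Complex.exp_eq_exp_iff_exists_int]
    refine ⟨q, ?_⟩
    push_cast
    field_simp
    ring

/-- Fourier inversion. If all offspring numbers are multiples of `d`, it suffices to integrate over
a period of length `2 π / d`. -/
theorem walkProb_eq_integral {d : ℕ} (hd : 0 < d) (hdvd : ∀ i, ν {i} ≠ 0 → d ∣ i) (m : ℕ) {j : ℕ}
    (hj : d ∣ j) :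
    (walkProb (fun i => ν.real {i}) m j : ℂ) = ((d / (2 * Real.pi) : ℝ) : ℂ) *
      ∫ t in (-(Real.pi / d))..(Real.pi / d),
        centredCharFun ν t ^ m * Complex.exp (t * Complex.I * (m - j)) := by
  set p : ℕ → ℝ := fun i => ν.real {i} with hp
  have hp0 : ∀ i, 0 ≤ p i := fun i => measureReal_nonneg
  have hpd : ∀ i, p i ≠ 0 → d ∣ i := fun i hi => hdvd i fun h => hi (by
    rw [hp]; simp only [Measure.real]; rw [h, ENNReal.toReal_zero])
  have hx : ∀ t : ℝ, ‖Complex.exp (t * Complex.I)‖ = 1 := Complex.norm_exp_ofReal_mul_I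
  have hsum := fun t : ℝ => summable_tsum_walkProb hp0 (summable_measureReal_singleton ν) (hx t) m
  have hsumw : Summable fun i => walkProb p m i := by
    refine (hsum 0).1.congr fun i => ?_
    rw [norm_mul, norm_pow, hx, one_pow, mul_one, Complex.norm_real,
      Real.norm_of_nonneg (walkProb_nonneg hp0 m i)]
  have h1 : ∀ t : ℝ, centredCharFun ν t ^ m * Complex.exp (t * Complex.I * (m - j))
      = ∑' i : ℕ, (walkProb p m i : ℂ) * Complex.exp (t * Complex.I * (i - j)) := by
    intro t
    rw [centredCharFun_eq_tsum, mul_pow, ← (hsum t).2, ← tsum_mul_left, ← tsum_mul_right]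
    refine tsum_congr fun i => ?_
    rw [← Complex.exp_nat_mul, ← Complex.exp_nat_mul, mul_left_comm, mul_assoc, ← Complex.exp_add,
      ← Complex.exp_add]
    congr 2; ring
  have h2 : HasSum (fun i : ℕ => ∫ t in (-(Real.pi / d))..(Real.pi / d),
      (walkProb p m i : ℂ) * Complex.exp (t * Complex.I * (i - j)))
      (∫ t in (-(Real.pi / d))..(Real.pi / d),
        centredCharFun ν t ^ m * Complex.exp (t * Complex.I * (m - j))) := by
    refine intervalIntegral.hasSum_integral_of_dominated_convergence
      (fun i _ => walkProb p m i) (fun i => ?_) (fun i => ae_of_all _ fun t _ => ?_)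
      (ae_of_all _ fun t _ => hsumw) ?_ (ae_of_all _ fun t _ => ?_)
    · exact Continuous.aestronglyMeasurable (by fun_prop)
    · have e : (t : ℂ) * Complex.I * (i - j) = ((t * (i - j) : ℝ) : ℂ) * Complex.I := by
        push_cast; ring
      rw [norm_mul, e, Complex.norm_exp_ofReal_mul_I, mul_one, Complex.norm_real,
        Real.norm_of_nonneg (walkProb_nonneg hp0 m i)]
    · exact intervalIntegrable_const
    · rw [h1]
      refine Summable.hasSum (Summable.of_norm (hsumw.congr fun i => ?_))
      have e : (t : ℂ) * Complex.I * (i - j) = ((t * (i - j) : ℝ) : ℂ) * Complex.I := by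
        push_cast; ring
      rw [norm_mul, e, Complex.norm_exp_ofReal_mul_I, mul_one, Complex.norm_real,
        Real.norm_of_nonneg (walkProb_nonneg hp0 m i)]
  have h3 : ∀ i : ℕ, ∫ t in (-(Real.pi / d))..(Real.pi / d),
      (walkProb p m i : ℂ) * Complex.exp (t * Complex.I * (i - j))
      = if i = j then (walkProb p m j : ℂ) * ((2 * Real.pi / d : ℝ) : ℂ) else 0 := by
    intro i
    rw [intervalIntegral.integral_const_mul]
    by_cases hi : d ∣ i
    · obtain ⟨a, rfl⟩ := hi
      obtain ⟨b, rfl⟩ := hj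
      have h4 := integral_exp_period hd (q := (a : ℤ) - b)
      have h5 : ∀ t : ℝ, Complex.exp (t * Complex.I * ((d * ((a : ℤ) - b) : ℤ) : ℂ))
          = Complex.exp (t * Complex.I * ((d * a : ℕ) - (d * b : ℕ))) := by
        intro t; congr 1; push_cast; ring
      simp only [h5] at h4
      rw [h4]
      have h6 : (a : ℤ) - b = 0 ↔ d * a = d * b := by
        rw [sub_eq_zero, Nat.cast_inj, Nat.mul_right_inj hd.ne']
      by_cases h7 : d * a = d * b
      · rw [if_pos h7, if_pos (h6.2 h7), h7]
      · rw [if_neg h7, if_neg (fun h => h7 (h6.1 h)), mul_zero]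
    · rw [walkProb_eq_zero_of_not_dvd hpd m hi, if_neg (by rintro rfl; exact hi hj)]
      simp
  simp only [h3] at h2
  have h8 := h2.unique (hasSum_ite_eq j _)
  rw [h8]
  have hd0 : (d : ℂ) ≠ 0 := by exact_mod_cast hd.ne'
  have hpi : (Real.pi : ℂ) ≠ 0 := by exact_mod_cast Real.pi_ne_zero
  push_cast
  field_simp

end Walk

/-! ### Gaussian integral bounds -/

theorem abs_pow_le_mul_exp {c : ℝ} (hc : 0 < c) {a : ℕ} (ha : a ≤ 2) (u : ℝ) :
    |u| ^ a ≤ (1 + 2 / c) * Real.exp (c * u ^ 2 / 2) := by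
  have h1 : |u| ^ a ≤ 1 + u ^ 2 := by
    have := sq_abs u
    interval_cases a
    · rw [pow_zero]; nlinarith [sq_nonneg u]
    · nlinarith [sq_nonneg (|u| - 1), abs_nonneg u]
    · rw [this]; linarith
  have h2 := Real.add_one_le_exp (c * u ^ 2 / 2)
  have h3 : 1 + u ^ 2 ≤ (1 + 2 / c) * (c * u ^ 2 / 2 + 1) := by
    have : (1 + 2 / c) * (c * u ^ 2 / 2 + 1) = 1 + u ^ 2 + (c * u ^ 2 / 2 + 2 / c) := by
      field_simp; ring
    rw [this]
    have : 0 ≤ c * u ^ 2 / 2 + 2 / c := by positivity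
    linarith
  exact h1.trans (h3.trans (mul_le_mul_of_nonneg_left h2 (by positivity)))

/-- An integrand of size `|t|^a exp (- c m t²)` on `[-b, b]` has an integral of order
`m ^ (- (a + 1) / 2)`. -/
theorem exists_norm_integral_le {c b : ℝ} (hc : 0 < c) (hb : 0 ≤ b) :
    ∃ K : ℝ, 0 ≤ K ∧ ∀ (a : ℕ), a ≤ 2 → ∀ (m : ℕ) (A : ℝ) (h : ℝ → ℂ), 0 ≤ A →
      (∀ t, |t| ≤ b → ‖h t‖ ≤ A * |t| ^ a * Real.exp (-(c * m * t ^ 2))) →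
      ‖∫ t in (-b)..b, h t‖ ≤ K * A / √((m : ℝ) + 1) ^ (a + 1) := by
  refine ⟨Real.exp (c * b ^ 2) * (1 + 2 / c) * √(2 * Real.pi / c), by positivity,
    fun a ha m A h hA hh => ?_⟩
  set M : ℝ := (m : ℝ) + 1 with hM
  have hMpos : 0 < M := by positivity
  have hs : 0 < √M := Real.sqrt_pos.2 hMpos
  set B : ℝ := A * Real.exp (c * b ^ 2) * (1 + 2 / c) / √M ^ a with hB
  have hBnn : 0 ≤ B := by positivity
  have key : ∀ t, |t| ≤ b → ‖h t‖ ≤ B * Real.exp (-(c * M / 2) * t ^ 2) := by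
    intro t ht
    have h1 := abs_pow_le_mul_exp hc ha (√M * t)
    have h2 : t ^ 2 ≤ b ^ 2 := by rw [← sq_abs t]; exact pow_le_pow_left₀ (abs_nonneg t) ht 2
    rw [abs_mul, mul_pow, abs_of_pos hs, mul_pow, Real.sq_sqrt hMpos.le] at h1
    have h3 : |t| ^ a ≤ (1 + 2 / c) * Real.exp (c * (M * t ^ 2) / 2) / √M ^ a := by
      rw [le_div_iff₀ (by positivity), mul_comm]; exact h1
    calc ‖h t‖ ≤ A * |t| ^ a * Real.exp (-(c * m * t ^ 2)) := hh t ht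
      _ ≤ A * ((1 + 2 / c) * Real.exp (c * (M * t ^ 2) / 2) / √M ^ a)
          * (Real.exp (c * b ^ 2) * Real.exp (-(c * M * t ^ 2))) := by
          have h4 : Real.exp (-(c * m * t ^ 2))
              ≤ Real.exp (c * b ^ 2) * Real.exp (-(c * M * t ^ 2)) := by
            rw [← Real.exp_add, Real.exp_le_exp, hM]
            nlinarith
          gcongr
      _ = B * (Real.exp (c * (M * t ^ 2) / 2) * Real.exp (-(c * M * t ^ 2))) := by
          rw [hB]; ring
      _ = _ := by rw [← Real.exp_add]; congr 2; ring
  have hint : Integrable fun t : ℝ => B * Real.exp (-(c * M / 2) * t ^ 2) :=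
    (integrable_exp_neg_mul_sq (by positivity)).const_mul B
  have h5 : ‖∫ t in (-b)..b, h t‖ ≤ ∫ t in (-b)..b, B * Real.exp (-(c * M / 2) * t ^ 2) := by
    refine intervalIntegral.norm_integral_le_of_norm_le (by linarith) (ae_of_all _ fun t ht => ?_)
      hint.intervalIntegrable
    exact key t (abs_le.2 ⟨ht.1.le, ht.2⟩)
  refine h5.trans ?_
  rw [intervalIntegral.integral_of_le (by linarith)]
  refine (setIntegral_le_integral hint (ae_of_all _ fun t => by positivity)).trans ?_
  rw [integral_const_mul, integral_gaussian]
  have h6 : √(Real.pi / (c * M / 2)) = √(2 * Real.pi / c) / √M := by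
    rw [← Real.sqrt_div (by positivity)]; congr 1; field_simp
  rw [h6, hB, pow_succ]
  apply le_of_eq
  field_simp
  ring

/-! ### Local limit estimates for the random walk -/

/-- Local estimates, with constants `c` and `C`, for the walk with critical step distribution `p` of
span `d`: upper bounds of order `m ^ (-1 / 2)`, lower bounds of this order for the probabilities at
`n - 1`, the only ones that occur in a denominator, and bounds for first order differences and for a
second order difference, the times and places being changed by `k` and `l` steps of mean `1`. -/
structure LocalLimitBounds (p : ℕ → ℝ) (d : ℕ) (c C : ℝ) : Prop where
  c_pos : 0 < c
  C_nonneg : 0 ≤ C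
  dvd : ∀ m j, walkProb p m j ≠ 0 → d ∣ j
  upper : ∀ m j, walkProb p m j ≤ C / √((m : ℝ) + 1)
  lower : ∀ n, 1 ≤ n → walkProb p n (n - 1) ≠ 0 → c / √(n : ℝ) ≤ walkProb p n (n - 1)
  diff_pred : ∀ m l, 1 ≤ l → d ∣ m → d ∣ m + l - 1 →
    |walkProb p m m - walkProb p (m + l) (m + l - 1)| ≤ C * √(l : ℝ) / ((m : ℝ) + 1)
  diff_succ : ∀ m l, 1 ≤ l → d ∣ m + 1 → d ∣ m + l →
    |walkProb p m (m + 1) - walkProb p (m + l) (m + l)| ≤ C * √(l : ℝ) / ((m : ℝ) + 1)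
  diff_second : ∀ m k l, 1 ≤ k → 1 ≤ l → d ∣ m + 1 → d ∣ m + l → d ∣ m + k → d ∣ m + k + l - 1 →
    |walkProb p m (m + 1) - walkProb p (m + l) (m + l) + walkProb p (m + k + l) (m + k + l - 1)
      - walkProb p (m + k) (m + k)| ≤ C * (√(k : ℝ) * √(l : ℝ)) / √((m : ℝ) + 1) ^ 3

theorem norm_one_sub_pow_le {x : ℂ} (hx : ‖x‖ ≤ 1) (l : ℕ) : ‖1 - x ^ l‖ ≤ l * ‖1 - x‖ := by
  induction l with
  | zero => simp
  | succ l ih =>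
    have e : 1 - x ^ (l + 1) = (1 - x ^ l) + x ^ l * (1 - x) := by ring
    have h : ‖x ^ l * (1 - x)‖ ≤ 1 * ‖1 - x‖ := by
      rw [norm_mul, norm_pow]
      exact mul_le_mul_of_nonneg_right (pow_le_one₀ (norm_nonneg _) hx) (norm_nonneg _)
    rw [e]
    refine (norm_add_le _ _).trans ?_
    push_cast
    linarith

section

open Filter Topology

variable {ν : Measure ℕ} [IsProbabilityMeasure ν]

/-- The characteristic function of `S_l - l + 1` is `1 + O(√l |t|)`: this covers both `|t|` close to
`0`, where `1 - φ(t) ^ l = O(l t²)`, and the range `l t² ≥ 1`, where the claim is trivial. -/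
theorem exists_norm_one_sub_exp_mul_pow_le (hfin : MemLp (fun k : ℕ => (k : ℝ)) 2 ν)
    (hmean : ∫ k : ℕ, (k : ℝ) ∂ν = 1) (hvar : 0 < Var[fun k : ℕ => (k : ℝ); ν]) :
    ∃ K : ℝ, 0 ≤ K ∧ ∀ (l : ℕ) (t : ℝ), 1 ≤ l →
      ‖1 - Complex.exp (t * Complex.I) * centredCharFun ν t ^ l‖ ≤ K * √(l : ℝ) * |t| := by
  obtain ⟨K, hK0, hK⟩ := exists_norm_one_sub_centredCharFun_le hfin hmean hvar
  refine ⟨1 + 2 * √K, by positivity, fun l t hl => ?_⟩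
  set z := Complex.exp (t * Complex.I)
  set φ := centredCharFun ν t
  have hφ : ‖φ‖ ≤ 1 := norm_centredCharFun_le_one ν t
  have hz : ‖z‖ = 1 := Complex.norm_exp_ofReal_mul_I t
  have hl1 : 1 ≤ √(l : ℝ) := Real.one_le_sqrt.2 (by exact_mod_cast hl)
  have h1 : ‖1 - z‖ ≤ |t| := by
    rw [norm_sub_rev]
    have := Real.norm_exp_I_mul_ofReal_sub_one_le (x := t)
    rwa [mul_comm Complex.I, Real.norm_eq_abs] at this
  have h2 : ‖1 - φ ^ l‖ ≤ 2 * (√K * √(l : ℝ) * |t|) := by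
    set x := √K * √(l : ℝ) * |t| with hx
    have hx0 : 0 ≤ x := by positivity
    have hx2 : x ^ 2 = l * (K * t ^ 2) := by
      rw [hx, mul_pow, mul_pow, Real.sq_sqrt hK0, Real.sq_sqrt (Nat.cast_nonneg l), sq_abs]; ring
    rcases le_or_gt x 1 with h | h
    · have h3 : ‖1 - φ ^ l‖ ≤ x ^ 2 := by
        rw [hx2]
        exact (norm_one_sub_pow_le hφ l).trans
          (mul_le_mul_of_nonneg_left (hK t) (Nat.cast_nonneg l))
      nlinarith
    · have h3 : ‖1 - φ ^ l‖ ≤ 1 + 1 := (norm_sub_le _ _).trans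
        (add_le_add (by simp) (by rw [norm_pow]; exact pow_le_one₀ (norm_nonneg _) hφ))
      linarith
  have e : 1 - z * φ ^ l = (1 - z) + z * (1 - φ ^ l) := by ring
  rw [e]
  refine (norm_add_le _ _).trans ?_
  rw [norm_mul, hz, one_mul]
  have h3 : |t| ≤ √(l : ℝ) * |t| := le_mul_of_one_le_left (abs_nonneg t) hl1
  nlinarith

/-- The local limit theorem at `n - 1`: on the multiples `n - 1` of the span, `√n ℙ(S_n = n - 1)`
has a positive limit. -/
theorem tendsto_sqrt_mul_integral (hfin : MemLp (fun k : ℕ => (k : ℝ)) 2 ν)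
    (hmean : ∫ k : ℕ, (k : ℝ) ∂ν = 1) (hvar : 0 < Var[fun k : ℕ => (k : ℝ); ν]) {b c : ℝ}
    (hb : 0 < b) (hc : 0 < c)
    (hφ : ∀ t : ℝ, |t| ≤ b → ‖centredCharFun ν t‖ ≤ Real.exp (-(c * t ^ 2))) :
    Tendsto (fun n : ℕ => (√(n : ℝ) : ℂ) * ∫ t in (-b)..b,
      centredCharFun ν t ^ n * Complex.exp (t * Complex.I)) atTop
      (𝓝 ((√(2 * Real.pi / Var[fun k : ℕ => (k : ℝ); ν]) : ℝ) : ℂ)) := by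
  set V := Var[fun k : ℕ => (k : ℝ); ν]
  set F : ℕ → ℝ → ℂ := fun n => (Set.Ioc (-b * √(n : ℝ)) (b * √(n : ℝ))).indicator fun s =>
    centredCharFun ν ((√(n : ℝ))⁻¹ * s) ^ n
      * Complex.exp (((√(n : ℝ))⁻¹ * s : ℝ) * Complex.I) with hF
  have hlim : ∫ s : ℝ, Complex.exp (-(V * s ^ 2 / 2 : ℝ)) = ((√(2 * Real.pi / V) : ℝ) : ℂ) := by
    have h1 := integral_gaussian (V / 2)
    rw [show 2 * Real.pi / V = Real.pi / (V / 2) by field_simp, ← h1, ← integral_complex_ofReal]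
    refine integral_congr_ae (ae_of_all _ fun s => ?_)
    simp only []
    rw [Complex.ofReal_exp]
    congr 1; push_cast; ring
  have hsub : ∀ᶠ n : ℕ in atTop, (√(n : ℝ) : ℂ) * ∫ t in (-b)..b,
      centredCharFun ν t ^ n * Complex.exp (t * Complex.I) = ∫ s, F n s := by
    filter_upwards [eventually_gt_atTop 0] with n hn
    have hs : 0 < √(n : ℝ) := Real.sqrt_pos.2 (by exact_mod_cast hn)
    have h1 := intervalIntegral.integral_comp_div (a := -b * √(n : ℝ)) (b := b * √(n : ℝ))
      (fun t : ℝ => centredCharFun ν t ^ n * Complex.exp (t * Complex.I)) hs.ne'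
    rw [mul_div_cancel_right₀ _ hs.ne', mul_div_cancel_right₀ _ hs.ne', Complex.real_smul] at h1
    rw [← h1, intervalIntegral.integral_of_le (by nlinarith), hF,
      integral_indicator measurableSet_Ioc]
    simp only [div_eq_inv_mul]
  rw [tendsto_congr' hsub, ← hlim]
  refine tendsto_integral_of_dominated_convergence (fun s => Real.exp (-c * s ^ 2)) (fun n => ?_)
    (integrable_exp_neg_mul_sq hc) (fun n => ae_of_all _ fun s => ?_) (ae_of_all _ fun s => ?_)
  · refine AEStronglyMeasurable.indicator ?_ measurableSet_Ioc
    have := continuous_centredCharFun ν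
    exact Continuous.aestronglyMeasurable (by fun_prop)
  · by_cases hs : s ∈ Set.Ioc (-b * √(n : ℝ)) (b * √(n : ℝ))
    · simp only [hF, Set.indicator_of_mem hs]
      rw [norm_mul, Complex.norm_exp_ofReal_mul_I, mul_one, norm_pow]
      have hn : 0 < √(n : ℝ) := by
        by_contra h
        have h0 : √(n : ℝ) = 0 := le_antisymm (not_lt.1 h) (Real.sqrt_nonneg _)
        rw [h0, mul_zero, mul_zero] at hs
        exact absurd hs.1 (not_lt.2 hs.2)
      have h1 : |(√(n : ℝ))⁻¹ * s| ≤ b := by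
        rw [inv_mul_eq_div, abs_div, abs_of_pos hn, div_le_iff₀ hn, abs_le]
        exact ⟨by linarith [hs.1], hs.2⟩
      refine (pow_le_pow_left₀ (norm_nonneg _) (hφ _ h1) n).trans ?_
      rw [← Real.exp_nat_mul, Real.exp_le_exp, mul_pow, inv_pow, Real.sq_sqrt (Nat.cast_nonneg n)]
      have hn0 : (n : ℝ) ≠ 0 := fun h => by rw [h, Real.sqrt_zero] at hn; exact lt_irrefl _ hn
      apply le_of_eq
      field_simp
    · simp only [hF, Set.indicator_of_notMem hs, norm_zero]
      positivity
  · have hsq : Tendsto (fun n : ℕ => √(n : ℝ)) atTop atTop :=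
      Real.tendsto_sqrt_atTop.comp tendsto_natCast_atTop_atTop
    have h1 := tendsto_centredCharFun_pow hfin hmean hvar s
    have h2 : Tendsto (fun n : ℕ => Complex.exp (((√(n : ℝ))⁻¹ * s : ℝ) * Complex.I)) atTop
        (𝓝 1) := by
      have h3 : Tendsto (fun n : ℕ => (√(n : ℝ))⁻¹ * s) atTop (𝓝 0) := by
        rw [← zero_mul s]; exact (tendsto_inv_atTop_zero.comp hsq).mul_const s
      have h4 : Continuous fun x : ℝ => Complex.exp (x * Complex.I) := by fun_prop
      have h5 := (h4.tendsto 0).comp h3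
      simp only [Complex.ofReal_zero, zero_mul, Complex.exp_zero] at h5
      exact h5
    have h3 := h1.mul h2
    rw [mul_one] at h3
    refine h3.congr' ?_
    have h4 : Tendsto (fun n : ℕ => b * √(n : ℝ)) atTop atTop := hsq.const_mul_atTop hb
    filter_upwards [h4.eventually_gt_atTop |s|] with n hn
    simp only [hF]
    rw [Set.indicator_of_mem]
    have := abs_lt.1 hn
    exact ⟨by linarith [this.1], this.2.le⟩

/-- A critical offspring distribution with finite variance satisfies the local estimates. -/
theorem exists_localLimitBounds (hfin : MemLp (fun k : ℕ => (k : ℝ)) 2 ν)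
    (hmean : ∫ k : ℕ, (k : ℝ) ∂ν = 1) (hvar : 0 < Var[fun k : ℕ => (k : ℝ); ν]) :
    ∃ d c C, LocalLimitBounds (fun i => ν.real {i}) d c C := by
  obtain ⟨d, hd, hdvd, hspan⟩ := exists_span hmean
  obtain ⟨c, hc, hφ⟩ := exists_norm_centredCharFun_le_exp hfin hmean hvar hd hspan
  set b := Real.pi / d with hbdef
  have hd0 : (0 : ℝ) < d := by exact_mod_cast hd
  have hb : 0 < b := div_pos Real.pi_pos hd0
  obtain ⟨K, hK0, hK⟩ := exists_norm_one_sub_exp_mul_pow_le hfin hmean hvar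
  obtain ⟨G, hG0, hG⟩ := exists_norm_integral_le hc hb.le
  set κ : ℝ := d / (2 * Real.pi) with hκ
  have hκ0 : 0 < κ := by positivity
  set p : ℕ → ℝ := fun i => ν.real {i} with hp
  set φ := centredCharFun ν with hφdef
  have hcont : Continuous φ := continuous_centredCharFun ν
  have hp0 : ∀ i, 0 ≤ p i := fun i => measureReal_nonneg
  have hpd : ∀ i, p i ≠ 0 → d ∣ i := fun i hi => hdvd i fun h => hi (by
    rw [hp]; simp only [Measure.real]; rw [h, ENNReal.toReal_zero])
  have hinv : ∀ (m : ℕ) {j : ℕ}, d ∣ j → (walkProb p m j : ℂ) = (κ : ℂ) *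
      ∫ t in (-b)..b, φ t ^ m * Complex.exp (t * Complex.I * (m - j)) :=
    fun m {j} hj => walkProb_eq_integral ν hd hdvd m hj
  have hpow : ∀ (m : ℕ) (t : ℝ), |t| ≤ b → ‖φ t ^ m‖ ≤ Real.exp (-(c * m * t ^ 2)) := by
    intro m t ht
    rw [norm_pow]
    refine (pow_le_pow_left₀ (norm_nonneg _) (hφ t ht) m).trans ?_
    rw [← Real.exp_nat_mul, Real.exp_le_exp]
    apply le_of_eq; ring
  have hii : ∀ f : ℝ → ℂ, Continuous f → IntervalIntegrable f volume (-b) b :=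
    fun f hf => hf.intervalIntegrable _ _
  -- the three kinds of probabilities
  have hq : ∀ m, d ∣ m → (walkProb p m m : ℂ) = κ * ∫ t in (-b)..b, φ t ^ m := by
    intro m hm
    rw [hinv m hm]
    simp
  have hP : ∀ m, 1 ≤ m → d ∣ m - 1 → (walkProb p m (m - 1) : ℂ)
      = κ * ∫ t in (-b)..b, φ t ^ m * Complex.exp (t * Complex.I) := by
    intro m hm1 hm
    rw [hinv m hm, Nat.cast_sub hm1]
    simp
  have hR : ∀ m, d ∣ m + 1 → (walkProb p m (m + 1) : ℂ)
      = κ * ∫ t in (-b)..b, φ t ^ m * Complex.exp (-(t * Complex.I)) := by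
    intro m hm
    rw [hinv m hm]
    congr 2; ext t; congr 2; push_cast; ring
  have hexp : ∀ t : ℝ, Complex.exp (-(t * Complex.I)) * Complex.exp (t * Complex.I) = 1 := by
    intro t; rw [← Complex.exp_add]; simp
  have hexpn : ∀ t : ℝ, ‖Complex.exp (-(t * Complex.I))‖ = 1 := by
    intro t
    have := Complex.norm_exp_ofReal_mul_I (-t)
    rwa [Complex.ofReal_neg, neg_mul] at this
  obtain ⟨c', hc', hlow⟩ : ∃ c' > 0, ∀ n, 1 ≤ n → walkProb p n (n - 1) ≠ 0 →
      c' ≤ √(n : ℝ) * walkProb p n (n - 1) := by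
    -- the local limit theorem leaves finitely many `n`, for which positivity suffices
    set L : ℝ := κ * √(2 * Real.pi / Var[fun k : ℕ => (k : ℝ); ν]) with hL
    have hL0 : 0 < L := mul_pos hκ0 (Real.sqrt_pos.2 (by positivity))
    have h1 := (tendsto_sqrt_mul_integral hfin hmean hvar hb hc hφ).const_mul (κ : ℂ)
    have h2 := (Complex.continuous_re.tendsto _).comp h1
    have h3 : ((κ : ℂ) * ((√(2 * Real.pi / Var[fun k : ℕ => (k : ℝ); ν]) : ℝ) : ℂ)).re = L := by
      rw [← Complex.ofReal_mul, Complex.ofReal_re]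
    rw [h3] at h2
    obtain ⟨N, hN⟩ := eventually_atTop.1 (h2.eventually (eventually_gt_nhds (half_lt_self hL0)))
    have hsmall : ∀ N : ℕ, ∃ c' > 0, ∀ n < N, 1 ≤ n → walkProb p n (n - 1) ≠ 0 →
        c' ≤ √(n : ℝ) * walkProb p n (n - 1) := by
      intro N
      induction N with
      | zero => exact ⟨1, one_pos, fun n hn => absurd hn (Nat.not_lt_zero n)⟩
      | succ N ih =>
        obtain ⟨c₁, hc₁, h⟩ := ih
        by_cases hN : 1 ≤ N ∧ walkProb p N (N - 1) ≠ 0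
        · have h4 : 0 < √(N : ℝ) * walkProb p N (N - 1) :=
            mul_pos (Real.sqrt_pos.2 (by exact_mod_cast hN.1))
              (lt_of_le_of_ne (walkProb_nonneg hp0 _ _) (Ne.symm hN.2))
          refine ⟨min c₁ (√(N : ℝ) * walkProb p N (N - 1)), lt_min hc₁ h4, fun n hn h5 h6 => ?_⟩
          rcases Nat.lt_succ_iff_lt_or_eq.1 hn with h7 | rfl
          · exact (min_le_left _ _).trans (h n h7 h5 h6)
          · exact min_le_right _ _
        · refine ⟨c₁, hc₁, fun n hn h5 h6 => ?_⟩
          rcases Nat.lt_succ_iff_lt_or_eq.1 hn with h7 | rfl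
          · exact h n h7 h5 h6
          · exact absurd ⟨h5, h6⟩ hN
    obtain ⟨c₁, hc₁, h⟩ := hsmall N
    refine ⟨min c₁ (L / 2), lt_min hc₁ (by positivity), fun n hn h6 => ?_⟩
    rcases lt_or_ge n N with h7 | h7
    · exact (min_le_left _ _).trans (h n h7 hn h6)
    · refine (min_le_right _ _).trans ?_
      have hdn : d ∣ n - 1 := by
        by_contra h8
        exact h6 (walkProb_eq_zero_of_not_dvd hpd n h8)
      have h9 := (hN n h7).le
      simp only [Function.comp_apply] at h9
      rw [mul_left_comm, ← hφdef, ← hP n hn hdn, ← Complex.ofReal_mul, Complex.ofReal_re] at h9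
      exact h9
  refine ⟨d, c', κ * G * (1 + K + K * K), ?_, ?_, ?_, ?_, ?_, ?_, ?_, ?_⟩
  · exact hc'
  · positivity
  · intro m j h
    by_contra h1
    exact h (walkProb_eq_zero_of_not_dvd hpd m h1)
  · intro m j
    by_cases hj : d ∣ j
    · have h1 := hG 0 (by norm_num) m 1 (fun t => φ t ^ m * Complex.exp (t * Complex.I * (m - j)))
        zero_le_one (fun t ht => by
          have e : (t : ℂ) * Complex.I * (m - j) = ((t * (m - j) : ℝ) : ℂ) * Complex.I := by
            push_cast; ring
          rw [norm_mul, e, Complex.norm_exp_ofReal_mul_I, mul_one, pow_zero, one_mul, one_mul]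
          exact hpow m t ht)
      have h2 : walkProb p m j = ‖(walkProb p m j : ℂ)‖ := by
        rw [Complex.norm_real, Real.norm_of_nonneg (walkProb_nonneg hp0 m j)]
      rw [h2, hinv m hj, norm_mul, Complex.norm_real, Real.norm_of_nonneg hκ0.le]
      refine (mul_le_mul_of_nonneg_left h1 hκ0.le).trans ?_
      rw [zero_add, pow_one, mul_one, ← mul_div_assoc]
      refine div_le_div_of_nonneg_right (le_mul_of_one_le_right (by positivity) ?_) (by positivity)
      nlinarith
    · rw [walkProb_eq_zero_of_not_dvd hpd m hj]
      positivity
  · intro n hn h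
    rw [div_le_iff₀ (Real.sqrt_pos.2 (by exact_mod_cast hn)), mul_comm]
    exact hlow n hn h
  · intro m l hl h1 h2
    have h3 := hG 1 (by norm_num) m (K * √(l : ℝ))
      (fun t => φ t ^ m - φ t ^ (m + l) * Complex.exp (t * Complex.I)) (by positivity)
      (fun t ht => by
        have e : φ t ^ m - φ t ^ (m + l) * Complex.exp (t * Complex.I)
            = (1 - Complex.exp (t * Complex.I) * φ t ^ l) * φ t ^ m := by ring
        rw [e, norm_mul, pow_one]
        exact mul_le_mul (hK l t hl) (hpow m t ht) (norm_nonneg _) (by positivity))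
    rw [intervalIntegral.integral_sub (hii _ (by fun_prop)) (hii _ (by fun_prop))] at h3
    rw [← Real.norm_eq_abs, ← Complex.norm_real, Complex.ofReal_sub, hq m h1,
      hP (m + l) (by omega) h2, ← mul_sub, norm_mul, Complex.norm_real,
      Real.norm_of_nonneg hκ0.le]
    refine (mul_le_mul_of_nonneg_left h3 hκ0.le).trans ?_
    rw [Real.sq_sqrt (by positivity), ← mul_div_assoc]
    refine div_le_div_of_nonneg_right ?_ (by positivity)
    have : 0 ≤ κ * G * √(l : ℝ) * (1 + K * K) := by positivity
    linarith
  · intro m l hl h1 h2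
    have h3 := hG 1 (by norm_num) m (K * √(l : ℝ))
      (fun t => φ t ^ m * Complex.exp (-(t * Complex.I)) - φ t ^ (m + l)) (by positivity)
      (fun t ht => by
        have e : φ t ^ m * Complex.exp (-(t * Complex.I)) - φ t ^ (m + l)
            = Complex.exp (-(t * Complex.I)) *
              ((1 - Complex.exp (t * Complex.I) * φ t ^ l) * φ t ^ m) := by
          linear_combination φ t ^ (m + l) * hexp t
        rw [e, norm_mul, hexpn, one_mul, norm_mul, pow_one]
        exact mul_le_mul (hK l t hl) (hpow m t ht) (norm_nonneg _) (by positivity))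
    rw [intervalIntegral.integral_sub (hii _ (by fun_prop)) (hii _ (by fun_prop))] at h3
    rw [← Real.norm_eq_abs, ← Complex.norm_real, Complex.ofReal_sub, hR m h1,
      hq (m + l) h2, ← mul_sub, norm_mul, Complex.norm_real,
      Real.norm_of_nonneg hκ0.le]
    refine (mul_le_mul_of_nonneg_left h3 hκ0.le).trans ?_
    rw [Real.sq_sqrt (by positivity), ← mul_div_assoc]
    refine div_le_div_of_nonneg_right ?_ (by positivity)
    have : 0 ≤ κ * G * √(l : ℝ) * (1 + K * K) := by positivity
    linarith
  · intro m k l hk hl h1 h2 h3 h4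
    have h5 := hG 2 le_rfl m (K * √(k : ℝ) * (K * √(l : ℝ)))
      (fun t => φ t ^ m * Complex.exp (-(t * Complex.I)) - φ t ^ (m + l)
        + φ t ^ (m + k + l) * Complex.exp (t * Complex.I) - φ t ^ (m + k)) (by positivity)
      (fun t ht => by
        have e : φ t ^ m * Complex.exp (-(t * Complex.I)) - φ t ^ (m + l)
            + φ t ^ (m + k + l) * Complex.exp (t * Complex.I) - φ t ^ (m + k)
            = Complex.exp (-(t * Complex.I)) *
              ((1 - Complex.exp (t * Complex.I) * φ t ^ k)
                * (1 - Complex.exp (t * Complex.I) * φ t ^ l) * φ t ^ m) := by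
          linear_combination (φ t ^ (m + l) + φ t ^ (m + k)
            - φ t ^ (m + k + l) * Complex.exp (t * Complex.I)) * hexp t
        rw [e, norm_mul, hexpn, one_mul, norm_mul, norm_mul]
        have h6 := mul_le_mul (hK k t hk) (hK l t hl) (norm_nonneg _) (by positivity)
        refine (mul_le_mul h6 (hpow m t ht) (norm_nonneg _) (by positivity)).trans ?_
        apply le_of_eq; ring)
    rw [intervalIntegral.integral_sub (hii _ (by fun_prop)) (hii _ (by fun_prop)),
      intervalIntegral.integral_add (hii _ (by fun_prop)) (hii _ (by fun_prop)),
      intervalIntegral.integral_sub (hii _ (by fun_prop)) (hii _ (by fun_prop))] at h5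
    rw [← Real.norm_eq_abs, ← Complex.norm_real, Complex.ofReal_sub, Complex.ofReal_add,
      Complex.ofReal_sub, hR m h1, hq (m + l) h2, hq (m + k) h3,
      hP (m + k + l) (by omega) h4, ← mul_sub, ← mul_add, ← mul_sub, norm_mul, Complex.norm_real,
      Real.norm_of_nonneg hκ0.le]
    refine (mul_le_mul_of_nonneg_left h5 hκ0.le).trans ?_
    rw [← mul_div_assoc]
    refine div_le_div_of_nonneg_right ?_ (by positivity)
    have : 0 ≤ κ * G * (√(k : ℝ) * √(l : ℝ)) * (1 + K) := by positivity
    linarith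

end

/-! ### Sums and kernels for the variance estimate -/

/-- The function `1 / √(m + 1)`, which is the order of the local probabilities at time `m`. -/
noncomputable def invSqrtSucc (m : ℕ) : ℝ := 1 / √((m : ℝ) + 1)

theorem invSqrtSucc_pos (m : ℕ) : 0 < invSqrtSucc m := by
  unfold invSqrtSucc; positivity

theorem invSqrtSucc_anti {m n : ℕ} (h : m ≤ n) : invSqrtSucc n ≤ invSqrtSucc m := by
  unfold invSqrtSucc
  have : (m : ℝ) ≤ n := by exact_mod_cast h
  gcongr

theorem invSqrtSucc_sq (m : ℕ) : invSqrtSucc m * invSqrtSucc m = 1 / ((m : ℝ) + 1) := by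
  unfold invSqrtSucc
  rw [div_mul_div_comm, one_mul, Real.mul_self_sqrt (by positivity)]

theorem sqrt_mul_invSqrtSucc (m : ℕ) : √((m : ℝ) + 1) * invSqrtSucc m = 1 := by
  unfold invSqrtSucc
  rw [mul_one_div_cancel (by positivity)]

theorem invSqrtSucc_le_two_div {m n : ℕ} (hn : 1 ≤ n) (h : n ≤ 4 * (m + 1)) :
    invSqrtSucc m ≤ 2 / √(n : ℝ) := by
  have hn0 : (0 : ℝ) < n := by exact_mod_cast hn
  have h1 : (n : ℝ) ≤ 2 ^ 2 * (m + 1) := by exact_mod_cast (by omega : n ≤ 2 ^ 2 * (m + 1))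
  have h2 : √(n : ℝ) ≤ 2 * √((m : ℝ) + 1) := by
    rw [← Real.sqrt_sq (zero_le_two : (0 : ℝ) ≤ 2), ← Real.sqrt_mul (by norm_num)]
    exact Real.sqrt_le_sqrt h1
  unfold invSqrtSucc
  rw [div_le_div_iff₀ (by positivity) (Real.sqrt_pos.2 hn0)]
  linarith

theorem one_div_sqrt_le_invSqrtSucc {m n : ℕ} (h : m + 1 ≤ n) :
    1 / √(n : ℝ) ≤ invSqrtSucc m := by
  unfold invSqrtSucc
  have : (m : ℝ) + 1 ≤ n := by exact_mod_cast h
  gcongr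

theorem sum_invSqrtSucc_le (n : ℕ) :
    ∑ k ∈ Finset.range (n + 1), invSqrtSucc k ≤ 2 * √((n : ℝ) + 1) := by
  induction n with
  | zero => simp [invSqrtSucc]
  | succ n ih =>
    rw [Finset.sum_range_succ]
    have h : invSqrtSucc (n + 1) ≤ 2 * √((n : ℝ) + 1 + 1) - 2 * √((n : ℝ) + 1) := by
      unfold invSqrtSucc
      push_cast
      set x := √((n : ℝ) + 1)
      set y := √((n : ℝ) + 1 + 1)
      have hx : 0 < x := by positivity
      have hy : 0 < y := by positivity
      have hxy : y ^ 2 = x ^ 2 + 1 := by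
        rw [Real.sq_sqrt (by positivity), Real.sq_sqrt (by positivity)]
      rw [div_le_iff₀ hy]
      nlinarith [sq_nonneg (y - x)]
    push_cast
    linarith

/-- If `s` is bounded by `B` and `∑ s k / k ≤ B`, then the convolution of `s k / k` with
`1 / √(m + 1)` is `O(B / √n)`: the sum over `k ≤ n / 2` is controlled by the second assumption, the
sum over `k > n / 2` by the first. -/
theorem sum_div_mul_invSqrtSucc_le {s : ℕ → ℝ} {B : ℝ} {n : ℕ} (hs : ∀ k, 0 ≤ s k)
    (hB : ∀ k ≤ n, s k ≤ B) (hsum : ∑ k ∈ Finset.range (n + 1), s k / k ≤ B) :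
    ∑ k ∈ Finset.range (n + 1), s k / k * invSqrtSucc (n - k) ≤ 6 * B * invSqrtSucc n := by
  have hB0 : 0 ≤ B := (hs 0).trans (hB 0 (Nat.zero_le n))
  have hn := invSqrtSucc_pos n
  have hterm : ∀ k ∈ Finset.range (n + 1), s k / k * invSqrtSucc (n - k)
      ≤ 2 * invSqrtSucc n * (s k / k) + 2 * B / ((n : ℝ) + 1) * invSqrtSucc (n - k) := by
    intro k hk
    rw [Finset.mem_range] at hk
    have h0 : 0 ≤ s k / k := div_nonneg (hs k) (Nat.cast_nonneg k)
    have h1 := invSqrtSucc_pos (n - k)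
    rcases le_or_gt (2 * k) n with h | h
    · have h2 : invSqrtSucc (n - k) ≤ 2 * invSqrtSucc n := by
        have := invSqrtSucc_le_two_div (m := n - k) (n := n + 1) (by omega) (by omega)
        unfold invSqrtSucc at this ⊢
        push_cast at this
        rw [mul_one_div]; exact this
      have h3 := mul_le_mul_of_nonneg_left h2 h0
      have h4 : 0 ≤ 2 * B / ((n : ℝ) + 1) * invSqrtSucc (n - k) := by positivity
      linarith
    · have hk0 : (0 : ℝ) < k := by exact_mod_cast (by omega : 0 < k)
      have h2 : s k / k ≤ 2 * B / ((n : ℝ) + 1) := by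
        rw [div_le_div_iff₀ hk0 (by positivity)]
        have h3 : (n : ℝ) + 1 ≤ 2 * k := by exact_mod_cast (by omega : n + 1 ≤ 2 * k)
        calc s k * ((n : ℝ) + 1) ≤ B * (2 * k) :=
              mul_le_mul (hB k (by omega)) h3 (by positivity) hB0
          _ = _ := by ring
      have h3 := mul_le_mul_of_nonneg_right h2 h1.le
      have h4 : 0 ≤ 2 * invSqrtSucc n * (s k / k) := by positivity
      linarith
  refine (Finset.sum_le_sum hterm).trans ?_
  rw [Finset.sum_add_distrib, ← Finset.mul_sum, ← Finset.mul_sum]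
  have h1 : ∑ k ∈ Finset.range (n + 1), invSqrtSucc (n - k) ≤ 2 * √((n : ℝ) + 1) := by
    have := Finset.sum_range_reflect invSqrtSucc (n + 1)
    simp only [Nat.add_sub_cancel] at this
    rw [this]
    exact sum_invSqrtSucc_le n
  have h2 := mul_le_mul_of_nonneg_left hsum (show 0 ≤ 2 * invSqrtSucc n by positivity)
  have h3 := mul_le_mul_of_nonneg_left h1 (show 0 ≤ 2 * B / ((n : ℝ) + 1) by positivity)
  have h4 : 2 * B / ((n : ℝ) + 1) * (2 * √((n : ℝ) + 1)) = 4 * B * invSqrtSucc n := by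
    have h5 : ((n : ℝ) + 1) = √((n : ℝ) + 1) * √((n : ℝ) + 1) :=
      (Real.mul_self_sqrt (by positivity)).symm
    have h6 : √((n : ℝ) + 1) ≠ 0 := by positivity
    unfold invSqrtSucc
    conv_lhs => enter [1, 2]; rw [h5]
    field_simp
    ring
  linarith

/-- The number of ordered pairs of disjoint fringe subtrees of sizes `k` and `l` in a tree of size
`n` is governed by this coefficient of `branchingSeries p`. -/
noncomputable def pairCoeff (p : ℕ → ℝ) (n k l : ℕ) : ℝ :=
  if k + l ≤ n then (((n - k - l : ℕ) : ℝ) + 1) * walkProb p (n - k - l) (n - k - l + 1) else 0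

theorem pairCoeff_comm (p : ℕ → ℝ) (n k l : ℕ) : pairCoeff p n k l = pairCoeff p n l k := by
  rw [pairCoeff, pairCoeff, Nat.sub_right_comm, add_comm k l]

namespace LocalLimitBounds

variable {p : ℕ → ℝ} {d : ℕ} {c C : ℝ} (H : LocalLimitBounds p d c C)

include H

theorem walkProb_le (m j : ℕ) : walkProb p m j ≤ C * invSqrtSucc m := by
  unfold invSqrtSucc
  rw [mul_one_div]; exact H.upper m j

theorem dvd_pred {k : ℕ} (h : walkProb p k (k - 1) ≠ 0) : d ∣ k - 1 := H.dvd _ _ h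

theorem dvd_sub {k l : ℕ} (hl : 1 ≤ l) (hkl : l ≤ k) (hk' : walkProb p k (k - 1) ≠ 0)
    (hl' : walkProb p l (l - 1) ≠ 0) : d ∣ k - l := by
  have h := Nat.dvd_sub (H.dvd_pred hk') (H.dvd_pred hl')
  rwa [show k - 1 - (l - 1) = k - l by omega] at h

theorem abs_sub_le (hp : ∀ i, 0 ≤ p i) {k l : ℕ} (hl : 1 ≤ l) (hkl : l ≤ k)
    (hk' : walkProb p k (k - 1) ≠ 0) (hl' : walkProb p l (l - 1) ≠ 0) :
    |walkProb p (k - l) (k - l) - walkProb p k (k - 1)|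
      ≤ 2 * C * √(l : ℝ) * invSqrtSucc (k - l) / √(k : ℝ) := by
  have hC := H.C_nonneg
  have hk0 : (0 : ℝ) < √(k : ℝ) := Real.sqrt_pos.2 (by exact_mod_cast (by omega : 0 < k))
  have hpos := invSqrtSucc_pos (k - l)
  rcases le_or_gt (2 * l) k with h | h
  · have h1 := H.diff_pred (k - l) l hl (H.dvd_sub hl hkl hk' hl')
      (by rw [show k - l + l - 1 = k - 1 by omega]; exact H.dvd_pred hk')
    rw [show k - l + l = k by omega, div_eq_mul_one_div, ← invSqrtSucc_sq] at h1
    refine h1.trans ?_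
    have h2 := invSqrtSucc_le_two_div (m := k - l) (n := k) (by omega) (by omega)
    calc C * √(l : ℝ) * (invSqrtSucc (k - l) * invSqrtSucc (k - l))
        ≤ C * √(l : ℝ) * (invSqrtSucc (k - l) * (2 / √(k : ℝ))) := by gcongr
      _ = _ := by ring
  · have h1 : |walkProb p (k - l) (k - l) - walkProb p k (k - 1)| ≤ C * invSqrtSucc (k - l) := by
      rw [abs_le]
      have e1 := H.walkProb_le (k - l) (k - l)
      have e2 := H.walkProb_le k (k - 1)
      have e3 := mul_le_mul_of_nonneg_left (invSqrtSucc_anti (show k - l ≤ k by omega)) hC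
      have e4 := walkProb_nonneg hp (k - l) (k - l)
      have e5 := walkProb_nonneg hp k (k - 1)
      constructor <;> linarith
    refine h1.trans ?_
    rw [le_div_iff₀ hk0]
    have h2 : √(k : ℝ) ≤ 2 * √(l : ℝ) := by
      rw [← Real.sqrt_sq (zero_le_two : (0 : ℝ) ≤ 2), ← Real.sqrt_mul (by norm_num)]
      refine Real.sqrt_le_sqrt ?_
      exact_mod_cast (by omega : k ≤ 2 ^ 2 * l)
    calc C * invSqrtSucc (k - l) * √(k : ℝ) ≤ C * invSqrtSucc (k - l) * (2 * √(l : ℝ)) := by gcongr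
      _ = _ := by ring

end LocalLimitBounds

namespace LocalLimitBounds

variable {p : ℕ → ℝ} {d : ℕ} {c C : ℝ} (H : LocalLimitBounds p d c C)

include H

theorem inv_walkProb_le {n : ℕ} (hn : 1 ≤ n) (hn' : walkProb p n (n - 1) ≠ 0)
    (hp : ∀ i, 0 ≤ p i) : 1 / walkProb p n (n - 1) ≤ √(n : ℝ) / c := by
  have h1 := H.lower n hn hn'
  have h2 : 0 < walkProb p n (n - 1) := lt_of_le_of_ne (walkProb_nonneg hp _ _) (Ne.symm hn')
  have h3 : 0 < √(n : ℝ) := Real.sqrt_pos.2 (by exact_mod_cast hn)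
  rw [div_le_iff₀ h3] at h1
  rw [div_le_div_iff₀ h2 H.c_pos]
  linarith

/-- The kernel `r + k q (n - k) - q (n - k) q (n - l) / π n`, with `r = pairCoeff p n k l`, is the
covariance of the numbers of fringe subtrees of sizes `k` and `l`, divided by `π k π l / π n`, in
which the factor `q (k - l)` of the nested pairs has been replaced by its approximation `k π k`.

For `k` of the order of `n` its estimate only uses first order differences over `l` steps. -/
theorem abs_kernel_le_of_large (hp : ∀ i, 0 ≤ p i) {n k l : ℕ} (hl : 1 ≤ l) (hlk : l ≤ k)
    (hkn : k ≤ n) (h4 : n ≤ 4 * k) (hn' : walkProb p n (n - 1) ≠ 0)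
    (hk' : walkProb p k (k - 1) ≠ 0) (hl' : walkProb p l (l - 1) ≠ 0) :
    |pairCoeff p n k l + k * walkProb p (n - k) (n - k)
        - n * walkProb p (n - k) (n - k) * walkProb p (n - l) (n - l) / walkProb p n (n - 1)|
      ≤ (3 * C + 4 * C ^ 2 / c) *
        (√(k : ℝ) * √(l : ℝ) * √(n : ℝ) * invSqrtSucc (n - k) * invSqrtSucc (n - l)) := by
  have hC := H.C_nonneg
  have hc := H.c_pos
  have hn : 1 ≤ n := by omega
  set q := walkProb p (n - k) (n - k) with hq
  set q' := walkProb p (n - l) (n - l) with hq'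
  set P := walkProb p n (n - 1) with hP
  set x := invSqrtSucc (n - k) with hx
  set y := invSqrtSucc (n - l) with hy
  set sk := √(k : ℝ) with hsk
  set sl := √(l : ℝ) with hsl
  set sn := √(n : ℝ) with hsn
  have hx0 : 0 < x := invSqrtSucc_pos _
  have hy0 : 0 < y := invSqrtSucc_pos _
  have hsl1 : 1 ≤ sl := Real.one_le_sqrt.2 (by exact_mod_cast hl)
  have hslk : sl ≤ sk := Real.sqrt_le_sqrt (by exact_mod_cast hlk)
  have hsn1 : 1 ≤ sn := Real.one_le_sqrt.2 (by exact_mod_cast hn)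
  have hll : (l : ℝ) = sl * sl := (Real.mul_self_sqrt (Nat.cast_nonneg l)).symm
  have hnn : (n : ℝ) = sn * sn := (Real.mul_self_sqrt (Nat.cast_nonneg n)).symm
  have hq0 : 0 ≤ q := walkProb_nonneg hp _ _
  have hqx : q ≤ C * x := H.walkProb_le _ _
  have hP0 : 0 < P := lt_of_le_of_ne (walkProb_nonneg hp _ _) (Ne.symm hn')
  have hny : 1 ≤ sn * y := by
    have := one_div_sqrt_le_invSqrtSucc (m := n - l) (n := n) (by omega)
    rw [div_le_iff₀ (by linarith)] at this
    linarith
  have hkx : 1 ≤ 2 * sk * x := by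
    have h1 : ((n - k : ℕ) : ℝ) + 1 ≤ 2 ^ 2 * k := by
      exact_mod_cast (by omega : n - k + 1 ≤ 2 ^ 2 * k)
    have h2 : √(((n - k : ℕ) : ℝ) + 1) ≤ 2 * sk := by
      rw [← Real.sqrt_sq (zero_le_two : (0 : ℝ) ≤ 2), hsk, ← Real.sqrt_mul (by norm_num)]
      exact Real.sqrt_le_sqrt h1
    have h3 := sqrt_mul_invSqrtSucc (n - k)
    nlinarith
  have hnk : sn ≤ 2 * sk := by
    rw [← Real.sqrt_sq (zero_le_two : (0 : ℝ) ≤ 2), hsk, ← Real.sqrt_mul (by norm_num)]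
    exact Real.sqrt_le_sqrt (by exact_mod_cast h4)
  have hU : |pairCoeff p n k l - ((n - k : ℕ) : ℝ) * q| ≤ 3 * C * (sk * sl * x) := by
    have hlx : l * (C * x) ≤ C * (sk * sl * x) := by
      rw [hll]
      have : sl * sl ≤ sk * sl := mul_le_mul_of_nonneg_right hslk (by linarith)
      have := mul_le_mul_of_nonneg_right this (show 0 ≤ C * x by positivity)
      linarith
    have hpos : 0 ≤ C * (sk * sl * x) := by positivity
    by_cases hkl : k + l ≤ n
    · set N := n - k - l with hN
      have hNl : n - k = N + l := by omega
      have h1 := H.diff_succ N l hl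
        (by
          have h1 := Nat.dvd_sub (H.dvd_sub (by omega) hkn hn' hk') (H.dvd_pred hl')
          rwa [show n - k - (l - 1) = N + 1 by omega] at h1)
        (by rw [← hNl]; exact H.dvd_sub (by omega) hkn hn' hk')
      rw [← hNl] at h1
      rw [pairCoeff, if_pos hkl]
      have hN1 : (0 : ℝ) < (N : ℝ) + 1 := by positivity
      rw [le_div_iff₀ hN1] at h1
      have h2 : sl ≤ 2 * (sk * sl * x) := by nlinarith
      have e : ((N : ℝ) + 1) * walkProb p N (N + 1) - ((n - k : ℕ) : ℝ) * q
          = (walkProb p N (N + 1) - q) * ((N : ℝ) + 1) - ((l : ℝ) - 1) * q := by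
        rw [hNl]; push_cast; ring
      rw [e]
      refine (abs_sub _ _).trans ?_
      rw [abs_mul, abs_of_pos hN1, abs_mul, abs_of_nonneg hq0]
      have h3 : |(l : ℝ) - 1| ≤ l := by
        have : (1 : ℝ) ≤ l := by exact_mod_cast hl
        rw [abs_of_nonneg (by linarith)]; linarith
      have h4 : |(l : ℝ) - 1| * q ≤ l * (C * x) := mul_le_mul h3 hqx hq0 (Nat.cast_nonneg l)
      have h5 := mul_le_mul_of_nonneg_left h2 hC
      linarith
    · rw [pairCoeff, if_neg hkl, zero_sub, abs_neg, abs_mul, Nat.abs_cast, abs_of_nonneg hq0]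
      have h1 : ((n - k : ℕ) : ℝ) ≤ l := by exact_mod_cast (by omega : n - k ≤ l)
      have h2 := mul_le_mul h1 hqx hq0 (Nat.cast_nonneg l)
      linarith
  have hD := H.abs_sub_le hp hl (hlk.trans hkn) hn' hl'
  have hV : |n * q / P * (P - q')| ≤ 4 * C ^ 2 / c * (sk * sl * sn * x * y) := by
    rw [abs_mul, abs_of_nonneg (by positivity : 0 ≤ n * q / P), abs_sub_comm]
    have h1 : n * q / P ≤ sn * sn * (C * x) * (sn / c) := by
      rw [div_eq_mul_one_div, hnn]
      exact mul_le_mul (mul_le_mul_of_nonneg_left hqx (by positivity))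
        (H.inv_walkProb_le hn hn' hp) (by positivity) (by positivity)
    refine (mul_le_mul h1 hD (abs_nonneg _) (by positivity)).trans ?_
    have e : sn * sn * (C * x) * (sn / c) * (2 * C * sl * y / sn)
        = 2 * C ^ 2 / c * (sl * sn * x * y) * sn := by
      field_simp
    rw [e]
    have := mul_le_mul_of_nonneg_left hnk
      (show 0 ≤ 2 * C ^ 2 / c * (sl * sn * x * y) by positivity)
    refine this.trans (le_of_eq ?_)
    ring
  have e : pairCoeff p n k l + k * q - n * q * q' / P
      = (pairCoeff p n k l - ((n - k : ℕ) : ℝ) * q) + n * q / P * (P - q') := by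
    rw [Nat.cast_sub hkn]
    field_simp
    ring
  rw [e]
  refine (abs_add_le _ _).trans ?_
  have h6 : sk * sl * x ≤ sk * sl * sn * x * y := by
    have := mul_le_mul_of_nonneg_left hny (show 0 ≤ sk * sl * x by positivity)
    linarith
  have h7 := mul_le_mul_of_nonneg_left h6 (show 0 ≤ 3 * C by positivity)
  rw [add_mul]
  linarith

/-- The kernel of `abs_kernel_le_of_large` for `k` small compared with `n`. Here the first order
differences over `k` and over `l` steps are too large one by one, and combine to a second order
difference. -/
theorem abs_kernel_le_of_small (hp : ∀ i, 0 ≤ p i) {n k l : ℕ} (hl : 1 ≤ l) (hlk : l ≤ k)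
    (h4 : 4 * k < n) (hn' : walkProb p n (n - 1) ≠ 0)
    (hk' : walkProb p k (k - 1) ≠ 0) (hl' : walkProb p l (l - 1) ≠ 0) :
    |pairCoeff p n k l + k * walkProb p (n - k) (n - k)
        - n * walkProb p (n - k) (n - k) * walkProb p (n - l) (n - l) / walkProb p n (n - 1)|
      ≤ (14 * C + 16 * C ^ 2 / c) *
        (√(k : ℝ) * √(l : ℝ) * √(n : ℝ) * invSqrtSucc (n - k) * invSqrtSucc (n - l)) := by
  have hC := H.C_nonneg
  have hc := H.c_pos
  have hn : 1 ≤ n := by omega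
  have hk : 1 ≤ k := by omega
  set q := walkProb p (n - k) (n - k) with hq
  set q' := walkProb p (n - l) (n - l) with hq'
  set P := walkProb p n (n - 1) with hP
  set x := invSqrtSucc (n - k) with hx
  set y := invSqrtSucc (n - l) with hy
  set sk := √(k : ℝ) with hsk
  set sl := √(l : ℝ) with hsl
  set sn := √(n : ℝ) with hsn
  have hx0 : 0 < x := invSqrtSucc_pos _
  have hy0 : 0 < y := invSqrtSucc_pos _
  have hsl1 : 1 ≤ sl := Real.one_le_sqrt.2 (by exact_mod_cast hl)
  have hslk : sl ≤ sk := Real.sqrt_le_sqrt (by exact_mod_cast hlk)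
  have hsn1 : 1 ≤ sn := Real.one_le_sqrt.2 (by exact_mod_cast hn)
  have hsn0 : 0 < sn := by linarith
  have hll : (l : ℝ) = sl * sl := (Real.mul_self_sqrt (Nat.cast_nonneg l)).symm
  have hkk : (k : ℝ) = sk * sk := (Real.mul_self_sqrt (Nat.cast_nonneg k)).symm
  have hnn : (n : ℝ) = sn * sn := (Real.mul_self_sqrt (Nat.cast_nonneg n)).symm
  have hskn : sk ≤ sn := Real.sqrt_le_sqrt (by exact_mod_cast (by omega : k ≤ n))
  have hP0 : 0 < P := lt_of_le_of_ne (walkProb_nonneg hp _ _) (Ne.symm hn')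
  have hx1 : 1 / sn ≤ x := one_div_sqrt_le_invSqrtSucc (by omega)
  have hy1 : 1 / sn ≤ y := one_div_sqrt_le_invSqrtSucc (by omega)
  have hx2 : x ≤ 2 / sn := invSqrtSucc_le_two_div hn (by omega)
  have hy2 : y ≤ 2 / sn := invSqrtSucc_le_two_div hn (by omega)
  set N := n - k - l with hN
  set R := walkProb p N (N + 1) with hR
  have hR0 : 0 ≤ R := walkProb_nonneg hp _ _
  have hNk : n - k = N + l := by omega
  have hNl : n - l = N + k := by omega
  have hNn : n = N + k + l := by omega
  have hNx : invSqrtSucc N ≤ 2 / sn := invSqrtSucc_le_two_div hn (by omega)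
  have hdk := H.dvd_sub hk (by omega : k ≤ n) hn' hk'
  have hdl := H.dvd_sub hl (by omega : l ≤ n) hn' hl'
  have hdN : d ∣ N + 1 := by
    have h1 := Nat.dvd_sub hdk (H.dvd_pred hl')
    rwa [show n - k - (l - 1) = N + 1 by omega] at h1
  have h1 : |((n - k : ℕ) : ℝ) * (R - q + P - q')| ≤ 8 * C * (sk * sl / sn) := by
    have h2 := H.diff_second N k l hk hl hdN (hNk ▸ hdk) (hNl ▸ hdl) (hNn ▸ H.dvd_pred hn')
    rw [← hNn, ← hNk, ← hNl] at h2
    have e : C * (sk * sl) / √((N : ℝ) + 1) ^ 3 = C * (sk * sl) * invSqrtSucc N ^ 3 := by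
      unfold invSqrtSucc; rw [one_div_pow, mul_one_div]
    rw [e] at h2
    have h3 : invSqrtSucc N ^ 3 ≤ (2 / sn) ^ 3 :=
      pow_le_pow_left₀ (invSqrtSucc_pos N).le hNx 3
    have h5 : ((n - k : ℕ) : ℝ) ≤ sn * sn := by
      rw [← hnn]; exact_mod_cast (by omega : n - k ≤ n)
    rw [abs_mul, Nat.abs_cast]
    calc ((n - k : ℕ) : ℝ) * |R - q + P - q'|
        ≤ (sn * sn) * (C * (sk * sl) * (2 / sn) ^ 3) :=
          mul_le_mul h5 (h2.trans (mul_le_mul_of_nonneg_left h3 (by positivity)))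
            (abs_nonneg _) (by positivity)
      _ = _ := by field_simp; ring
  have h2 : |(1 - (l : ℝ)) * R| ≤ 2 * C * (sk * sl / sn) := by
    have h3 : |1 - (l : ℝ)| ≤ sk * sl := by
      have : (1 : ℝ) ≤ l := by exact_mod_cast hl
      rw [abs_sub_comm, abs_of_nonneg (by linarith), hll]
      have : sl * sl ≤ sk * sl := mul_le_mul_of_nonneg_right hslk (by linarith)
      linarith
    have h5 : R ≤ C * (2 / sn) :=
      (H.walkProb_le N (N + 1)).trans (mul_le_mul_of_nonneg_left hNx hC)
    rw [abs_mul, abs_of_nonneg hR0]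
    refine (mul_le_mul h3 h5 hR0 (by positivity)).trans (le_of_eq ?_)
    ring
  have hDl : |P - q'| ≤ 4 * C * sl / (sn * sn) := by
    rw [abs_sub_comm]
    refine (H.abs_sub_le hp hl (by omega : l ≤ n) hn' hl').trans ?_
    calc 2 * C * sl * y / sn ≤ 2 * C * sl * (2 / sn) / sn := by gcongr
      _ = _ := by field_simp; ring
  have hDk : |q - P| ≤ 4 * C * sk / (sn * sn) := by
    refine (H.abs_sub_le hp hk (by omega : k ≤ n) hn' hk').trans ?_
    calc 2 * C * sk * x / sn ≤ 2 * C * sk * (2 / sn) / sn := by gcongr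
      _ = _ := by field_simp; ring
  have h3 : |(n * (q - P) / P + k) * (P - q')|
      ≤ (4 * C + 16 * C ^ 2 / c) * (sk * sl / sn) := by
    have h5 : |n * (q - P) / P + k| ≤ (4 * C / c + 1) * (sk * sn) := by
      refine (abs_add_le _ _).trans ?_
      rw [Nat.abs_cast, abs_div, abs_mul, Nat.abs_cast, abs_of_pos hP0, div_eq_mul_one_div]
      have h6 : n * |q - P| * (1 / P) ≤ sn * sn * (4 * C * sk / (sn * sn)) * (sn / c) := by
        rw [hnn]
        exact mul_le_mul (mul_le_mul_of_nonneg_left hDk (by positivity))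
          (H.inv_walkProb_le hn hn' hp) (by positivity) (by positivity)
      have h7 : sn * sn * (4 * C * sk / (sn * sn)) * (sn / c) = 4 * C / c * (sk * sn) := by
        field_simp
      have h8 : (k : ℝ) ≤ sk * sn := by
        rw [hkk]; exact mul_le_mul_of_nonneg_left hskn (by positivity)
      linarith
    rw [abs_mul]
    refine (mul_le_mul h5 hDl (abs_nonneg _) (by positivity)).trans (le_of_eq ?_)
    field_simp
    ring
  have e : pairCoeff p n k l + k * q - n * q * q' / P
      = ((n - k : ℕ) : ℝ) * (R - q + P - q') + (n * (q - P) / P + k) * (P - q')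
        + (1 - (l : ℝ)) * R := by
    rw [pairCoeff, if_pos (by omega : k + l ≤ n)]
    have e1 : (N : ℝ) = n - k - l := by rw [hNn]; push_cast; ring
    rw [← hN, ← hR, e1, Nat.cast_sub (by omega : k ≤ n)]
    field_simp
    ring
  rw [e]
  refine (abs_add_le _ _).trans ?_
  refine (add_le_add (abs_add_le _ _) le_rfl).trans ?_
  have h6 : sk * sl / sn ≤ sk * sl * sn * x * y := by
    calc sk * sl / sn = sk * sl * sn * (1 / sn) * (1 / sn) := by field_simp
      _ ≤ _ := by gcongr
  have h7 := mul_le_mul_of_nonneg_left h6 (show 0 ≤ 14 * C + 16 * C ^ 2 / c by positivity)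
  refine le_trans ?_ h7
  rw [add_mul] at h3 ⊢
  linarith

theorem abs_kernel_le (hp : ∀ i, 0 ≤ p i) {n k l : ℕ} (hl : 1 ≤ l) (hlk : l ≤ k)
    (hkn : k ≤ n) (hn' : walkProb p n (n - 1) ≠ 0)
    (hk' : walkProb p k (k - 1) ≠ 0) (hl' : walkProb p l (l - 1) ≠ 0) :
    |pairCoeff p n k l + k * walkProb p (n - k) (n - k)
        - n * walkProb p (n - k) (n - k) * walkProb p (n - l) (n - l) / walkProb p n (n - 1)|
      ≤ (14 * C + 16 * C ^ 2 / c) *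
        (√(k : ℝ) * √(l : ℝ) * √(n : ℝ) * invSqrtSucc (n - k) * invSqrtSucc (n - l)) := by
  rcases le_or_gt n (4 * k) with h | h
  · refine (H.abs_kernel_le_of_large hp hl hlk hkn h hn' hk' hl').trans ?_
    have hC := H.C_nonneg
    have hc := H.c_pos
    have h1 := (invSqrtSucc_pos (n - k)).le
    have h2 := (invSqrtSucc_pos (n - l)).le
    refine mul_le_mul_of_nonneg_right ?_ (by positivity)
    have h3 : 4 * C ^ 2 / c ≤ 16 * C ^ 2 / c := by gcongr; norm_num
    linarith
  · exact H.abs_kernel_le_of_small hp hl hlk h hn' hk' hl'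

end LocalLimitBounds

/-! ### Variance bounds for weighted sums over trees -/

theorem treeSum_eq_zero_of_one {p : ℕ → ℝ} (hp : ∀ i, 0 ≤ p i) {n : ℕ}
    (h : treeSum p (fun _ => 1) n = 0) (f : PlaneTree → ℝ) : treeSum p f n = 0 := by
  have h1 := (Finset.sum_eq_zero_iff_of_nonneg
    fun T _ => mul_nonneg (T.weight_nonneg hp) zero_le_one).1 h
  exact Finset.sum_eq_zero fun T hT => by
    rw [show T.weight p = 0 by simpa using h1 T hT, zero_mul]

namespace LocalLimitBounds

variable {p : ℕ → ℝ} {d : ℕ} {c C : ℝ} (H : LocalLimitBounds p d c C)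

include H

/-- The total weight of the trees of size `k` is `O(k ^ (-3 / 2))`. -/
theorem treeSum_one_le {k : ℕ} (hk : 1 ≤ k) :
    treeSum p (fun _ => 1) k ≤ C / (k * √(k : ℝ)) := by
  have h1 := mul_treeSum_one p (by omega : k ≠ 0)
  have h2 := H.upper k (k - 1)
  have hC := H.C_nonneg
  have hk0 : (0 : ℝ) < k := by exact_mod_cast hk
  have hs : 0 < √(k : ℝ) := Real.sqrt_pos.2 hk0
  rw [← div_div, div_right_comm, le_div_iff₀ hk0, mul_comm, h1]
  refine h2.trans ?_
  gcongr
  linarith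

theorem mul_invSqrtSucc_le {n : ℕ} (hn : 1 ≤ n) (hn' : walkProb p n (n - 1) ≠ 0) :
    c * invSqrtSucc n ≤ walkProb p n (n - 1) := by
  refine le_trans ?_ (H.lower n hn hn')
  rw [div_eq_mul_one_div]
  have hc := H.c_pos
  have hs : 0 < √(n : ℝ) := Real.sqrt_pos.2 (by exact_mod_cast hn)
  unfold invSqrtSucc
  gcongr
  linarith

/-- The second moment of a functional whose toll function has conditional mean `0` for every size.
Disjoint fringe subtrees are then uncorrelated, and what remains is a sum over the nested pairs,
that is, over `f(T_v) F(T_v)`. By the Cauchy-Schwarz inequality this contains the second moments of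
`F` for the smaller sizes, which are bounded by induction. -/
theorem treeSum_sq_le_of_centred (hp : ∀ i, 0 ≤ p i) (hp0 : p 0 ≠ 0) {g : PlaneTree → ℝ}
    (hg : ∀ k, treeSum p g k = 0) {s : ℕ → ℝ} {B : ℝ} {n : ℕ} (hs : ∀ k, 0 ≤ s k)
    (hgs : ∀ k, treeSum p (fun T => g T ^ 2) k ≤ treeSum p (fun _ => 1) k * s k ^ 2)
    (hB : ∀ k ≤ n, s k ≤ B) (hsum : ∑ k ∈ Finset.range (n + 1), s k / k ≤ B) :
    treeSum p (fun T => additiveFunctional g T ^ 2) n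
      ≤ (12 * C ^ 2 / c * B) ^ 2 * (n * treeSum p (fun _ => 1) n) := by
  have hC := H.C_nonneg
  have hc := H.c_pos
  have hB0 : 0 ≤ B := (hs 0).trans (hB 0 (Nat.zero_le n))
  set π := treeSum p fun _ => 1 with hπ
  have hπ0 : ∀ k, 0 ≤ π k := fun k => treeSum_nonneg hp fun _ _ => zero_le_one
  set V : ℕ → ℝ := treeSum p fun T => additiveFunctional g T ^ 2 with hV
  -- `6` is the constant of `sum_div_mul_invSqrtSucc_le`, doubled because nested pairs count twice
  set Kc := 12 * C ^ 2 / c * B with hKc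
  have hKc0 : 0 ≤ Kc := by positivity
  suffices h : ∀ m ≤ n, V m ≤ Kc ^ 2 * (m * π m) from h n le_rfl
  intro m
  induction m using Nat.strong_induction_on with
  | _ m ih =>
  intro hmn
  by_cases hm0 : π m = 0
  · rw [show V m = 0 from treeSum_eq_zero_of_one hp hm0 _, hm0, mul_zero, mul_zero]
  have hm1 : 1 ≤ m := by
    rw [Nat.one_le_iff_ne_zero]
    rintro rfl
    exact hm0 (treeSum_zero_size p _)
  have hmpos : (0 : ℝ) < m := by exact_mod_cast hm1
  have hP := mul_treeSum_one p (by omega : m ≠ 0)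
  have hP' : walkProb p m (m - 1) ≠ 0 := by
    rw [← hP]; exact mul_ne_zero hmpos.ne' hm0
  have hPpos : 0 < m * π m := mul_pos hmpos (lt_of_le_of_ne (hπ0 m) (Ne.symm hm0))
  set x := √(V m / (m * π m)) with hx
  have hVnn : 0 ≤ V m := treeSum_nonneg hp fun T _ => sq_nonneg _
  have hVx : V m = x ^ 2 * (m * π m) := by
    rw [hx, Real.sq_sqrt (by positivity), div_mul_cancel₀ _ hPpos.ne']
  have hx0 : 0 ≤ x := Real.sqrt_nonneg _
  -- the term with `k = m` contains the second moment for `m` itself, which is why `x` occurs here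
  set y := max x Kc with hy
  have hy0 : 0 ≤ y := le_max_of_le_left hx0
  have hVk : ∀ k ≤ m, V k ≤ y ^ 2 * (k * π k) := by
    intro k hk
    have hkπ : 0 ≤ (k : ℝ) * π k := mul_nonneg (Nat.cast_nonneg k) (hπ0 k)
    rcases hk.lt_or_eq with h | rfl
    · refine (ih k h (by omega)).trans (mul_le_mul_of_nonneg_right ?_ hkπ)
      exact pow_le_pow_left₀ hKc0 (le_max_right _ _) 2
    · rw [hVx]
      exact mul_le_mul_of_nonneg_right (pow_le_pow_left₀ hx0 (le_max_left _ _) 2) hkπ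
  -- the nested pairs with upper tree of size `k`
  have hterm : ∀ k ∈ Finset.range (m + 1), walkProb p (m - k) (m - k)
      * treeSum p (fun T => g T * (2 * additiveFunctional g T - g T)) k
      ≤ 2 * C ^ 2 * y * (s k / k * invSqrtSucc (m - k)) := by
    intro k hk
    rw [Finset.mem_range] at hk
    rcases Nat.eq_zero_or_pos k with rfl | hk1
    · rw [treeSum_zero_size]; simp
    have hkpos : (0 : ℝ) < k := by exact_mod_cast hk1
    have hsk : 0 < √(k : ℝ) := Real.sqrt_pos.2 hkpos
    have h1 : treeSum p (fun T => g T * (2 * additiveFunctional g T - g T)) k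
        ≤ 2 * treeSum p (fun T => g T * additiveFunctional g T) k := by
      rw [← treeSum_const_mul]
      exact treeSum_mono hp fun T _ => by nlinarith [sq_nonneg (g T)]
    have h2 : treeSum p (fun T => g T * additiveFunctional g T) k
        ≤ π k * √(k : ℝ) * (s k * y) := by
      refine le_of_sq_le_sq ?_ (by have := hπ0 k; have := hs k; positivity)
      calc _ ≤ _ := treeSum_mul_le hp g (additiveFunctional g) k
        _ ≤ (π k * s k ^ 2) * (y ^ 2 * (k * π k)) :=
          mul_le_mul (hgs k) (hVk k (by omega)) (treeSum_nonneg hp fun T _ => sq_nonneg _)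
            (mul_nonneg (hπ0 k) (sq_nonneg _))
        _ = (π k * √(k : ℝ) * (s k * y)) ^ 2 := by
          rw [mul_pow, mul_pow, Real.sq_sqrt hkpos.le]; ring
    have h3 : π k * √(k : ℝ) ≤ C / k := by
      have := mul_le_mul_of_nonneg_right (H.treeSum_one_le hk1) hsk.le
      refine this.trans (le_of_eq ?_)
      field_simp
    have h4 : treeSum p (fun T => g T * (2 * additiveFunctional g T - g T)) k
        ≤ 2 * (C / k * (s k * y)) := by
      have := mul_le_mul_of_nonneg_right h3 (mul_nonneg (hs k) hy0)
      linarith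
    have h5 : 0 ≤ 2 * (C / k * (s k * y)) := by have := hs k; positivity
    calc _ ≤ walkProb p (m - k) (m - k) * (2 * (C / k * (s k * y))) :=
          mul_le_mul_of_nonneg_left h4 (walkProb_nonneg hp _ _)
      _ ≤ C * invSqrtSucc (m - k) * (2 * (C / k * (s k * y))) :=
          mul_le_mul_of_nonneg_right (H.walkProb_le _ _) h5
      _ = _ := by ring
  have hmain : V m ≤ Kc * y * (m * π m) := by
    have h1 := treeSum_additiveFunctional_sq hp0 g m
    simp only [hg, mul_zero, Finset.sum_const_zero, add_zero] at h1
    have h2 := Finset.sum_le_sum hterm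
    rw [← Finset.mul_sum] at h2
    have hsum' : ∑ k ∈ Finset.range (m + 1), s k / k ≤ B := by
      refine le_trans (Finset.sum_le_sum_of_subset_of_nonneg ?_ fun k _ _ =>
        div_nonneg (hs k) (Nat.cast_nonneg k)) hsum
      intro k; simp only [Finset.mem_range]; omega
    have h3 := sum_div_mul_invSqrtSucc_le hs (fun k hk => hB k (hk.trans hmn)) hsum'
    have h4 := mul_le_mul_of_nonneg_left h3 (show 0 ≤ 2 * C ^ 2 * y by positivity)
    have h5 := H.mul_invSqrtSucc_le hm1 hP'
    rw [← hP] at h5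
    have h6 := mul_le_mul_of_nonneg_left h5 (show 0 ≤ Kc * y by positivity)
    have h7 : Kc * y * (c * invSqrtSucc m) = 2 * C ^ 2 * y * (6 * B * invSqrtSucc m) := by
      rw [hKc]; field_simp; ring
    have h8 : V m ≤ 2 * C ^ 2 * y * (6 * B * invSqrtSucc m) := by
      rw [hV, h1]; exact h2.trans h4
    linarith
  have hx2 : x ^ 2 ≤ Kc * y := by
    rw [hVx] at hmain
    exact le_of_mul_le_mul_right hmain hPpos
  have hxK : x ≤ Kc := by
    by_contra h
    rw [not_le] at h
    rw [hy, max_eq_left h.le] at hx2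
    nlinarith
  rw [hVx]
  exact mul_le_mul_of_nonneg_right (pow_le_pow_left₀ hx0 hxK 2) hPpos.le

/-- The contribution to the variance of the pairs of fringe subtrees of sizes `k ≥ l`, nested or
disjoint, for a toll function that depends only on the size. -/
theorem abs_covariance_le (hp : ∀ i, 0 ≤ p i) {a s : ℕ → ℝ} {n k l : ℕ} (ha : ∀ k, |a k| ≤ s k)
    (hn' : treeSum p (fun _ => 1) n ≠ 0) (hlk : l ≤ k) (hkn : k ≤ n)
    (hk' : treeSum p (fun _ => 1) k ≠ 0) (hl' : treeSum p (fun _ => 1) l ≠ 0) :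
    |a k * (a l * treeSum p (fun _ => 1) l)
        * (walkProb p (n - k) (n - k) * walkProb p (k - l) (k - l)
          + treeSum p (fun _ => 1) k * (pairCoeff p n k l - walkProb p (n - k) (n - k)
            * walkProb p (n - l) (n - l) / treeSum p (fun _ => 1) n))|
      ≤ 2 * C ^ 3 * (√((k : ℝ) + 1) * (s k / k * invSqrtSucc (n - k))
            * (s l / l * invSqrtSucc (k - l)))
        + C ^ 2 * (14 * C + 16 * C ^ 2 / c) * (√((n : ℝ) + 1) * (s k / k * invSqrtSucc (n - k))
            * (s l / l * invSqrtSucc (n - l))) := by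
  have hC := H.C_nonneg
  have hc := H.c_pos
  have hs : ∀ k, 0 ≤ s k := fun k => (abs_nonneg _).trans (ha k)
  have hl : 1 ≤ l := by
    rw [Nat.one_le_iff_ne_zero]
    rintro rfl
    exact hl' (treeSum_zero_size p _)
  have hk : 1 ≤ k := hl.trans hlk
  have hn : 1 ≤ n := hk.trans hkn
  have hPk := mul_treeSum_one p (by omega : k ≠ 0)
  have hPl := mul_treeSum_one p (by omega : l ≠ 0)
  have hPn := mul_treeSum_one p (by omega : n ≠ 0)
  have hk0 : (0 : ℝ) < k := by exact_mod_cast hk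
  have hl0 : (0 : ℝ) < l := by exact_mod_cast hl
  have hn0 : (0 : ℝ) < n := by exact_mod_cast hn
  have hWk : walkProb p k (k - 1) ≠ 0 := by rw [← hPk]; exact mul_ne_zero hk0.ne' hk'
  have hWl : walkProb p l (l - 1) ≠ 0 := by rw [← hPl]; exact mul_ne_zero hl0.ne' hl'
  have hWn : walkProb p n (n - 1) ≠ 0 := by rw [← hPn]; exact mul_ne_zero hn0.ne' hn'
  have h1 := H.abs_sub_le hp hl hlk hWk hWl
  have h2 := H.abs_kernel_le hp hl hlk hkn hWn hWk hWl
  rw [← hPk] at h1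
  rw [← hPn] at h2
  have hπk := H.treeSum_one_le hk
  have hπl := H.treeSum_one_le hl
  have hπk0 : 0 ≤ treeSum p (fun _ => 1) k := treeSum_nonneg hp fun _ _ => zero_le_one
  have hπl0 : 0 ≤ treeSum p (fun _ => 1) l := treeSum_nonneg hp fun _ _ => zero_le_one
  have hqx := H.walkProb_le (n - k) (n - k)
  have hq0 := walkProb_nonneg hp (n - k) (n - k)
  set πk := treeSum p (fun _ => 1) k
  set πl := treeSum p (fun _ => 1) l
  set πn := treeSum p (fun _ => 1) n
  set q := walkProb p (n - k) (n - k)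
  set q' := walkProb p (n - l) (n - l)
  set q₀ := walkProb p (k - l) (k - l)
  set x := invSqrtSucc (n - k)
  set y := invSqrtSucc (n - l)
  set z := invSqrtSucc (k - l)
  have hx0 : 0 < x := invSqrtSucc_pos _
  have hy0 : 0 < y := invSqrtSucc_pos _
  have hz0 : 0 < z := invSqrtSucc_pos _
  have hsk1 : √(k : ℝ) ≤ √((k : ℝ) + 1) := Real.sqrt_le_sqrt (by linarith)
  have hsn1 : √(n : ℝ) ≤ √((n : ℝ) + 1) := Real.sqrt_le_sqrt (by linarith)
  have hkk : (k : ℝ) = √(k : ℝ) * √(k : ℝ) := (Real.mul_self_sqrt hk0.le).symm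
  set sk := √(k : ℝ)
  set sl := √(l : ℝ)
  set sn := √(n : ℝ)
  have hsk : 0 < sk := Real.sqrt_pos.2 hk0
  have hsl : 0 < sl := Real.sqrt_pos.2 hl0
  set C₃ := 14 * C + 16 * C ^ 2 / c
  have hC₃ : 0 ≤ C₃ := by positivity
  have e : q * q₀ + πk * (pairCoeff p n k l - q * q' / πn)
      = q * (q₀ - k * πk) + πk * (pairCoeff p n k l + k * q - n * q * q' / (n * πn)) := by
    field_simp
    ring
  have hD : |q * q₀ + πk * (pairCoeff p n k l - q * q' / πn)|
      ≤ (C * x) * (2 * C * sl * z / sk) + C / (k * sk) * (C₃ * (sk * sl * sn * x * y)) := by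
    rw [e]
    refine (abs_add_le _ _).trans ?_
    rw [abs_mul, abs_of_nonneg hq0, abs_mul, abs_of_nonneg hπk0]
    exact add_le_add (mul_le_mul hqx h1 (abs_nonneg _) (by positivity))
      (mul_le_mul hπk h2 (abs_nonneg _) (by positivity))
  have hA : |a k * (a l * πl)| ≤ s k * (s l * (C / (l * sl))) := by
    rw [abs_mul, abs_mul, abs_of_nonneg hπl0]
    have := hs l
    exact mul_le_mul (ha k) (mul_le_mul (ha l) hπl hπl0 (hs l)) (by positivity) (hs k)
  rw [abs_mul]
  have hsk' := hs k
  have hsl' := hs l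
  refine (mul_le_mul hA hD (abs_nonneg _) (by positivity)).trans ?_
  have e2 : s k * (s l * (C / (l * sl))) * ((C * x) * (2 * C * sl * z / sk)
        + C / (k * sk) * (C₃ * (sk * sl * sn * x * y)))
      = 2 * C ^ 3 * (sk * (s k / k * x) * (s l / l * z))
        + C ^ 2 * C₃ * (sn * (s k / k * x) * (s l / l * y)) := by
    rw [hkk]
    field_simp
  rw [e2]
  gcongr

end LocalLimitBounds

/-- A symmetric double sum in terms of the part `l ≤ k`. -/
theorem sum_sum_symm {X : ℕ → ℕ → ℝ} (hX : ∀ k l, X k l = X l k) (S : Finset ℕ) :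
    ∑ k ∈ S, ∑ l ∈ S, X k l
      = 2 * ∑ k ∈ S, ∑ l ∈ S, (if l ≤ k then X k l else 0) - ∑ k ∈ S, X k k := by
  have h1 : ∀ k ∈ S, ∑ l ∈ S, X k l = ∑ l ∈ S, (if l ≤ k then X k l else 0)
      + ∑ l ∈ S, (if k ≤ l then X l k else 0) - X k k := by
    intro k hk
    have h2 : X k k = ∑ l ∈ S, if k = l then X k l else 0 := by
      rw [Finset.sum_ite_eq, if_pos hk]
    conv_rhs => rw [h2]
    rw [← Finset.sum_add_distrib, ← Finset.sum_sub_distrib]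
    refine Finset.sum_congr rfl fun l _ => ?_
    rcases lt_trichotomy k l with h | h | h
    · simp [h.le, not_le.2 h, h.ne, hX k l]
    · simp [h]
    · simp [h.le, not_le.2 h, h.ne']
  rw [Finset.sum_congr rfl h1, Finset.sum_sub_distrib, Finset.sum_add_distrib,
    Finset.sum_comm (f := fun k l => if k ≤ l then X l k else 0)]
  ring

/-- The variance of an additive functional whose toll function depends only on the size. -/
theorem LocalLimitBounds.abs_treeSum_sq_sub_le {p : ℕ → ℝ} {d : ℕ} {c C : ℝ}
    (H : LocalLimitBounds p d c C) (hp : ∀ i, 0 ≤ p i) (hp0 : p 0 ≠ 0) {a s : ℕ → ℝ}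
    {B : ℝ} {n : ℕ} (ha : ∀ k, |a k| ≤ s k)
    (ha0 : ∀ k, treeSum p (fun _ => 1) k = 0 → a k = 0)
    (hn' : treeSum p (fun _ => 1) n ≠ 0)
    (hB : ∀ k ≤ n, s k ≤ B) (hsum : ∑ k ∈ Finset.range (n + 1), s k / k ≤ B) :
    |treeSum p (fun T => additiveFunctional (fun T => a T.size) T ^ 2) n
        - treeSum p (additiveFunctional fun T => a T.size) n ^ 2 / treeSum p (fun _ => 1) n|
      ≤ 108 * (2 * C ^ 3 + C ^ 2 * (14 * C + 16 * C ^ 2 / c)) / c * B ^ 2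
        * (n * treeSum p (fun _ => 1) n) := by
  have hC := H.C_nonneg
  have hc := H.c_pos
  have hs : ∀ k, 0 ≤ s k := fun k => (abs_nonneg _).trans (ha k)
  have hB0 : 0 ≤ B := (hs 0).trans (hB 0 (Nat.zero_le n))
  have hn : 1 ≤ n := by
    rw [Nat.one_le_iff_ne_zero]
    rintro rfl
    exact hn' (treeSum_zero_size p _)
  set C₃ := 14 * C + 16 * C ^ 2 / c with hC₃
  have hC₃0 : 0 ≤ C₃ := by positivity
  set h : PlaneTree → ℝ := fun T => a T.size with hh
  set π := treeSum p fun _ => 1 with hπ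
  set q : ℕ → ℝ := fun m => walkProb p m m with hq
  set S := Finset.range (n + 1) with hS
  have hA : ∀ k, treeSum p h k = a k * π k := by
    intro k
    rw [hπ, ← treeSum_const_mul]
    exact treeSum_congr fun T hT => by simp only [hh, hT, mul_one]
  have hM1 : treeSum p (additiveFunctional h) n = ∑ k ∈ S, q (n - k) * (a k * π k) := by
    rw [treeSum_additiveFunctional]
    exact Finset.sum_congr rfl fun k _ => by rw [hA]
  -- the nested pairs
  set E : ℕ → ℕ → ℝ := fun k l =>
    if l ≤ k then a k * (a l * π l) * (q (n - k) * q (k - l)) else 0 with hE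
  have hnest : ∀ k ∈ S, q (n - k) * treeSum p (fun T => h T * (2 * additiveFunctional h T - h T)) k
      = 2 * ∑ l ∈ S, E k l - a k * (a k * π k) * q (n - k) := by
    intro k hk
    rw [hS, Finset.mem_range] at hk
    have h1 : treeSum p (fun T => h T * (2 * additiveFunctional h T - h T)) k
        = 2 * a k * treeSum p (additiveFunctional h) k + -(a k * a k) * π k := by
      rw [hπ, ← treeSum_const_mul, ← treeSum_const_mul, ← treeSum_add]
      refine treeSum_congr fun T hT => ?_
      simp only [hh, hT]
      ring
    have h2 : ∑ l ∈ S, E k l = a k * q (n - k) * treeSum p (additiveFunctional h) k := by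
      rw [treeSum_additiveFunctional, Finset.mul_sum]
      have hsub : Finset.range (k + 1) ⊆ S := by
        intro l; simp only [hS, Finset.mem_range]; omega
      rw [← Finset.sum_subset hsub]
      · refine Finset.sum_congr rfl fun l hl => ?_
        rw [Finset.mem_range] at hl
        rw [hE, hA]
        simp only []
        rw [if_pos (by omega)]
        ring
      · intro l _ hl
        rw [Finset.mem_range] at hl
        exact if_neg (by omega)
    rw [h1, h2]; ring
  -- the disjoint pairs, after subtraction of the square of the mean
  set X : ℕ → ℕ → ℝ := fun k l =>
    (pairCoeff p n k l - q (n - k) * q (n - l) / π n) * (a k * π k * (a l * π l)) with hX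
  have hXsymm : ∀ k l, X k l = X l k := by
    intro k l
    simp only [hX]
    rw [pairCoeff_comm, mul_comm (q (n - k)), mul_comm (a k * π k)]
  -- both together, for sizes `l ≤ k`
  set Y : ℕ → ℕ → ℝ := fun k l => a k * (a l * π l) * (q (n - k) * q (k - l)
      + π k * (pairCoeff p n k l - q (n - k) * q (n - l) / π n)) with hY
  have hEX : ∀ k l, E k l + (if l ≤ k then X k l else 0) = if l ≤ k then Y k l else 0 := by
    intro k l
    simp only [hE, hX, hY]
    split_ifs
    · ring
    · ring
  have hq0 : q 0 = 1 := by simp only [hq]; rw [walkProb_zero, if_pos rfl]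
  have htotal : treeSum p (fun T => additiveFunctional h T ^ 2) n
      - treeSum p (additiveFunctional h) n ^ 2 / π n
      = 2 * ∑ k ∈ S, ∑ l ∈ S, (if l ≤ k then Y k l else 0) - ∑ k ∈ S, Y k k := by
    have h1 : treeSum p (additiveFunctional h) n ^ 2 / π n = ∑ k ∈ S, ∑ l ∈ S,
        q (n - k) * q (n - l) / π n * (a k * π k * (a l * π l)) := by
      rw [hM1, pow_two, Finset.sum_mul_sum, Finset.sum_div]
      refine Finset.sum_congr rfl fun k _ => ?_
      rw [Finset.sum_div]
      refine Finset.sum_congr rfl fun l _ => ?_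
      ring
    have h2 : ∑ k ∈ S, ∑ l ∈ S, X k l
        = ∑ k ∈ S, ∑ l ∈ S, pairCoeff p n k l * (treeSum p h k * treeSum p h l)
          - treeSum p (additiveFunctional h) n ^ 2 / π n := by
      rw [h1, ← Finset.sum_sub_distrib]
      refine Finset.sum_congr rfl fun k _ => ?_
      rw [← Finset.sum_sub_distrib]
      refine Finset.sum_congr rfl fun l _ => ?_
      rw [hA, hA]
      simp only [hX]
      ring
    have h3 : ∑ k ∈ S, ∑ l ∈ S, (if l ≤ k then Y k l else 0)
        = ∑ k ∈ S, ∑ l ∈ S, E k l + ∑ k ∈ S, ∑ l ∈ S, (if l ≤ k then X k l else 0) := by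
      simp only [← hEX, Finset.sum_add_distrib]
    have h4 : ∑ k ∈ S, Y k k = ∑ k ∈ S, a k * (a k * π k) * q (n - k) + ∑ k ∈ S, X k k := by
      rw [← Finset.sum_add_distrib]
      refine Finset.sum_congr rfl fun k _ => ?_
      simp only [hY, hX, Nat.sub_self, hq0]
      ring
    have h5 := sum_sum_symm hXsymm S
    rw [h2] at h5
    have h6 := treeSum_additiveFunctional_sq hp0 h n
    rw [Finset.sum_congr rfl hnest, Finset.sum_sub_distrib, ← Finset.mul_sum] at h6
    have h7 : ∑ k ∈ S, ∑ l ∈ S, pairCoeff p n k l * (treeSum p h k * treeSum p h l)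
        = ∑ k ∈ S, ∑ l ∈ S, (if k + l ≤ n then
            (((n - k - l : ℕ) : ℝ) + 1) * walkProb p (n - k - l) (n - k - l + 1) else 0)
              * (treeSum p h k * treeSum p h l) := rfl
    rw [← h7] at h6
    linarith
  set u : ℕ → ℝ := fun k => s k / k with hu
  have hu0 : ∀ k, 0 ≤ u k := fun k => div_nonneg (hs k) (Nat.cast_nonneg k)
  have hinv := fun m => (invSqrtSucc_pos m).le
  set Z : ℕ → ℕ → ℝ := fun k l =>
    2 * C ^ 3 * (√((k : ℝ) + 1) * (u k * invSqrtSucc (n - k)) * (u l * invSqrtSucc (k - l)))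
      + C ^ 2 * C₃ * (√((n : ℝ) + 1) * (u k * invSqrtSucc (n - k))
        * (u l * invSqrtSucc (n - l))) with hZ
  have hZ0 : ∀ k l, 0 ≤ Z k l := by
    intro k l
    have := hu0 k
    have := hu0 l
    have := hinv (n - k)
    have := hinv (n - l)
    have := hinv (k - l)
    simp only [hZ]
    positivity
  have hYZ : ∀ k ≤ n, ∀ l ≤ k, |Y k l| ≤ Z k l := by
    intro k hk l hl
    by_cases hk0 : π k = 0
    · simp only [hY, ha0 k hk0, zero_mul, abs_zero]; exact hZ0 k l
    by_cases hl0 : π l = 0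
    · simp only [hY, hl0, mul_zero, zero_mul, abs_zero]; exact hZ0 k l
    exact H.abs_covariance_le hp ha hn' hl hk hk0 hl0
  have hrow : ∀ k ∈ S, ∑ l ∈ S, |if l ≤ k then Y k l else 0|
      ≤ 2 * C ^ 3 * (6 * B * (u k * invSqrtSucc (n - k)))
        + C ^ 2 * C₃ * (6 * B * (u k * invSqrtSucc (n - k))) := by
    intro k hk
    rw [hS, Finset.mem_range] at hk
    have hkn : k ≤ n := by omega
    have hsub : Finset.range (k + 1) ⊆ S := by
      intro l; simp only [hS, Finset.mem_range]; omega
    have hukx : 0 ≤ u k * invSqrtSucc (n - k) := mul_nonneg (hu0 k) (hinv _)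
    have h1 : ∑ l ∈ S, |if l ≤ k then Y k l else 0| ≤ ∑ l ∈ Finset.range (k + 1), Z k l := by
      rw [← Finset.sum_subset hsub]
      · refine Finset.sum_le_sum fun l hl => ?_
        rw [Finset.mem_range] at hl
        rw [if_pos (by omega)]
        exact hYZ k hkn l (by omega)
      · intro l _ hl
        rw [Finset.mem_range] at hl
        rw [if_neg (by omega), abs_zero]
    refine h1.trans ?_
    simp only [hZ]
    rw [Finset.sum_add_distrib, ← Finset.mul_sum, ← Finset.mul_sum, ← Finset.mul_sum,
      ← Finset.mul_sum]
    have hsumk : ∑ l ∈ Finset.range (k + 1), s l / l ≤ B :=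
      (Finset.sum_le_sum_of_subset_of_nonneg hsub fun l _ _ => hu0 l).trans hsum
    have h2 : ∑ l ∈ Finset.range (k + 1), u l * invSqrtSucc (k - l) ≤ 6 * B * invSqrtSucc k :=
      sum_div_mul_invSqrtSucc_le hs (fun l hl => hB l (hl.trans hkn)) hsumk
    have h3 : ∑ l ∈ Finset.range (k + 1), u l * invSqrtSucc (n - l) ≤ 6 * B * invSqrtSucc n :=
      (Finset.sum_le_sum_of_subset_of_nonneg hsub fun l _ _ =>
        mul_nonneg (hu0 l) (hinv _)).trans (sum_div_mul_invSqrtSucc_le hs hB hsum)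
    have h4 : √((k : ℝ) + 1) * (u k * invSqrtSucc (n - k))
        * ∑ l ∈ Finset.range (k + 1), u l * invSqrtSucc (k - l)
        ≤ 6 * B * (u k * invSqrtSucc (n - k)) := by
      refine (mul_le_mul_of_nonneg_left h2 (by positivity)).trans (le_of_eq ?_)
      linear_combination 6 * B * (u k * invSqrtSucc (n - k)) * sqrt_mul_invSqrtSucc k
    have h5 : √((n : ℝ) + 1) * (u k * invSqrtSucc (n - k))
        * ∑ l ∈ Finset.range (k + 1), u l * invSqrtSucc (n - l)
        ≤ 6 * B * (u k * invSqrtSucc (n - k)) := by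
      refine (mul_le_mul_of_nonneg_left h3 (by positivity)).trans (le_of_eq ?_)
      linear_combination 6 * B * (u k * invSqrtSucc (n - k)) * sqrt_mul_invSqrtSucc n
    gcongr
  have hsumY : ∑ k ∈ S, ∑ l ∈ S, |if l ≤ k then Y k l else 0|
      ≤ (2 * C ^ 3 + C ^ 2 * C₃) * (36 * B ^ 2 * invSqrtSucc n) := by
    refine (Finset.sum_le_sum hrow).trans ?_
    have h1 : ∑ k ∈ S, u k * invSqrtSucc (n - k) ≤ 6 * B * invSqrtSucc n :=
      sum_div_mul_invSqrtSucc_le hs hB hsum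
    rw [Finset.sum_add_distrib]
    simp only [← Finset.mul_sum]
    have h2 := mul_le_mul_of_nonneg_left h1 (show 0 ≤ (2 * C ^ 3 + C ^ 2 * C₃) * (6 * B) by positivity)
    refine le_trans (le_of_eq ?_) (h2.trans (le_of_eq ?_))
    · ring
    · ring
  have hdiag : ∑ k ∈ S, |Y k k| ≤ ∑ k ∈ S, ∑ l ∈ S, |if l ≤ k then Y k l else 0| := by
    refine Finset.sum_le_sum fun k hk => ?_
    have := Finset.single_le_sum (f := fun l => |if l ≤ k then Y k l else 0|)
      (fun l _ => abs_nonneg _) hk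
    simpa using this
  have habs : |∑ k ∈ S, ∑ l ∈ S, (if l ≤ k then Y k l else 0)|
      ≤ ∑ k ∈ S, ∑ l ∈ S, |if l ≤ k then Y k l else 0| :=
    (Finset.abs_sum_le_sum_abs _ _).trans
      (Finset.sum_le_sum fun k _ => Finset.abs_sum_le_sum_abs _ _)
  have habs' : |∑ k ∈ S, Y k k| ≤ ∑ k ∈ S, |Y k k| := Finset.abs_sum_le_sum_abs _ _
  rw [htotal]
  have h1 : |2 * ∑ k ∈ S, ∑ l ∈ S, (if l ≤ k then Y k l else 0) - ∑ k ∈ S, Y k k|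
      ≤ 3 * ((2 * C ^ 3 + C ^ 2 * C₃) * (36 * B ^ 2 * invSqrtSucc n)) := by
    refine (abs_sub _ _).trans ?_
    rw [abs_mul, abs_of_nonneg (zero_le_two : (0 : ℝ) ≤ 2)]
    linarith
  refine h1.trans ?_
  have hP := mul_treeSum_one p (by omega : n ≠ 0)
  have hn0 : (n : ℝ) ≠ 0 := by exact_mod_cast (by omega : n ≠ 0)
  have h2 := H.mul_invSqrtSucc_le hn (by rw [← hP]; exact mul_ne_zero hn0 hn')
  rw [← hP] at h2
  have h3 := mul_le_mul_of_nonneg_left h2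
    (show 0 ≤ 108 * (2 * C ^ 3 + C ^ 2 * C₃) / c * B ^ 2 by positivity)
  refine le_trans (le_of_eq ?_) h3
  field_simp
  ring

/-- The variance bound for a general toll function, which is the sum of its conditional mean given
the size and of a toll function with conditional mean `0` for every size. -/
theorem LocalLimitBounds.exists_treeSum_sub_sq_le {p : ℕ → ℝ} {d : ℕ} {c C : ℝ}
    (H : LocalLimitBounds p d c C) (hp : ∀ i, 0 ≤ p i) (hp0 : p 0 ≠ 0) :
    ∃ K : ℝ, 0 ≤ K ∧ ∀ (f : PlaneTree → ℝ) (n : ℕ) (B : ℝ), treeSum p (fun _ => 1) n ≠ 0 →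
      (∀ k ≤ n, √(treeSum p (fun T => f T ^ 2) k / treeSum p (fun _ => 1) k) ≤ B) →
      ∑ k ∈ Finset.range (n + 1),
        √(treeSum p (fun T => f T ^ 2) k / treeSum p (fun _ => 1) k) / k ≤ B →
      ∃ m : ℝ, treeSum p (fun T => (additiveFunctional f T - m) ^ 2) n
        ≤ K * B ^ 2 * (n * treeSum p (fun _ => 1) n) := by
  have hC := H.C_nonneg
  have hc := H.c_pos
  set K₁ := (12 * C ^ 2 / c) ^ 2 with hK₁
  set K₂ := 108 * (2 * C ^ 3 + C ^ 2 * (14 * C + 16 * C ^ 2 / c)) / c with hK₂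
  refine ⟨2 * K₁ + 2 * K₂, by positivity, fun f n B hn hB hsum => ?_⟩
  set π := treeSum p fun _ => 1 with hπ
  have hπ0 : ∀ k, 0 ≤ π k := fun k => treeSum_nonneg hp fun _ _ => zero_le_one
  set s : ℕ → ℝ := fun k => √(treeSum p (fun T => f T ^ 2) k / π k) with hs
  have hs0 : ∀ k, 0 ≤ s k := fun k => Real.sqrt_nonneg _
  have hf0 : ∀ k, 0 ≤ treeSum p (fun T => f T ^ 2) k := fun k => treeSum_nonneg hp fun _ _ => sq_nonneg _
  have hssq : ∀ k, π k * s k ^ 2 = treeSum p (fun T => f T ^ 2) k := by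
    intro k
    by_cases h : π k = 0
    · rw [h, zero_mul, treeSum_eq_zero_of_one hp h]
    · rw [hs]
      simp only []
      rw [Real.sq_sqrt (div_nonneg (hf0 k) (hπ0 k)), mul_div_cancel₀ _ h]
  set a : ℕ → ℝ := fun k => treeSum p f k / π k with ha
  have haπ : ∀ k, a k * π k = treeSum p f k := by
    intro k
    by_cases h : π k = 0
    · rw [h, mul_zero, treeSum_eq_zero_of_one hp h]
    · rw [ha]; simp only []; rw [div_mul_cancel₀ _ h]
  have ha0 : ∀ k, π k = 0 → a k = 0 := fun k h => by rw [ha]; simp only []; rw [h, div_zero]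
  have has : ∀ k, |a k| ≤ s k := by
    intro k
    refine Real.abs_le_sqrt ?_
    by_cases h : π k = 0
    · rw [ha0 k h]
      simpa using div_nonneg (hf0 k) (hπ0 k)
    · have hpos : 0 < π k := lt_of_le_of_ne (hπ0 k) (Ne.symm h)
      have h1 := treeSum_mul_le hp f (fun _ => 1) k
      simp only [mul_one, one_pow] at h1
      rw [← hπ] at h1
      rw [ha]
      simp only []
      rw [div_pow, div_le_div_iff₀ (by positivity) hpos]
      nlinarith
  set h : PlaneTree → ℝ := fun T => a T.size with hh
  set g : PlaneTree → ℝ := fun T => f T - h T with hg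
  have hg0 : ∀ k, treeSum p g k = 0 := by
    intro k
    have h1 : treeSum p g k = treeSum p f k + -a k * π k := by
      rw [hπ, ← treeSum_const_mul, ← treeSum_add]
      refine treeSum_congr fun T hT => ?_
      simp only [hg, hh, hT]
      ring
    rw [h1, ← haπ]; ring
  have hgs : ∀ k, treeSum p (fun T => g T ^ 2) k ≤ π k * s k ^ 2 := by
    intro k
    have h1 : treeSum p (fun T => g T ^ 2) k
        = treeSum p (fun T => f T ^ 2) k + (-2 * a k * treeSum p f k + a k ^ 2 * π k) := by
      rw [hπ, ← treeSum_const_mul, ← treeSum_const_mul, ← treeSum_add, ← treeSum_add]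
      refine treeSum_congr fun T hT => ?_
      simp only [hg, hh, hT]
      ring
    rw [h1, hssq, ← haπ]
    nlinarith [mul_nonneg (sq_nonneg (a k)) (hπ0 k)]
  have hcent := H.treeSum_sq_le_of_centred hp hp0 hg0 hs0 hgs hB hsum
  have hsize := H.abs_treeSum_sq_sub_le hp hp0 has ha0 hn hB hsum
  rw [← hπ] at hcent hsize
  set M := treeSum p (additiveFunctional h) n with hM
  refine ⟨M / π n, ?_⟩
  have hF : ∀ T, additiveFunctional f T = additiveFunctional g T + additiveFunctional h T := by
    intro T
    rw [← additiveFunctional_add]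
    congr 1; ext T; simp only [hg]; ring
  have h1 : treeSum p (fun T => (additiveFunctional f T - M / π n) ^ 2) n
      ≤ 2 * treeSum p (fun T => additiveFunctional g T ^ 2) n
        + 2 * treeSum p (fun T => (additiveFunctional h T - M / π n) ^ 2) n := by
    rw [← treeSum_const_mul, ← treeSum_const_mul, ← treeSum_add]
    refine treeSum_mono hp fun T _ => ?_
    rw [hF]
    nlinarith [sq_nonneg (additiveFunctional g T - (additiveFunctional h T - M / π n))]
  have h2 : treeSum p (fun T => (additiveFunctional h T - M / π n) ^ 2) n
      = treeSum p (fun T => additiveFunctional h T ^ 2) n - M ^ 2 / π n := by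
    have h3 : treeSum p (fun T => (additiveFunctional h T - M / π n) ^ 2) n
        = treeSum p (fun T => additiveFunctional h T ^ 2) n
          + (-2 * (M / π n) * M + (M / π n) ^ 2 * π n) := by
      rw [hM, hπ, ← treeSum_const_mul, ← treeSum_const_mul, ← treeSum_add, ← treeSum_add]
      exact treeSum_congr fun T _ => by ring
    rw [h3]
    field_simp
    ring
  have h3 := (le_abs_self _).trans hsize
  rw [← h2] at h3
  have e1 : (12 * C ^ 2 / c * B) ^ 2 = K₁ * B ^ 2 := by rw [hK₁]; ring
  rw [e1] at hcent
  linarith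

/-! ### The law of the conditioned Galton-Watson tree -/

namespace PlaneTree

instance : DiscreteMeasurableSpace PlaneTree := ⟨fun _ => trivial⟩

/-- The addresses of the nodes of a plane tree. -/
def addresses : PlaneTree → Finset (List ℕ)
  | node d c => insert [] (Finset.univ.biUnion fun i : Fin d =>
      (addresses (c i)).image fun v => (i : ℕ) :: v)

/-- The number of children of the node with the given address, and `0` if there is no such
node. -/
def childCount : PlaneTree → List ℕ → ℕ
  | node d _, [] => d
  | node d c, i :: v => if h : i < d then childCount (c ⟨i, h⟩) v else 0

theorem isFamilyTree_iff (T : PlaneTree) (ω : List ℕ → ℕ) :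
    T.IsFamilyTree ω ↔ ∀ v ∈ T.addresses, ω v = T.childCount v := by
  induction T generalizing ω with
  | node d c ih =>
    simp only [IsFamilyTree, ih, addresses, Finset.mem_insert, Finset.mem_biUnion,
      Finset.mem_univ, true_and, Finset.mem_image, forall_eq_or_imp, childCount]
    refine and_congr_right fun _ => ⟨?_, fun h i v hv => ?_⟩
    · rintro h _ ⟨i, v, hv, rfl⟩
      rw [childCount, dif_pos i.2]
      exact h i v hv
    · rw [h _ ⟨i, v, hv, rfl⟩, childCount, dif_pos i.2]

theorem prod_addresses {M : Type*} [CommMonoid M] (d : ℕ) (c : Fin d → PlaneTree)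
    (g : ℕ → M) :
    ∏ v ∈ (node d c).addresses, g ((node d c).childCount v)
      = g d * ∏ i, ∏ v ∈ (c i).addresses, g ((c i).childCount v) := by
  rw [addresses, Finset.prod_insert (by simp), Finset.prod_biUnion]
  · congr 1
    refine Finset.prod_congr rfl fun i _ => ?_
    rw [Finset.prod_image (by intro v _ w _ h; simpa using h)]
    exact Finset.prod_congr rfl fun v _ => by rw [childCount, dif_pos i.2]
  · intro i _ j _ hij
    rw [Function.onFun, Finset.disjoint_left]
    rintro v hv hw
    simp only [Finset.mem_image] at hv hw
    obtain ⟨a, -, rfl⟩ := hv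
    obtain ⟨b, -, h⟩ := hw
    exact hij (Fin.ext (List.cons.inj h).1.symm)

theorem prod_addresses_eq_weight (ν : Measure ℕ) [IsProbabilityMeasure ν] (T : PlaneTree) :
    ∏ v ∈ T.addresses, ν {T.childCount v}
      = ENNReal.ofReal (T.weight fun i => ν.real {i}) := by
  induction T with
  | node d c ih =>
    rw [prod_addresses d c fun k => ν {k}, weight, ENNReal.ofReal_mul measureReal_nonneg,
      ENNReal.ofReal_prod_of_nonneg fun i _ => weight_nonneg (fun _ => measureReal_nonneg) _,
      ofReal_measureReal]
    simp only [ih]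

end PlaneTree

section

variable (ν : Measure ℕ) [IsProbabilityMeasure ν]

theorem offspringMeasure_isFamilyTree (T : PlaneTree) :
    offspringMeasure ν {ω | T.IsFamilyTree ω}
      = ENNReal.ofReal (T.weight fun i => ν.real {i}) := by
  have h : {ω : List ℕ → ℕ | T.IsFamilyTree ω}
      = Set.pi (T.addresses : Set (List ℕ)) fun v => {T.childCount v} := by
    ext ω
    simp [isFamilyTree_iff, Set.mem_pi]
  rw [h, offspringMeasure, Measure.infinitePi_pi _ fun v _ => measurableSet_singleton _,
    prod_addresses_eq_weight]

theorem galtonWatson_apply_inter (n : ℕ) (E : Set PlaneTree) :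
    galtonWatson ν ({T | T.size = n} ∩ E) = ∑ T ∈ treesOfSize n,
      ENNReal.ofReal (T.weight fun i => ν.real {i}) * E.indicator 1 T := by
  rw [galtonWatson, Measure.sum_apply _ (MeasurableSet.of_discrete), tsum_eq_sum
    (s := treesOfSize n)]
  · refine Finset.sum_congr rfl fun T hT => ?_
    rw [Measure.smul_apply, offspringMeasure_isFamilyTree, smul_eq_mul,
      Measure.dirac_apply' _ MeasurableSet.of_discrete]
    rw [mem_treesOfSize] at hT
    have h : T ∈ {T : PlaneTree | T.size = n} ∩ E ↔ T ∈ E := and_iff_right hT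
    congr 1
    by_cases hE : T ∈ E
    · rw [Set.indicator_of_mem hE, Set.indicator_of_mem (h.2 hE)]
    · rw [Set.indicator_of_notMem hE, Set.indicator_of_notMem fun h1 => hE (h.1 h1)]
  · intro T hT
    rw [mem_treesOfSize] at hT
    rw [Measure.smul_apply, Measure.dirac_apply' _ MeasurableSet.of_discrete]
    simp [hT]

theorem galtonWatson_size (n : ℕ) : galtonWatson ν {T | T.size = n}
    = ENNReal.ofReal (treeSum (fun i => ν.real {i}) (fun _ => 1) n) := by
  have h := galtonWatson_apply_inter ν n Set.univ
  rw [Set.inter_univ] at h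
  rw [h, treeSum, ENNReal.ofReal_sum_of_nonneg]
  · simp
  · exact fun T _ => mul_nonneg (T.weight_nonneg fun _ => measureReal_nonneg) zero_le_one

theorem mem_admissibleSizes {n : ℕ} : n ∈ admissibleSizes ν
    ↔ treeSum (fun i => ν.real {i}) (fun _ => 1) n ≠ 0 := by
  rw [admissibleSizes, Set.mem_ofPred_eq, galtonWatson_size, ENNReal.ofReal_pos]
  have h : 0 ≤ treeSum (fun i => ν.real {i}) (fun _ => 1) n :=
    treeSum_nonneg (fun _ => measureReal_nonneg) fun _ _ => zero_le_one
  exact ⟨fun h => h.ne', fun h1 => lt_of_le_of_ne h (Ne.symm h1)⟩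

/-- The law of the conditioned tree is supported by finitely many trees. -/
theorem conditionedGaltonWatson_eq_sum {n : ℕ} (hn : n ∈ admissibleSizes ν) :
    conditionedGaltonWatson ν n = ∑ T ∈ treesOfSize n,
      ENNReal.ofReal ((T.weight fun i => ν.real {i})
        / treeSum (fun i => ν.real {i}) (fun _ => 1) n) • Measure.dirac T := by
  rw [mem_admissibleSizes] at hn
  have h : 0 < treeSum (fun i => ν.real {i}) (fun _ => 1) n :=
    lt_of_le_of_ne (treeSum_nonneg (fun _ => measureReal_nonneg) fun _ _ => zero_le_one)
      (Ne.symm hn)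
  ext E hE
  rw [conditionedGaltonWatson, cond_apply MeasurableSet.of_discrete, galtonWatson_apply_inter,
    galtonWatson_size, Measure.finsetSum_apply, Finset.mul_sum]
  refine Finset.sum_congr rfl fun T _ => ?_
  rw [Measure.smul_apply, smul_eq_mul, Measure.dirac_apply' _ hE, ENNReal.ofReal_div_of_pos h,
    div_eq_mul_inv, mul_left_comm, mul_assoc]

theorem integral_conditionedGaltonWatson {n : ℕ} (hn : n ∈ admissibleSizes ν)
    (f : PlaneTree → ℝ) :
    ∫ T, f T ∂conditionedGaltonWatson ν n
      = treeSum (fun i => ν.real {i}) f n / treeSum (fun i => ν.real {i}) (fun _ => 1) n := by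
  rw [conditionedGaltonWatson_eq_sum ν hn, integral_finsetSum_measure]
  · have h : treeSum (fun i => ν.real {i}) f n
        = ∑ T ∈ treesOfSize n, T.weight (fun i => ν.real {i}) * f T := rfl
    rw [h, Finset.sum_div]
    refine Finset.sum_congr rfl fun T _ => ?_
    rw [integral_smul_measure, integral_dirac, ENNReal.toReal_ofReal, smul_eq_mul]
    · ring
    · exact div_nonneg (T.weight_nonneg fun _ => measureReal_nonneg)
        (treeSum_nonneg (fun _ => measureReal_nonneg) fun _ _ => zero_le_one)
  · exact fun T _ => (integrable_dirac (by simp)).smul_measure ENNReal.ofReal_ne_top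

theorem isProbabilityMeasure_conditionedGaltonWatson {n : ℕ} (hn : n ∈ admissibleSizes ν) :
    IsProbabilityMeasure (conditionedGaltonWatson ν n) :=
  cond_isProbabilityMeasure_of_finite (ne_of_gt hn)
    (by rw [galtonWatson_size]; exact ENNReal.ofReal_ne_top)

theorem variance_conditionedGaltonWatson_le {n : ℕ} (hn : n ∈ admissibleSizes ν)
    (F : PlaneTree → ℝ) (m : ℝ) :
    Var[F; conditionedGaltonWatson ν n]
      ≤ treeSum (fun i => ν.real {i}) (fun T => (F T - m) ^ 2) n
        / treeSum (fun i => ν.real {i}) (fun _ => 1) n := by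
  have := isProbabilityMeasure_conditionedGaltonWatson ν hn
  have hF : AEStronglyMeasurable F (conditionedGaltonWatson ν n) :=
    (Measurable.of_discrete (f := F)).aestronglyMeasurable
  rw [← integral_conditionedGaltonWatson ν hn, ← variance_sub_const hF m]
  exact variance_le_expectation_sq (hF.sub aestronglyMeasurable_const)

end

theorem mainTheorem5 (ν : Measure ℕ) [IsProbabilityMeasure ν]
    (hfin : MemLp (fun k : ℕ => (k : ℝ)) 2 ν)
    (hmean : ∫ k : ℕ, (k : ℝ) ∂ν = 1)
    (hvar : 0 < Var[fun k : ℕ => (k : ℝ); ν]) :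
    ∃ C : ℝ≥0, ∀ (f : PlaneTree → ℝ), ∀ n ∈ admissibleSizes ν,
      ENNReal.ofReal √(Var[PlaneTree.additiveFunctional f; conditionedGaltonWatson ν n]) ≤
        (C : ℝ≥0∞) * ENNReal.ofReal √(n : ℝ) *
          ((⨆ k : admissibleSizes ν,
              ENNReal.ofReal √(∫ T, f T ^ 2 ∂conditionedGaltonWatson ν k)) +
            ∑' k : admissibleSizes ν,
              ENNReal.ofReal (√(∫ T, f T ^ 2 ∂conditionedGaltonWatson ν k) / ((k : ℕ) : ℝ))) := by
  set p : ℕ → ℝ := fun i => ν.real {i} with hp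
  have hp0 : ∀ i, 0 ≤ p i := fun i => measureReal_nonneg
  have hpz : p 0 ≠ 0 := by
    have := measure_zero_ne_zero hfin hmean hvar
    simpa [hp, Measure.real, ENNReal.toReal_eq_zero_iff] using this
  obtain ⟨d, c, C, H⟩ := exists_localLimitBounds hfin hmean hvar
  obtain ⟨K, hK0, hK⟩ := H.exists_treeSum_sub_sq_le hp0 hpz
  refine ⟨(√K + 1).toNNReal, fun f n hn => ?_⟩
  set π := treeSum p fun _ => 1 with hπ
  set s : ℕ → ℝ := fun k => √(treeSum p (fun T => f T ^ 2) k / π k) with hs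
  have hs_eq : ∀ k : admissibleSizes ν, √(∫ T, f T ^ 2 ∂conditionedGaltonWatson ν k) = s k :=
    fun k => by rw [integral_conditionedGaltonWatson ν k.2]
  have hs_zero : ∀ k, k ∉ admissibleSizes ν → s k = 0 := by
    intro k hk
    rw [mem_admissibleSizes, not_not] at hk
    simp only [hs]
    rw [hπ, hk, div_zero, Real.sqrt_zero]
  simp only [hs_eq]
  set R := (⨆ k : admissibleSizes ν, ENNReal.ofReal (s k))
    + ∑' k : admissibleSizes ν, ENNReal.ofReal (s k / ((k : ℕ) : ℝ)) with hR
  have hπn : π n ≠ 0 := (mem_admissibleSizes ν).1 hn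
  have hn0 : n ≠ 0 := by
    rintro rfl
    exact hπn (treeSum_zero_size p _)
  have hnpos : (0 : ℝ) < n := by exact_mod_cast Nat.pos_of_ne_zero hn0
  change _ ≤ ENNReal.ofReal (√K + 1) * _ * _
  by_cases hRtop : R = ∞
  · rw [hRtop, ENNReal.mul_top]
    · exact le_top
    · exact mul_ne_zero (ENNReal.ofReal_pos.2 (by positivity)).ne'
        (ENNReal.ofReal_pos.2 (Real.sqrt_pos.2 hnpos)).ne'
  set B := R.toReal with hBdef
  have hRB : R = ENNReal.ofReal B := (ENNReal.ofReal_toReal hRtop).symm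
  have hB0 : 0 ≤ B := ENNReal.toReal_nonneg
  have hB : ∀ k ≤ n, s k ≤ B := by
    intro k _
    by_cases hk : k ∈ admissibleSizes ν
    · rw [← ENNReal.ofReal_le_ofReal_iff hB0, ← hRB]
      exact (le_iSup (fun k : admissibleSizes ν => ENNReal.ofReal (s k)) ⟨k, hk⟩).trans le_self_add
    · rw [hs_zero k hk]; exact hB0
  have hsum : ∑ k ∈ Finset.range (n + 1), s k / k ≤ B := by
    rw [← ENNReal.ofReal_le_ofReal_iff hB0, ← hRB, ENNReal.ofReal_sum_of_nonneg
      fun k _ => div_nonneg (Real.sqrt_nonneg _) (Nat.cast_nonneg k)]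
    refine le_trans ?_ le_add_self
    rw [tsum_subtype (admissibleSizes ν) fun k => ENNReal.ofReal (s k / (k : ℝ))]
    refine le_trans (le_of_eq (Finset.sum_congr rfl fun k _ => ?_))
      (ENNReal.sum_le_tsum (Finset.range (n + 1)))
    by_cases hk : k ∈ admissibleSizes ν
    · rw [Set.indicator_of_mem hk]
    · rw [Set.indicator_of_notMem hk]
      change ENNReal.ofReal (s k / (k : ℝ)) = 0
      rw [hs_zero k hk, zero_div, ENNReal.ofReal_zero]
  obtain ⟨m, hm⟩ := hK f n B hπn hB hsum
  have hvarle : Var[additiveFunctional f; conditionedGaltonWatson ν n] ≤ K * B ^ 2 * n := by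
    refine (variance_conditionedGaltonWatson_le ν hn _ m).trans ?_
    have hπpos : 0 < π n :=
      lt_of_le_of_ne (treeSum_nonneg hp0 fun _ _ => zero_le_one) (Ne.symm hπn)
    rw [div_le_iff₀ hπpos]
    refine hm.trans (le_of_eq ?_)
    ring
  rw [hRB, ← ENNReal.ofReal_mul (by positivity), ← ENNReal.ofReal_mul (by positivity)]
  refine ENNReal.ofReal_le_ofReal ?_
  calc √(Var[additiveFunctional f; conditionedGaltonWatson ν n]) ≤ √(K * B ^ 2 * n) :=
        Real.sqrt_le_sqrt hvarle
    _ = √K * √(n : ℝ) * B := by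
        rw [Real.sqrt_mul (by positivity), Real.sqrt_mul hK0, Real.sqrt_sq hB0]; ring
    _ ≤ (√K + 1) * √(n : ℝ) * B := by
        gcongr
        linarith
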